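/- Let $(M,\langle\cdot,\cdot\rangle)$ be a non-empty Lorentz surface, i.e. a smooth (Hausdorff) $2$-dimensional manifold with a smooth pseudo-Riemannian metric of index $1$, of constant Gaussian curvature $K\in\{-1,0,1\}$. Notation. On $\mathbb R^n$ let $\langle x,y\rangle_s=\sum_{i\le n-s}x^iy^i-\sum_{i>n-s}x^iy^i$, and let $\mathbb R^n_s$ be $\mathbb R^n$ with this product. Put $\mathbb L^2=\mathbb R^2_1$, $\mathbb S^2_1=\{x\in\mathbb R^3_1:\langle x,x\rangle_1=1\}$ (de Sitter space) and $\mathbb H^2_1=\{x\in\mathbb R^3_2:\langle x,x\rangle_2=-1\}$ (anti-de Sitter space), with the induced metrics. $M$ is locally isometric to $N$ if every point of $M$ has an open neighbourhood isometric to an open subset of $N$. Let $\gamma\colon I\to M$ be a geodesic on an open interval with $\langle\gamma',\gamma'\rangle\equiv\epsilon\in\{1,-1\}$. A Fermi-type coordinate system along $\gamma$ is a smooth map $\mathbf x\colon U\to M$ with everywhere injective differential, where $U\subset\mathbb R\times I$ is open, contains $\{0\}\times I$ and has each slice $J_v=\{u:(u,v)\in U\}$ an interval, such that for each $v\in I$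 the curve $\gamma_v=\mathbf x(\cdot,v)\colon J_v\to M$ is a unit-speed geodesic ($|\langle\gamma_v',\gamma_v'\rangle|=1$) with $\gamma_v(0)=\gamma(v)$ and $\langle\gamma_v'(0),\gamma'(v)\rangle=0$. It is called spacelike if $\epsilon=1$, with parameters written $(u,v)$, and timelike if $\epsilon=-1$, with parameters written $(\tau,\vartheta)$. Then for every $p\in M$ and $w\in T_pM$ with $\langle w,w\rangle=\pm1$ there are injective Fermi-type coordinates along a geodesic $\gamma$ with $0\in I$, $\gamma(0)=p$, $\gamma'(0)=w$, and one and only one of the following holds: (i) $K=0$, $M$ is locally isometric to the Lorentz–Minkowski plane $\mathbb L^2$, and the metric is $ds^2=-du^2+dv^2$ in all spacelike and $ds^2=d\tau^2-d\vartheta^2$ in all timelike Fermi-type coordinates; (ii) $K=1$, $M$ is locally isometric to $\mathbb S^2_1$, and the metric is $ds^2=-du^2+\cosh^2u\,dv^2$ in all spacelike and $ds^2=d\tau^2-\cos^2\tau\,d\vartheta^2$ in all timelike Fermi-type coordinates; (iii) $K=-1$, $M$ is locally isometric to $\mathbb H^2_1$, and the metric is $ds^2=-du^2+\cos^2u\,dv^2$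 in all spacelike and $ds^2=d\tau^2-\cosh^2\tau\,d\vartheta^2$ in all timelike Fermi-type coordinates. Moreover, $M$ is locally isometric to only one of $\mathbb L^2$, $\mathbb S^2_1$, $\mathbb H^2_1$. -/

import Mathlib

open Set
open scoped Manifold ContDiff Bundle

noncomputable section

namespace LorentzSurface

/-- The coordinate plane `ℝ²` on which the charts of a surface take their values. -/
abbrev Plane : Type := EuclideanSpace ℝ (Fin 2)

/-! ### The semi-Euclidean spaces and their quadrics -/

/-- The product `⟨x, y⟩ₛ` of `ℝⁿₛ`: plus signs on the first `n - s` coordinates, minus signs on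
the last `s`. -/
def pair {n : ℕ} (s : ℕ) (x y : Fin n → ℝ) : ℝ :=
  ∑ i : Fin n, (if (i : ℕ) + s < n then (1 : ℝ) else -1) * (x i * y i)

/-- The pseudosphere `𝕊ⁿₛ ⊆ ℝⁿ⁺¹ₛ`. -/
def pseudoSphere (n s : ℕ) : Set (Fin (n + 1) → ℝ) := {x | pair s x x = 1}

/-- The pseudohyperbolic space `ℍⁿₛ ⊆ ℝⁿ⁺¹ₛ₊₁`. -/
def pseudoHyperbolic (n s : ℕ) : Set (Fin (n + 1) → ℝ) := {x | pair (s + 1) x x = -1}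

/-! ### Christoffel symbols and Gaussian curvature in coordinates

Here `h y = (g_ij(y))` is the matrix of the coefficients of a metric in a coordinate system. -/

/-- The partial derivative `∂f/∂uⁱ` at `y`. -/
def partialDeriv (i : Fin 2) (f : Plane → ℝ) (y : Plane) : ℝ :=
  fderiv ℝ f y (EuclideanSpace.single i 1)

/-- `Γᵏᵢⱼ = ½ ∑ᵣ gᵏʳ (∂ⱼ gᵢᵣ + ∂ᵢ gⱼᵣ - ∂ᵣ gᵢⱼ)`. -/
def christoffel (h : Plane → Matrix (Fin 2) (Fin 2) ℝ) (k i j : Fin 2) (y : Plane) : ℝ :=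
  ∑ r : Fin 2, (1 / 2 : ℝ) * (h y)⁻¹ k r *
    (partialDeriv j (fun z => h z i r) y + partialDeriv i (fun z => h z j r) y
      - partialDeriv r (fun z => h z i j) y)

/-- The component along `∂ₗ` of `R(∂ᵢ, ∂ⱼ)∂ₖ = ∇ᵢ∇ⱼ∂ₖ - ∇ⱼ∇ᵢ∂ₖ`. -/
def riemannTensor (h : Plane → Matrix (Fin 2) (Fin 2) ℝ) (l i j k : Fin 2) (y : Plane) : ℝ :=
  partialDeriv i (christoffel h l j k) y - partialDeriv j (christoffel h l i k) y
    + ∑ m : Fin 2, (christoffel h m j k y * christoffel h l i m y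
      - christoffel h m i k y * christoffel h l j m y)

/-- The Gaussian (sectional) curvature
`⟨R(∂₁, ∂₂)∂₂, ∂₁⟩ / (⟨∂₁, ∂₁⟩⟨∂₂, ∂₂⟩ - ⟨∂₁, ∂₂⟩²)`. -/
def gaussCurvature (h : Plane → Matrix (Fin 2) (Fin 2) ℝ) (y : Plane) : ℝ :=
  (∑ l : Fin 2, riemannTensor h l 0 1 1 y * h y l 0) / (h y 0 0 * h y 1 1 - h y 0 1 ^ 2)

/-! ### Lorentz metrics on surfaces -/

section

variable (M : Type*) [TopologicalSpace M] [ChartedSpace Plane M] [IsManifold (𝓡 2) ∞ M]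

/-- A smooth Lorentz metric on a surface. On a plane, a nondegenerate symmetric bilinear form has
index `1` exactly when it takes both negative and positive values on vectors. -/
structure LorentzMetric where
  val : ∀ p : M, TangentSpace (𝓡 2) p →L[ℝ] TangentSpace (𝓡 2) p →L[ℝ] ℝ
  symm : ∀ (p : M) (X Y : TangentSpace (𝓡 2) p), val p X Y = val p Y X
  nondegenerate : ∀ (p : M) (X : TangentSpace (𝓡 2) p), (∀ Y, val p X Y = 0) → X = 0
  exists_timelike : ∀ p : M, ∃ X : TangentSpace (𝓡 2) p, val p X X < 0
  exists_spacelike : ∀ p : M, ∃ X : TangentSpace (𝓡 2) p, 0 < val p X X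
  contMDiff : ContMDiff (𝓡 2) ((𝓡 2).prod 𝓘(ℝ, Plane →L[ℝ] Plane →L[ℝ] ℝ)) ∞
    (fun p => Bundle.TotalSpace.mk' (Plane →L[ℝ] Plane →L[ℝ] ℝ)
      (E := fun p : M => TangentSpace (𝓡 2) p →L[ℝ] TangentSpace (𝓡 2) p →L[ℝ] ℝ) p (val p))

end

section

variable {M : Type*} [TopologicalSpace M] [ChartedSpace Plane M] [IsManifold (𝓡 2) ∞ M]

/-- The coordinate vector field `∂ᵢ` of the chart `e`, at the point with coordinates `y`. -/
def coordVector (e : OpenPartialHomeomorph M Plane) (i : Fin 2) (y : Plane) :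
    TangentSpace (𝓡 2) (e.symm y) :=
  letI : ChartedSpace Plane Plane := chartedSpaceSelf Plane
  mfderiv 𝓘(ℝ, Plane) (𝓡 2) e.symm y (EuclideanSpace.single i (1 : ℝ) : Plane)

/-- The coefficients `g_ij = ⟨∂ᵢ, ∂ⱼ⟩` of the metric in the chart `e`. -/
def metricCoeff (g : LorentzMetric M) (e : OpenPartialHomeomorph M Plane) (y : Plane) :
    Matrix (Fin 2) (Fin 2) ℝ :=
  Matrix.of fun i j => g.val (e.symm y) (coordVector e i y) (coordVector e j y)

/-- The Gaussian curvature is `K` at every point (computed in any smooth chart around it). -/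
def HasConstantCurvature (g : LorentzMetric M) (K : ℝ) : Prop :=
  ∀ e ∈ IsManifold.maximalAtlas (𝓡 2) ∞ M, ∀ y ∈ e.target,
    gaussCurvature (metricCoeff g e) y = K

/-! ### Local isometries onto open sets of a model -/

/-- Every point of `M` has an open neighbourhood isometric to a (relatively) open set of the regular
surface `S ⊆ ℝⁿₛ`, with the metric induced by `⟨·, ·⟩ₛ`: there is a homeomorphism `φ` from an open
neighbourhood onto an open set of `S`, smooth as a map into `ℝⁿ` and with an inverse that is
locally the restriction of smooth maps defined on open sets of `ℝⁿ`, which preserves the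
metrics. -/
def IsLocallyIsometricTo (g : LorentzMetric M) {n : ℕ} (s : ℕ) (S : Set (Fin n → ℝ)) : Prop :=
  ∀ p : M, ∃ φ : OpenPartialHomeomorph M S,
    p ∈ φ.source ∧
    ContMDiffOn (𝓡 2) 𝓘(ℝ, Fin n → ℝ) ∞ (fun q => (φ q : Fin n → ℝ)) φ.source ∧
    (∀ z ∈ φ.target, ∃ (W : Set (Fin n → ℝ)) (ψ : (Fin n → ℝ) → M),
      IsOpen W ∧ (z : Fin n → ℝ) ∈ W ∧ ContMDiffOn 𝓘(ℝ, Fin n → ℝ) (𝓡 2) ∞ ψ W ∧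
      ∀ z' ∈ φ.target, (z' : Fin n → ℝ) ∈ W → ψ z' = φ.symm z') ∧
    ∀ q ∈ φ.source, ∀ X Y : TangentSpace (𝓡 2) q,
      pair s (mfderiv (𝓡 2) 𝓘(ℝ, Fin n → ℝ) (fun q => (φ q : Fin n → ℝ)) q X : Fin n → ℝ)
        (mfderiv (𝓡 2) 𝓘(ℝ, Fin n → ℝ) (fun q => (φ q : Fin n → ℝ)) q Y : Fin n → ℝ) =
      g.val q X Y

/-! ### Geodesics and Fermi-type coordinates -/

/-- The velocity `γ'(t)`. -/
def velocity (γ : ℝ → M) (t : ℝ) : TangentSpace (𝓡 2) (γ t) :=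
  mfderiv 𝓘(ℝ, ℝ) (𝓡 2) γ t (1 : ℝ)

/-- `γ` is a geodesic on the open interval `J`: it is smooth and satisfies
`ük + ∑ᵢⱼ Γᵏᵢⱼ u̇ⁱ u̇ʲ = 0` in all local coordinates. -/
def IsGeodesicOn (g : LorentzMetric M) (γ : ℝ → M) (J : Set ℝ) : Prop :=
  ContMDiffOn 𝓘(ℝ, ℝ) (𝓡 2) ∞ γ J ∧
  ∀ e ∈ IsManifold.maximalAtlas (𝓡 2) ∞ M, ∀ t ∈ J, γ t ∈ e.source → ∀ k : Fin 2,
    deriv (deriv fun r => e (γ r) k) t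
      + ∑ i : Fin 2, ∑ j : Fin 2, christoffel (metricCoeff g e) k i j (e (γ t))
          * deriv (fun r => e (γ r) i) t * deriv (fun r => e (γ r) j) t = 0

/-- `x(u, v) = γᵥ(u)`, defined on the open set `U`, is a (regular) Fermi-type parametrisation along
the geodesic `γ : I → M` with `⟨γ', γ'⟩ = ε`. It is spacelike for `ε = 1`, timelike for
`ε = -1`. -/
structure IsFermi (g : LorentzMetric M) (ε : ℝ) (I : Set ℝ) (γ : ℝ → M)
    (U : Set (ℝ × ℝ)) (x : ℝ × ℝ → M) : Prop where
  isOpen_interval : IsOpen I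
  ordConnected_interval : I.OrdConnected
  geodesic : IsGeodesicOn g γ I
  unit_speed : ∀ v ∈ I, g.val (γ v) (velocity γ v) (velocity γ v) = ε
  isOpen_domain : IsOpen U
  zero_mem : ∀ v ∈ I, (0, v) ∈ U
  snd_mem : ∀ q ∈ U, q.2 ∈ I
  ordConnected_slice : ∀ v ∈ I, {u : ℝ | (u, v) ∈ U}.OrdConnected
  contMDiffOn : ContMDiffOn 𝓘(ℝ, ℝ × ℝ) (𝓡 2) ∞ x U
  slice_geodesic : ∀ v ∈ I, IsGeodesicOn g (fun u => x (u, v)) {u : ℝ | (u, v) ∈ U}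
  slice_unit_speed : ∀ v ∈ I, ∀ u, (u, v) ∈ U →
    |g.val (x (u, v)) (velocity (fun r => x (r, v)) u) (velocity (fun r => x (r, v)) u)| = 1
  slice_start : ∀ v ∈ I, x (0, v) = γ v
  slice_orthogonal : ∀ v ∈ I,
    g.val (x (0, v)) (velocity (fun r => x (r, v)) 0) (velocity (fun r => x (0, r)) v) = 0
  regular : ∀ q ∈ U, Function.Injective (mfderiv 𝓘(ℝ, ℝ × ℝ) (𝓡 2) x q)

/-- The metric expressed in Fermi-type coordinates of causal type `ε` is `E(u) du² + G(u) dv²`: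
through every point `p`, with every velocity `w` such that `⟨w, w⟩ = ε`, there is a geodesic along
which there are (injective) Fermi-type coordinates, and in all Fermi-type coordinates of this type
the coefficients of the metric are `E(u)`, `0` and `G(u)`. -/
def FermiExpression (g : LorentzMetric M) (ε : ℝ) (E G : ℝ → ℝ) : Prop :=
  (∀ (p : M) (w : TangentSpace (𝓡 2) p), g.val p w w = ε →
    ∃ (I : Set ℝ) (γ : ℝ → M) (U : Set (ℝ × ℝ)) (x : ℝ × ℝ → M),
      IsFermi g ε I γ U x ∧ InjOn x U ∧ 0 ∈ I ∧
      (⟨γ 0, velocity γ 0⟩ : TangentBundle (𝓡 2) M) = ⟨p, w⟩) ∧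
  ∀ (I : Set ℝ) (γ : ℝ → M) (U : Set (ℝ × ℝ)) (x : ℝ × ℝ → M), IsFermi g ε I γ U x →
    ∀ q ∈ U,
      g.val (x q) (mfderiv 𝓘(ℝ, ℝ × ℝ) (𝓡 2) x q ((1, 0) : ℝ × ℝ))
        (mfderiv 𝓘(ℝ, ℝ × ℝ) (𝓡 2) x q ((1, 0) : ℝ × ℝ)) = E q.1 ∧
      g.val (x q) (mfderiv 𝓘(ℝ, ℝ × ℝ) (𝓡 2) x q ((1, 0) : ℝ × ℝ))
        (mfderiv 𝓘(ℝ, ℝ × ℝ) (𝓡 2) x q ((0, 1) : ℝ × ℝ)) = 0 ∧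
      g.val (x q) (mfderiv 𝓘(ℝ, ℝ × ℝ) (𝓡 2) x q ((0, 1) : ℝ × ℝ))
        (mfderiv 𝓘(ℝ, ℝ × ℝ) (𝓡 2) x q ((0, 1) : ℝ × ℝ)) = G q.1

end

end LorentzSurface

end

/-! In Fermi-type coordinates the slices `u ↦ x(u, v)` are affine curves as well as geodesics, so
the geodesic equation of the pulled back metric reduces to `∂₀g(∂₀, Z) = ½ ∂_Z g(∂₀, ∂₀)`. Taking `Z
= ∂₀` makes `g₀₀` constant along slices, and then `Z = ∂₁` makes `g₀₁` constant along them (the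
Gauss lemma). The initial values along `γ`, together with the index of the metric, give `-ε du² + G
dv²` with `G = ε` at `u = 0`. Since `γ` is itself a geodesic, `∂₀G = 0` there. For `φ = √(εG)` the
curvature formula becomes the Jacobi equation `φ'' = εKφ` with `φ(0) = 1`, `φ'(0) = 0`, so `φ` is
`1`, `cosh` or `cos` according to the sign of `εK`. This is `eq_of_curvature_equation` and
`IsFermi.metric_eq`.

Existence of the coordinates (`exists_isFermi`) comes from following geodesics orthogonal to a base
geodesic. It requires solutions of an ordinary differential equation to depend smoothly on time and
initial values. This is obtained in `ContDiffOn.exists_local_flow` from the implicit function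
theorem in the Banach space of continuous functions on `[-1, 1]`, applied to the Picard operator.

Each model surface has a global parametrisation whose metric has the same form `-ε du² + ε S(u)²
dv²`, with `S = 1` or `S = cosh`. Composing a Fermi-type chart of `M` with the parametrisation gives
the local isometries (`isLocallyIsometricTo_of_charts`). Conversely, a local isometry into a model
makes the model parametrisation a parametrisation of a piece of `M`, whose curvature can be computed
(`curvature_eq_of_isLocallyIsometricTo`). Hence the model determines `K`, and no two models can
occur together. -/

open Filter Topology

/-! ### Superposition operators on spaces of continuous functions -/

section SmoothFlow

universe u

namespace ContinuousMap

variable {X : Type*} [TopologicalSpace X] [CompactSpace X]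
  {E F G : Type u} [NormedAddCommGroup E] [NormedSpace ℝ E] [NormedAddCommGroup F]
  [NormedSpace ℝ F] [NormedAddCommGroup G] [NormedSpace ℝ G]

/-- Pointwise application of a continuous bilinear map to continuous functions, as a continuous
bilinear map. -/
noncomputable def pointwiseBilin (B : G →L[ℝ] E →L[ℝ] F) : C(X, G) →L[ℝ] C(X, E) →L[ℝ] C(X, F) :=
  LinearMap.mkContinuous₂
    (LinearMap.mk₂ ℝ (fun (A : C(X, G)) (η : C(X, E)) =>
        (⟨fun t => B (A t) (η t), by fun_prop⟩ : C(X, F)))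
      (fun _ _ _ => by ext; simp) (fun _ _ _ => by ext; simp)
      (fun _ _ _ => by ext; simp) (fun _ _ _ => by ext; simp)) ‖B‖
    (fun A η => by
      rw [ContinuousMap.norm_le _ (by positivity)]
      intro t
      exact (B (A t)).le_of_opNorm_le_of_le (B.le_of_opNorm_le_of_le le_rfl (A.norm_coe_le_norm t))
        (η.norm_coe_le_norm t))

lemma pointwiseBilin_apply (B : G →L[ℝ] E →L[ℝ] F) (A : C(X, G)) (η : C(X, E)) (t : X) :
    pointwiseBilin B A η t = B (A t) (η t) := rfl

/-- A pointwise bound suffices because the norm is a supremum. It lets a Lipschitz constant of `f`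
bound the derivative of `γ ↦ f ∘ γ`. -/
lemma norm_pointwiseBilin_le (B : G →L[ℝ] E →L[ℝ] F) (A : C(X, G)) {c : ℝ} (hc : 0 ≤ c)
    (h : ∀ t, ‖B (A t)‖ ≤ c) : ‖pointwiseBilin B A‖ ≤ c := by
  refine ContinuousLinearMap.opNorm_le_bound _ hc fun η => ?_
  rw [ContinuousMap.norm_le _ (by positivity)]
  exact fun t => (B (A t)).le_of_opNorm_le_of_le (h t) (η.norm_coe_le_norm t)

/-- The superposition operator `γ ↦ f ∘ γ` is differentiable for continuously differentiable
`f`. -/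
lemma hasFDerivAt_comp (B : G →L[ℝ] E →L[ℝ] F) (f : C(E, F)) (f' : C(E, G))
    (hf : ∀ x, HasFDerivAt f (B (f' x)) x) (γ : C(X, E)) :
    HasFDerivAt (fun γ : C(X, E) => f.comp γ) (pointwiseBilin B (f'.comp γ)) γ := by
  rw [hasFDerivAt_iff_isLittleO, Asymptotics.isLittleO_iff]
  intro c hc
  have hB : 0 < ‖B‖ + 1 := by positivity
  obtain ⟨δ, hδ, hδc⟩ := Metric.continuous_iff.1 (ContinuousMap.continuous_postcomp f') γ
    (c / (‖B‖ + 1)) (by positivity)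
  filter_upwards [Metric.ball_mem_nhds γ hδ] with η hη
  rw [ContinuousMap.norm_le _ (by positivity)]
  intro t
  simp only [ContinuousMap.sub_apply, ContinuousMap.comp_apply, pointwiseBilin_apply]
  -- The mean value inequality on the segment from `γ t` to `η t` gives a remainder bound uniform in
  -- `t`, because `f' ∘ ξ` is uniformly close to `f' ∘ γ` for every `ξ` on the segment from `γ` to
  -- `η`.
  have key := (convex_segment (γ t) (η t)).norm_image_sub_le_of_norm_hasFDerivWithin_le'
    (𝕜 := ℝ) (f := f) (φ := B (f' (γ t))) (C := c) (fun x _ => (hf x).hasFDerivWithinAt) ?_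
    (left_mem_segment ℝ _ _) (right_mem_segment ℝ _ _)
  · exact key.trans (mul_le_mul_of_nonneg_left ((η - γ).norm_coe_le_norm t) hc.le)
  · intro x hx
    rw [segment_eq_image'] at hx
    obtain ⟨s, hs, rfl⟩ := hx
    have hs' : dist (γ + s • (η - γ)) γ < δ := by
      rw [dist_eq_norm, add_sub_cancel_left, norm_smul, Real.norm_of_nonneg hs.1]
      exact (mul_le_of_le_one_left (norm_nonneg _) hs.2).trans_lt (mem_ball_iff_norm.1 hη)
    have h1 := hδc _ hs'
    rw [dist_eq_norm] at h1
    have h2 := (ContinuousMap.norm_coe_le_norm (f'.comp (γ + s • (η - γ)) - f'.comp γ) t).trans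
      h1.le
    rw [← map_sub]
    refine (B.le_of_opNorm_le_of_le le_rfl h2).trans ?_
    rw [mul_div_assoc', div_le_iff₀ hB]
    nlinarith

/-- The derivative of a superposition operator is the superposition operator of `fderiv ℝ f`
followed by a continuous linear map, so induction on `n` applies. The codomain changes from `F` to
`E →L[ℝ] F` in each step; hence `F` is quantified inside the induction and all spaces share one
universe. -/
theorem contDiff_comp_nat (n : ℕ) : ∀ {F : Type u} [NormedAddCommGroup F]
    [NormedSpace ℝ F] (f : C(E, F)), ContDiff ℝ n f →
    ContDiff ℝ n (fun γ : C(X, E) => f.comp γ) := by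
  induction n with
  | zero =>
    intro F _ _ f hf
    exact contDiff_zero.2 (ContinuousMap.continuous_postcomp f)
  | succ n ih =>
    intro F _ _ f hf
    have h1 : ContDiff ℝ 1 f := hf.of_le (by exact_mod_cast Nat.le_add_left 1 n)
    have h2 : ContDiff ℝ n (fderiv ℝ f) := hf.fderiv_right (by norm_cast)
    have h3 := (pointwiseBilin (X := X) (ContinuousLinearMap.id ℝ (E →L[ℝ] F))).contDiff.comp
      (ih ⟨fderiv ℝ f, h1.continuous_fderiv one_ne_zero⟩ h2)
    rw [Nat.cast_succ, contDiff_succ_iff_hasFDerivAt]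
    exact ⟨_, h3, fun γ => hasFDerivAt_comp _ f _
      (fun x => (h1.differentiable one_ne_zero x).hasFDerivAt) γ⟩

/-- The superposition operator of a smooth map is smooth. -/
theorem contDiff_comp (f : C(E, F)) (hf : ContDiff ℝ ∞ f) :
    ContDiff ℝ ∞ (fun γ : C(X, E) => f.comp γ) :=
  contDiff_infty.2 fun n => contDiff_comp_nat n f (contDiff_infty.1 hf n)

end ContinuousMap

end SmoothFlow

/-! ### Smooth local flows of vector fields -/

section SmoothFlow

variable {E : Type*} [NormedAddCommGroup E] [NormedSpace ℝ E]

omit [NormedSpace ℝ E] in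
lemma continuous_comp_projIcc (η : C(Icc (-1 : ℝ) 1, E)) :
    Continuous fun τ : ℝ => η (projIcc (-1) 1 (by norm_num) τ) :=
  η.continuous.comp continuous_projIcc

/-- The primitive of a continuous function on `[-1, 1]` that vanishes at `0`, as a linear
operator. -/
noncomputable def primitiveLinear : C(Icc (-1 : ℝ) 1, E) →ₗ[ℝ] C(Icc (-1 : ℝ) 1, E) where
  -- `projIcc` extends `η` to the whole line by its end values, so that interval integrals over `ℝ`
  -- can be used.
  toFun η := ⟨fun t => ∫ τ in (0 : ℝ)..t, η (projIcc (-1) 1 (by norm_num) τ),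
    (intervalIntegral.continuous_primitive
      (fun a b => (continuous_comp_projIcc η).intervalIntegrable a b) 0).comp
      continuous_subtype_val⟩
  map_add' η ξ := by
    ext t
    exact intervalIntegral.integral_add ((continuous_comp_projIcc η).intervalIntegrable _ _)
      ((continuous_comp_projIcc ξ).intervalIntegrable _ _)
  map_smul' c η := by
    ext t
    exact intervalIntegral.integral_smul _ _

lemma norm_primitiveLinear_le (η : C(Icc (-1 : ℝ) 1, E)) : ‖primitiveLinear η‖ ≤ ‖η‖ := by
  rw [ContinuousMap.norm_le _ (by positivity)]
  intro t
  have h := intervalIntegral.norm_integral_le_of_norm_le_const (a := 0) (b := (t : ℝ))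
    (f := fun τ => η (projIcc (-1) 1 (by norm_num) τ)) (C := ‖η‖)
    (fun τ _ => η.norm_coe_le_norm _)
  refine h.trans ?_
  rw [sub_zero]
  exact mul_le_of_le_one_right (norm_nonneg _) (abs_le.2 t.2)

/-- The primitive of a continuous function on `[-1, 1]` that vanishes at `0`, as a continuous
linear operator. -/
noncomputable def primitiveCLM : C(Icc (-1 : ℝ) 1, E) →L[ℝ] C(Icc (-1 : ℝ) 1, E) :=
  primitiveLinear.mkContinuous 1 fun η => by
    rw [one_mul]
    exact norm_primitiveLinear_le η

lemma norm_primitiveCLM_apply_le (η : C(Icc (-1 : ℝ) 1, E)) : ‖primitiveCLM η‖ ≤ ‖η‖ :=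
  norm_primitiveLinear_le η

lemma norm_primitiveCLM_le :
    ‖(primitiveCLM : C(Icc (-1 : ℝ) 1, E) →L[ℝ] C(Icc (-1 : ℝ) 1, E))‖ ≤ 1 :=
  LinearMap.mkContinuous_norm_le _ zero_le_one _

/-- The Picard operator of the equation `γ' = s f(γ)`, `γ(0) = z`, where `p = (z, s)`. -/
noncomputable def picardMap (f : C(E, E)) (p : E × ℝ) (γ : C(Icc (-1 : ℝ) 1, E)) :
    C(Icc (-1 : ℝ) 1, E) :=
  ContinuousLinearMap.const ℝ (Icc (-1 : ℝ) 1) p.1 + p.2 • primitiveCLM (f.comp γ)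

lemma picardMap_apply (f : C(E, E)) (p : E × ℝ) (γ : C(Icc (-1 : ℝ) 1, E)) (t : Icc (-1 : ℝ) 1) :
    picardMap f p γ t =
      p.1 + p.2 • ∫ τ in (0 : ℝ)..t, f (γ (projIcc (-1) 1 (by norm_num) τ)) := rfl

lemma picardMap_sub (f : C(E, E)) (p : E × ℝ) (γ₁ γ₂ : C(Icc (-1 : ℝ) 1, E)) :
    picardMap f p γ₁ - picardMap f p γ₂ = p.2 • primitiveCLM (f.comp γ₁ - f.comp γ₂) := by
  rw [picardMap, picardMap, add_sub_add_left_eq_sub, map_sub, smul_sub]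

lemma dist_picardMap_le {f : C(E, E)} {L : NNReal} (hL : LipschitzWith L f) (p : E × ℝ)
    (γ₁ γ₂ : C(Icc (-1 : ℝ) 1, E)) :
    dist (picardMap f p γ₁) (picardMap f p γ₂) ≤ |p.2| * L * dist γ₁ γ₂ := by
  have h : dist (f.comp γ₁) (f.comp γ₂) ≤ L * dist γ₁ γ₂ := by
    rw [ContinuousMap.dist_le (by positivity)]
    exact fun t => (hL.dist_le_mul _ _).trans
      (mul_le_mul_of_nonneg_left (ContinuousMap.dist_apply_le_dist t) L.2)
  rw [dist_eq_norm, picardMap_sub, norm_smul, Real.norm_eq_abs, mul_assoc]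
  refine mul_le_mul_of_nonneg_left ((norm_primitiveCLM_apply_le _).trans ?_) (abs_nonneg _)
  rwa [← dist_eq_norm]

lemma contractingWith_picardMap {f : C(E, E)} {L : NNReal} (hL : LipschitzWith L f) {p : E × ℝ}
    (hp : |p.2| * L < 1) :
    ContractingWith ⟨|p.2| * L, by positivity⟩ (picardMap f p) :=
  ⟨by exact_mod_cast hp, LipschitzWith.of_dist_le_mul fun _ _ => dist_picardMap_le hL p _ _⟩

-- Smoothness of the superposition operator is the only nonlinear ingredient besides the product
-- with the scalar `s`.
open ContinuousMap in
lemma contDiff_picardMap {f : C(E, E)} (hf : ContDiff ℝ ∞ f) :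
    ContDiff ℝ ∞ fun q : (E × ℝ) × C(Icc (-1 : ℝ) 1, E) => picardMap f q.1 q.2 := by
  have h := (primitiveCLM (E := E)).contDiff.comp
    ((contDiff_comp (X := Icc (-1 : ℝ) 1) f hf).comp
      (contDiff_snd (E := E × ℝ) (F := C(Icc (-1 : ℝ) 1, E))))
  exact ((ContinuousLinearMap.const ℝ (Icc (-1 : ℝ) 1)).contDiff.comp
    (contDiff_fst.comp contDiff_fst)).add ((contDiff_snd.comp contDiff_fst).smul h)

variable [CompleteSpace E]

/-- A Neumann series inverts the linearised Picard equation under the same smallness condition that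
makes the Picard operator a contraction. -/
lemma ContinuousLinearMap.isInvertible_one_sub_smul_comp {P B : E →L[ℝ] E} {s L : ℝ}
    (hP : ‖P‖ ≤ 1) (hB : ‖B‖ ≤ L) (hs : |s| * L < 1) :
    (1 - s • P ∘L B).IsInvertible := by
  have h : ‖s • P ∘L B‖ < 1 := by
    refine lt_of_le_of_lt ?_ hs
    rw [norm_smul, Real.norm_eq_abs]
    refine mul_le_mul_of_nonneg_left ?_ (abs_nonneg _)
    exact ((P.opNorm_comp_le B).trans (mul_le_of_le_one_left (norm_nonneg _) hP)).trans hB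
  obtain ⟨u, hu⟩ := isUnit_one_sub_of_norm_lt_one h
  exact ⟨ContinuousLinearEquiv.ofUnit u, by rw [← hu]; rfl⟩

/-- The solution of `γ' = s f(γ)`, `γ(0) = z` on `[-1, 1]` depends smoothly on `p = (z, s)`. -/
lemma exists_contDiffOn_fixedPoint {f : C(E, E)} (hf : ContDiff ℝ ∞ f) {L : NNReal}
    (hL : LipschitzWith L f) :
    ∃ Γ : E × ℝ → C(Icc (-1 : ℝ) 1, E),
      ContDiffOn ℝ ∞ Γ {p | |p.2| * L < 1} ∧
      (∀ p : E × ℝ, |p.2| * L < 1 → ∀ γ, picardMap f p γ = γ ↔ γ = Γ p) := by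
  classical
  let Γ : E × ℝ → C(Icc (-1 : ℝ) 1, E) := fun p =>
    if hp : |p.2| * L < 1 then (contractingWith_picardMap hL hp).fixedPoint else 0
  have hΓ : ∀ p : E × ℝ, |p.2| * L < 1 → ∀ γ, picardMap f p γ = γ ↔ γ = Γ p := by
    intro p hp γ
    have h : Γ p = (contractingWith_picardMap hL hp).fixedPoint := dif_pos hp
    rw [h]
    constructor
    · exact fun hγ => (contractingWith_picardMap hL hp).fixedPoint_unique hγ
    · rintro rfl
      exact (contractingWith_picardMap hL hp).fixedPoint_isFixedPt
  refine ⟨Γ, fun p hp => ContDiffAt.contDiffWithinAt ?_, hΓ⟩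
  have hopen : IsOpen {p : E × ℝ | |p.2| * L < 1} :=
    isOpen_lt (by fun_prop) continuous_const
  have hfix : picardMap f p (Γ p) = Γ p := (hΓ p hp _).2 rfl
  -- The fixed points are the zeros of `Φ`, whose partial derivative in `γ` is invertible.
  let Φ : (E × ℝ) × C(Icc (-1 : ℝ) 1, E) → C(Icc (-1 : ℝ) 1, E) :=
    fun q => q.2 - picardMap f q.1 q.2
  have hΦ : ContDiff ℝ ∞ Φ := contDiff_snd.sub (contDiff_picardMap hf)
  have h1 : ContDiff ℝ 1 f := hf.of_le (by simp)
  set B := ContinuousMap.pointwiseBilin (ContinuousLinearMap.id ℝ (E →L[ℝ] E))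
    ((⟨fderiv ℝ f, h1.continuous_fderiv one_ne_zero⟩ : C(E, E →L[ℝ] E)).comp (Γ p)) with hB
  have hd1 : HasFDerivAt (fun γ => Φ (p, γ)) (1 - p.2 • primitiveCLM ∘L B) (Γ p) := by
    have h3 := ContinuousMap.hasFDerivAt_comp (X := Icc (-1 : ℝ) 1)
      (ContinuousLinearMap.id ℝ (E →L[ℝ] E)) f
      ⟨fderiv ℝ f, h1.continuous_fderiv one_ne_zero⟩
      (fun x => (h1.differentiable one_ne_zero x).hasFDerivAt) (Γ p)
    have h4 := (primitiveCLM (E := E)).hasFDerivAt.comp (Γ p) h3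
    exact (hasFDerivAt_id (Γ p)).sub
      ((h4.const_smul p.2).const_add (ContinuousLinearMap.const ℝ (Icc (-1 : ℝ) 1) p.1))
  have hd2 : HasFDerivAt (fun γ => Φ (p, γ))
      (fderiv ℝ Φ (p, Γ p) ∘L ContinuousLinearMap.inr ℝ (E × ℝ) C(Icc (-1 : ℝ) 1, E)) (Γ p) :=
    ((hΦ.differentiable (by simp)) (p, Γ p)).hasFDerivAt.comp (Γ p) (hasFDerivAt_prodMk_right p _)
  have hinv : (fderiv ℝ Φ (p, Γ p) ∘L
      ContinuousLinearMap.inr ℝ (E × ℝ) C(Icc (-1 : ℝ) 1, E)).IsInvertible := by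
    rw [hd2.unique hd1]
    exact ContinuousLinearMap.isInvertible_one_sub_smul_comp norm_primitiveCLM_le
      (ContinuousMap.norm_pointwiseBilin_le _ _ L.2 fun t => norm_fderiv_le_of_lipschitz ℝ hL) hp
  have hc : ContDiffAt ℝ ∞ Φ (p, Γ p) := hΦ.contDiffAt
  refine (hc.contDiffAt_implicitFunction (by simp) hinv).congr_of_eventuallyEq ?_
  -- The smooth implicit function also consists of fixed points, so by uniqueness it agrees with `Γ`
  -- near `p`.
  filter_upwards [hc.eventually_apply_implicitFunction (by simp) hinv, hopen.mem_nhds hp]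
    with q hq hq'
  have h0 : Φ (p, Γ p) = 0 := sub_eq_zero.2 hfix.symm
  rw [h0] at hq
  exact ((hΓ q hq' _).1 (sub_eq_zero.1 hq).symm).symm

/-- A smooth globally Lipschitz vector field has a smooth local flow. -/
theorem exists_contDiffOn_flow {f : E → E} (hf : ContDiff ℝ ∞ f) {L : NNReal}
    (hL : LipschitzWith L f) :
    ∃ a > (0 : ℝ), ∃ φ : E × ℝ → E, ContDiffOn ℝ ∞ φ (univ ×ˢ Ioo (-a) a) ∧
      (∀ z, φ (z, 0) = z) ∧
      ∀ z, ∀ s ∈ Ioo (-a) a, HasDerivAt (fun s => φ (z, s)) (f (φ (z, s))) s := by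
  lift f to C(E, E) using hf.continuous
  obtain ⟨Γ, hΓ, hΓu⟩ := exists_contDiffOn_fixedPoint hf hL
  have hLpos : (0 : ℝ) < L + 1 := by positivity
  have hsmall : ∀ s ∈ Ioo (-(1 / (L + 1 : ℝ))) (1 / (L + 1 : ℝ)), |s| * L < 1 := by
    intro s hs
    have h1 : |s| < 1 / (L + 1 : ℝ) := abs_lt.2 hs
    rw [lt_div_iff₀ hLpos] at h1
    nlinarith [abs_nonneg s]
  have hfix : ∀ p : E × ℝ, |p.2| * L < 1 → picardMap f p (Γ p) = Γ p :=
    fun p hp => (hΓu p hp _).2 rfl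
  -- The flow at time `s` is the value at time `1` of the solution of `γ' = s f(γ)`. Time thereby
  -- becomes a parameter, and smoothness in it is included in that of `Γ`. The bound `1 / (L + 1)`
  -- guarantees `|s| L < 1`, also for `L = 0`.
  refine ⟨1 / (L + 1), by positivity, fun p => Γ p ⟨1, by norm_num⟩, ?_, ?_, ?_⟩
  · have hsub : (univ : Set E) ×ˢ Ioo (-(1 / (L + 1 : ℝ))) (1 / (L + 1 : ℝ)) ⊆
        {p : E × ℝ | |p.2| * L < 1} := fun p hp => hsmall p.2 hp.2
    exact (ContinuousMap.evalCLM ℝ (⟨1, by norm_num⟩ : Icc (-1 : ℝ) 1)).contDiff.comp_contDiffOn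
      (hΓ.mono hsub)
  · intro z
    have h := hfix (z, 0) (by simp)
    dsimp only
    rw [← h]
    simp [picardMap_apply]
  · intro z s₀ hs₀
    obtain ⟨s₁, h₀₁, hs₁⟩ := exists_between (abs_lt.2 hs₀)
    have hs₁pos : 0 < s₁ := (abs_nonneg _).trans_lt h₀₁
    have hs₁a : |s₁| * L < 1 := hsmall s₁ ⟨by linarith [show (0:ℝ) < 1 / (L + 1) by positivity], hs₁⟩
    set γ : ℝ → E := fun t => Γ (z, s₁) (projIcc (-1) 1 (by norm_num) t) with hγ
    have hγc : Continuous γ := continuous_comp_projIcc _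
    have hγi : ∀ t ∈ Icc (-1 : ℝ) 1, γ t = z + s₁ • ∫ τ in (0 : ℝ)..t, f (γ τ) := by
      intro t ht
      have h := DFunLike.congr_fun (hfix (z, s₁) hs₁a) (projIcc (-1) 1 (by norm_num) t)
      rw [hγ]
      dsimp only
      rw [← h, picardMap_apply, projIcc_of_mem _ ht]
    -- Reparametrising the solution for the fixed speed `s₁` by `t ↦ (s / s₁) t` solves the equation
    -- for the speed `s`. Uniqueness then identifies the flow with a single curve, which can be
    -- differentiated by the fundamental theorem of calculus.
    have hscale : ∀ s ∈ Ioo (-s₁) s₁, Γ (z, s) ⟨1, by norm_num⟩ = γ (s / s₁) := by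
      intro s hs
      have hr : |s / s₁| ≤ 1 := by
        rw [abs_div, abs_of_pos hs₁pos, div_le_one hs₁pos]
        exact (abs_lt.2 hs).le
      have hsL : |s| * L < 1 :=
        (mul_le_mul_of_nonneg_right ((abs_lt.2 hs).le.trans (le_abs_self _)) L.2).trans_lt hs₁a
      have hu := (hΓu (z, s) hsL ⟨fun t => γ (s / s₁ * t), by fun_prop⟩).1 ?_
      · rw [← hu]
        simp
      · ext t
        have hrt : s / s₁ * t ∈ Icc (-1 : ℝ) 1 := by
          refine abs_le.1 ?_
          rw [abs_mul]
          exact mul_le_one₀ hr (abs_nonneg _) (abs_le.2 t.2)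
        rw [picardMap_apply]
        simp only [ContinuousMap.coe_mk]
        have hcongr : ∫ τ in (0 : ℝ)..t,
            f (γ (s / s₁ * (projIcc (-1) 1 (by norm_num) τ : Icc (-1 : ℝ) 1))) =
            ∫ τ in (0 : ℝ)..t, f (γ (s / s₁ * τ)) := by
          refine intervalIntegral.integral_congr fun τ hτ => ?_
          have : τ ∈ Icc (-1 : ℝ) 1 :=
            ordConnected_Icc.uIcc_subset (by norm_num) t.2 hτ
          simp only [projIcc_of_mem _ this]
        rw [hcongr, hγi _ hrt]
        have h2 := intervalIntegral.smul_integral_comp_mul_left (a := 0) (b := (t : ℝ))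
          (fun τ => f (γ τ)) (s / s₁)
        rw [mul_zero] at h2
        rw [← h2, smul_smul, mul_div_cancel₀ _ hs₁pos.ne']
    have hmem : s₀ ∈ Ioo (-s₁) s₁ := abs_lt.1 h₀₁
    have hr₀ : s₀ / s₁ ∈ Ioo (-1 : ℝ) 1 := by
      refine abs_lt.1 ?_
      rw [abs_div, abs_of_pos hs₁pos, div_lt_one hs₁pos]
      exact h₀₁
    have hγd : HasDerivAt γ (s₁ • f (γ (s₀ / s₁))) (s₀ / s₁) := by
      have h3 : HasDerivAt (fun t => z + s₁ • ∫ τ in (0 : ℝ)..t, f (γ τ))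
          (s₁ • f (γ (s₀ / s₁))) (s₀ / s₁) := by
        refine HasDerivAt.const_add _ (HasDerivAt.const_smul _ ?_)
        exact intervalIntegral.integral_hasDerivAt_right
          ((f.continuous.comp hγc).intervalIntegrable _ _)
          ((f.continuous.comp hγc).stronglyMeasurableAtFilter _ _)
          (f.continuous.comp hγc).continuousAt
      refine h3.congr_of_eventuallyEq ?_
      filter_upwards [Ioo_mem_nhds hr₀.1 hr₀.2] with t ht
      exact hγi t (Ioo_subset_Icc_self ht)
    have h4 := HasDerivAt.scomp s₀ hγd ((hasDerivAt_id s₀).div_const s₁)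
    dsimp only
    rw [hscale s₀ hmem]
    simp only [id, smul_smul, one_div, inv_mul_cancel₀ hs₁pos.ne', one_smul] at h4
    refine h4.congr_of_eventuallyEq ?_
    filter_upwards [Ioo_mem_nhds hmem.1 hmem.2] with s hs
    exact hscale s hs

/-- A vector field that is smooth near a point has a smooth local flow near this point. -/
theorem ContDiffOn.exists_local_flow [FiniteDimensional ℝ E] {f : E → E} {V : Set E}
    (hV : IsOpen V) (hf : ContDiffOn ℝ ∞ f V) {z₀ : E} (hz₀ : z₀ ∈ V) :
    ∃ a > (0 : ℝ), ∃ W : Set E, IsOpen W ∧ z₀ ∈ W ∧ ∃ φ : E × ℝ → E,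
      ContDiffOn ℝ ∞ φ (W ×ˢ Ioo (-a) a) ∧ (∀ z ∈ W, φ (z, 0) = z) ∧
      ∀ z ∈ W, ∀ s ∈ Ioo (-a) a, φ (z, s) ∈ V ∧
        HasDerivAt (fun s => φ (z, s)) (f (φ (z, s))) s := by
  -- A bump function makes the field smooth and globally Lipschitz without changing it near `z₀`.
  obtain ⟨χ, hχ1, hχV, hχc, hχs, -⟩ : ∃ χ : E → ℝ, (∀ᶠ z in 𝓝 z₀, χ z = 1) ∧
      tsupport χ ⊆ V ∧ HasCompactSupport χ ∧ ContDiff ℝ ∞ χ ∧ True := by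
    obtain ⟨r, hr, hrV⟩ := Metric.isOpen_iff.1 hV z₀ hz₀
    let b : ContDiffBump z₀ := ⟨r / 4, r / 2, by positivity, by linarith⟩
    refine ⟨b, b.eventuallyEq_one, ?_, b.hasCompactSupport, b.contDiff, trivial⟩
    rw [b.tsupport_eq]
    exact (Metric.closedBall_subset_ball (by change r / 2 < r; linarith)).trans hrV
  have hsm : ContDiff ℝ ∞ fun z => χ z • f z := by
    rw [contDiff_iff_contDiffAt]
    intro z
    by_cases hz : z ∈ tsupport χ
    · exact hχs.contDiffAt.smul (hf.contDiffAt (hV.mem_nhds (hχV hz)))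
    · have h0 : (fun z => χ z • f z) =ᶠ[𝓝 z] fun _ => 0 := by
        filter_upwards [(isClosed_tsupport χ).isOpen_compl.mem_nhds hz] with w hw
        rw [image_eq_zero_of_notMem_tsupport hw, zero_smul]
      exact contDiffAt_const.congr_of_eventuallyEq h0
  obtain ⟨L, hL⟩ := ContDiff.lipschitzWith_of_hasCompactSupport (𝕂 := ℝ)
    (hχc.smul_right (f' := f)) hsm (by simp)
  obtain ⟨a, ha, φ, hφ, hφ0, hφd⟩ := exists_contDiffOn_flow hsm hL
  have hcont : ContinuousAt φ (z₀, 0) :=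
    hφ.continuousOn.continuousAt (prod_mem_nhds univ_mem (Ioo_mem_nhds (by linarith) ha))
  -- For short times the flow stays where `χ = 1`, and there the cut-off field is `f`.
  have hN : ∀ᶠ p in 𝓝 (z₀, (0 : ℝ)), φ p ∈ V ∧ χ (φ p) = 1 := by
    have h0 : ∀ᶠ z in 𝓝 (φ (z₀, 0)), z ∈ V ∧ χ z = 1 := by
      rw [hφ0]
      exact (hV.eventually_mem hz₀).and hχ1
    exact hcont.eventually h0
  obtain ⟨W, W', hW, hzW, hW', h0W', hWW⟩ := mem_nhds_prod_iff'.1 hN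
  obtain ⟨b, hb, hbW⟩ := Metric.isOpen_iff.1 hW' 0 h0W'
  rw [Real.ball_eq_Ioo, zero_sub, zero_add] at hbW
  have hsub : Ioo (-(min a b)) (min a b) ⊆ Ioo (-a) a :=
    Ioo_subset_Ioo (neg_le_neg (min_le_left _ _)) (min_le_left _ _)
  refine ⟨min a b, lt_min ha hb, W, hW, hzW, φ,
    hφ.mono (prod_mono (subset_univ _) hsub), fun z _ => hφ0 z, fun z hz s hs => ?_⟩
  have h1 := hWW (mk_mem_prod hz (hbW ⟨(neg_le_neg (min_le_right a b)).trans_lt hs.1,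
    hs.2.trans_le (min_le_right a b)⟩))
  have h2 := hφd z s (hsub hs)
  simp only [mem_ofPred_eq] at h1
  rw [h1.2, one_smul] at h2
  exact ⟨h1.1, h2⟩

end SmoothFlow

namespace LorentzSurface

/-! ### Christoffel symbols and curvature in coordinates -/

section Coordinates

variable {h h' : Plane → Matrix (Fin 2) (Fin 2) ℝ} {y : Plane}

lemma partialDeriv_congr {f f' : Plane → ℝ} (hf : f =ᶠ[𝓝 y] f') (i : Fin 2) :
    partialDeriv i f y = partialDeriv i f' y := by
  rw [partialDeriv, partialDeriv, hf.fderiv_eq]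

lemma partialDeriv_const (c : ℝ) (i : Fin 2) : partialDeriv i (fun _ => c) y = 0 := by
  simp [partialDeriv]

lemma christoffel_congr (hh : h =ᶠ[𝓝 y] h') (k i j : Fin 2) :
    christoffel h k i j y = christoffel h' k i j y := by
  have hc : ∀ a b : Fin 2, (fun z => h z a b) =ᶠ[𝓝 y] fun z => h' z a b :=
    fun a b => hh.mono fun z hz => by simp only [hz]
  simp only [christoffel, hh.eq_of_nhds, partialDeriv_congr (hc _ _)]

lemma christoffel_eventuallyEq (hh : h =ᶠ[𝓝 y] h') (k i j : Fin 2) :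
    christoffel h k i j =ᶠ[𝓝 y] christoffel h' k i j :=
  hh.eventuallyEq_nhds.mono fun _ hz => christoffel_congr hz k i j

/-- Derivatives see only germs, and agreement near `y` passes to the Christoffel symbols near `y`,
so they can be differentiated once more. -/
lemma gaussCurvature_congr (hh : h =ᶠ[𝓝 y] h') : gaussCurvature h y = gaussCurvature h' y := by
  simp only [gaussCurvature, riemannTensor, hh.eq_of_nhds, christoffel_congr hh,
    partialDeriv_congr (christoffel_eventuallyEq hh _ _ _)]

lemma inv_fin_two_apply (A : Matrix (Fin 2) (Fin 2) ℝ) :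
    A⁻¹ = A.det⁻¹ • !![A 1 1, -A 0 1; -A 1 0, A 0 0] := by
  rw [Matrix.inv_def, Matrix.adjugate_fin_two, Ring.inverse_eq_inv]

/-- The Christoffel symbols with a lowered index. -/
lemma sum_mul_christoffel (hdet : (h y).det ≠ 0) (r i j : Fin 2) :
    ∑ k, h y r k * christoffel h k i j y = 1 / 2 *
      (partialDeriv j (fun z => h z i r) y + partialDeriv i (fun z => h z j r) y
        - partialDeriv r (fun z => h z i j) y) := by
  have hone : ∀ s : Fin 2, ∑ k, h y r k * (h y)⁻¹ k s = if r = s then 1 else 0 := by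
    intro s
    rw [← Matrix.mul_apply, Matrix.mul_nonsing_inv _ (isUnit_iff_ne_zero.2 hdet), Matrix.one_apply]
  have h0 := hone 0
  have h1 := hone 1
  simp only [christoffel, Fin.sum_univ_two] at h0 h1 ⊢
  fin_cases r <;> simp only [Fin.zero_eta, Fin.mk_one, Fin.isValue, if_true, one_ne_zero,
    zero_ne_one, if_false] at h0 h1 ⊢
  all_goals
    linear_combination (1 / 2 * (partialDeriv j (fun z => h z i 0) y +
        partialDeriv i (fun z => h z j 0) y - partialDeriv 0 (fun z => h z i j) y)) * h0 +
      (1 / 2 * (partialDeriv j (fun z => h z i 1) y +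
        partialDeriv i (fun z => h z j 1) y - partialDeriv 1 (fun z => h z i j) y)) * h1

lemma contDiffOn_partialDeriv {f : Plane → ℝ} {V : Set Plane} (hV : IsOpen V)
    (hf : ContDiffOn ℝ ∞ f V) (i : Fin 2) : ContDiffOn ℝ ∞ (partialDeriv i f) V :=
  (hf.fderiv_of_isOpen hV (m := ∞) le_rfl).clm_apply contDiffOn_const

lemma contDiffOn_christoffel {V : Set Plane} (hV : IsOpen V)
    (hh : ∀ i j, ContDiffOn ℝ ∞ (fun z => h z i j) V) (hdet : ∀ z ∈ V, (h z).det ≠ 0)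
    (k i j : Fin 2) : ContDiffOn ℝ ∞ (christoffel h k i j) V := by
  have hd : ContDiffOn ℝ ∞ (fun z => (h z).det⁻¹) V := by
    refine ContDiffOn.inv ?_ hdet
    simp only [Matrix.det_fin_two]
    exact ((hh 0 0).mul (hh 1 1)).sub ((hh 0 1).mul (hh 1 0))
  have hinv : ∀ a b, ContDiffOn ℝ ∞ (fun z => (h z)⁻¹ a b) V := by
    intro a b
    simp only [inv_fin_two_apply, Matrix.smul_apply, smul_eq_mul]
    refine hd.mul ?_
    fin_cases a <;> fin_cases b
    · exact hh 1 1
    · exact (hh 0 1).neg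
    · exact (hh 1 0).neg
    · exact hh 0 0
  refine ContDiffOn.sum fun r _ => (contDiffOn_const.mul (hinv k r)).mul ?_
  exact ((contDiffOn_partialDeriv hV (hh i r) j).add
    (contDiffOn_partialDeriv hV (hh j r) i)).sub (contDiffOn_partialDeriv hV (hh i j) r)

/-- The Gaussian curvature of a metric `c du² + G dv²` with constant `c`. -/
lemma gaussCurvature_orthogonal {c : ℝ} (hc : c ≠ 0) {G : Plane → ℝ}
    (hG : ContDiffAt ℝ ∞ G y) (hG0 : G y ≠ 0)
    (hh : ∀ᶠ z in 𝓝 y, h z = !![c, 0; 0, G z]) :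
    c * G y * gaussCurvature h y =
      -(1 / 2) * partialDeriv 0 (partialDeriv 0 G) y + partialDeriv 0 G y ^ 2 / (4 * G y) := by
  rw [gaussCurvature_congr (h' := fun z => !![c, 0; 0, G z]) hh]
  set k : Plane → Matrix (Fin 2) (Fin 2) ℝ := fun z => !![c, 0; 0, G z] with hk
  have hne : ∀ᶠ z in 𝓝 y, G z ≠ 0 := hG.continuousAt.eventually_ne hG0
  -- Since `g₁₀ = 0`, only the component `l = 0` of the curvature tensor counts. The symbols not
  -- listed here enter it multiplied by `Γ⁰₀₁ = 0`.
  have hchr : ∀ z, G z ≠ 0 → christoffel k 0 1 1 z = -(1 / (2 * c)) * partialDeriv 0 G z ∧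
      christoffel k 0 0 1 z = 0 ∧ christoffel k 1 0 1 z = partialDeriv 0 G z / (2 * G z) ∧
      christoffel k 0 0 0 z = 0 := by
    intro z hz
    have hinv : (k z)⁻¹ = !![c⁻¹, 0; 0, (G z)⁻¹] := by
      rw [inv_fin_two_apply]
      ext a b
      fin_cases a <;> fin_cases b <;> simp [hk, Matrix.det_fin_two] <;> field_simp
    simp only [christoffel, Fin.sum_univ_two, hinv]
    simp only [hk, Matrix.of_apply, Matrix.cons_val', Matrix.cons_val_zero, Matrix.cons_val_one,
      Matrix.cons_val_fin_one, partialDeriv_const, Fin.isValue]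
    refine ⟨?_, ?_, ?_, ?_⟩ <;> field_simp <;> ring
  have e011 : christoffel k 0 1 1 =ᶠ[𝓝 y] fun z => -(1 / (2 * c)) * partialDeriv 0 G z :=
    hne.mono fun z hz => (hchr z hz).1
  have e001 : christoffel k 0 0 1 =ᶠ[𝓝 y] fun _ => 0 := hne.mono fun z hz => (hchr z hz).2.1
  have hd : DifferentiableAt ℝ (partialDeriv 0 G) y := by
    have := (hG.fderiv_right (m := ∞) le_rfl).differentiableAt (by simp)
    exact this.clm_apply (differentiableAt_const _)
  have hp : partialDeriv 0 (christoffel k 0 1 1) y =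
      -(1 / (2 * c)) * partialDeriv 0 (partialDeriv 0 G) y := by
    rw [partialDeriv_congr e011, partialDeriv, fderiv_const_mul hd]
    rfl
  have hp1 : partialDeriv 1 (christoffel k 0 0 1) y = 0 := by
    rw [partialDeriv_congr e001, partialDeriv_const]
  obtain ⟨c1, c2, c3, c4⟩ := hchr y hG0
  have hk00 : k y 0 0 = c := rfl
  have hk01 : k y 0 1 = 0 := rfl
  have hk10 : k y 1 0 = 0 := rfl
  have hk11 : k y 1 1 = G y := rfl
  simp only [gaussCurvature, Fin.sum_univ_two, hk00, hk01, hk10, hk11, mul_zero, add_zero]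
  rw [riemannTensor, hp, hp1]
  simp only [Fin.sum_univ_two, c1, c2, c3, c4]
  field_simp
  ring

end Coordinates

end LorentzSurface

namespace LorentzSurface

/-! ### The weak form of the geodesic equation -/

section GeodesicEquation

set_option synthInstance.maxHeartbeats 400000

/-- The standard basis vectors of the coordinate plane. -/
noncomputable abbrev basisVec (i : Fin 2) : Plane := EuclideanSpace.single i (1 : ℝ)

lemma plane_eq_sum (X : Plane) : X = X 0 • basisVec 0 + X 1 • basisVec 1 := by
  ext i
  fin_cases i <;> simp

/-- The matrix of a bilinear form on the plane. -/
noncomputable def formMatrix (B : Plane →L[ℝ] Plane →L[ℝ] ℝ) : Matrix (Fin 2) (Fin 2) ℝ :=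
  Matrix.of fun i j => B (basisVec i) (basisVec j)

lemma formMatrix_apply (B : Plane →L[ℝ] Plane →L[ℝ] ℝ) (i j : Fin 2) :
    formMatrix B i j = B (basisVec i) (basisVec j) := rfl

lemma linear_plane_apply {G : Type*} [AddCommGroup G] [Module ℝ G] [TopologicalSpace G]
    (L : Plane →L[ℝ] G) (X : Plane) : L X = X 0 • L (basisVec 0) + X 1 • L (basisVec 1) := by
  conv_lhs => rw [plane_eq_sum X]
  rw [map_add, map_smul, map_smul]

lemma form_apply (B : Plane →L[ℝ] Plane →L[ℝ] ℝ) (X Y : Plane) :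
    B X Y = X 0 * Y 0 * B (basisVec 0) (basisVec 0) + X 0 * Y 1 * B (basisVec 0) (basisVec 1) +
      X 1 * Y 0 * B (basisVec 1) (basisVec 0) + X 1 * Y 1 * B (basisVec 1) (basisVec 1) := by
  rw [linear_plane_apply B X]
  simp only [add_apply, smul_apply, smul_eq_mul]
  rw [linear_plane_apply (B (basisVec 0)), linear_plane_apply (B (basisVec 1))]
  simp only [smul_eq_mul]
  ring

lemma trilinear_apply (D : Plane →L[ℝ] Plane →L[ℝ] Plane →L[ℝ] ℝ) (X Y Z : Plane) :
    D X Y Z = X 0 * D (basisVec 0) Y Z + X 1 * D (basisVec 1) Y Z := by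
  have h := linear_plane_apply ((D.flip Y).flip Z) X
  simpa only [ContinuousLinearMap.flip_apply, smul_eq_mul] using h

variable {E : Type*} [NormedAddCommGroup E] [NormedSpace ℝ E]
  {B B' : E → E →L[ℝ] E →L[ℝ] ℝ} {c : ℝ → E} {t : ℝ}

/-- The geodesic equation of the metric `B` in weak form (the Euler-Lagrange equation of the
energy). -/
def GeodesicEq (B : E → E →L[ℝ] E →L[ℝ] ℝ) (c : ℝ → E) (t : ℝ) : Prop :=
  ∀ X : E, fderiv ℝ B (c t) (deriv c t) (deriv c t) X + B (c t) (deriv (deriv c) t) X =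
    1 / 2 * fderiv ℝ B (c t) X (deriv c t) (deriv c t)

lemma hasFDerivAt_form_apply {y : E} (hB : DifferentiableAt ℝ B y) (X Y : E) :
    HasFDerivAt (fun z => B z X Y) (((fderiv ℝ B y).flip X).flip Y) y := by
  have h1 := (hB.hasFDerivAt.clm_apply (hasFDerivAt_const X y)).clm_apply (hasFDerivAt_const Y y)
  refine h1.congr_fderiv ?_
  ext Z
  simp

section

variable {B : Plane → Plane →L[ℝ] Plane →L[ℝ] ℝ} {c : ℝ → Plane} {t : ℝ}

lemma partialDeriv_formMatrix {y : Plane} (hB : DifferentiableAt ℝ B y) (i j k : Fin 2) :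
    partialDeriv i (fun z => formMatrix (B z) j k) y =
      fderiv ℝ B y (basisVec i) (basisVec j) (basisVec k) := by
  have h1 := (hasFDerivAt_form_apply hB (basisVec j) (basisVec k)).fderiv
  simp only [partialDeriv, formMatrix_apply]
  rw [h1]
  rfl

/-- Let `w` be the vector of left-hand sides of the Christoffel equations. Lowering its index with
the metric gives the weak equation tested on basis vectors (`key`), and nondegeneracy allows the
index to be raised again. -/
lemma geodesicEq_iff_christoffel (hB : DifferentiableAt ℝ B (c t))
    (hsymm : ∀ X Y, B (c t) X Y = B (c t) Y X) (hdet : (formMatrix (B (c t))).det ≠ 0) :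
    GeodesicEq B c t ↔ ∀ k : Fin 2, deriv (deriv c) t k + ∑ i : Fin 2, ∑ j : Fin 2,
      christoffel (fun z => formMatrix (B z)) k i j (c t) * deriv c t i * deriv c t j = 0 := by
  set a := deriv c t with ha
  set b := deriv (deriv c) t with hb
  set D := fderiv ℝ B (c t) with hD
  set w : Fin 2 → ℝ := fun k => b k + ∑ i : Fin 2, ∑ j : Fin 2,
      christoffel (fun z => formMatrix (B z)) k i j (c t) * a i * a j with hw
  have key : ∀ r : Fin 2, (formMatrix (B (c t))).mulVec w r =
      D a a (basisVec r) + B (c t) b (basisVec r) - 1 / 2 * D (basisVec r) a a := by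
    intro r
    have hl := fun i j => sum_mul_christoffel (h := fun z => formMatrix (B z)) hdet r i j
    simp only [partialDeriv_formMatrix hB, ← hD] at hl
    have h1 : D a a (basisVec r) = ∑ i : Fin 2, ∑ j : Fin 2,
        a i * a j * D (basisVec j) (basisVec i) (basisVec r) := by
      rw [trilinear_apply D a, form_apply (D (basisVec 0)), form_apply (D (basisVec 1))]
      fin_cases r <;> simp [Fin.sum_univ_two] <;> ring
    have h2 : D (basisVec r) a a = ∑ i : Fin 2, ∑ j : Fin 2,
        a i * a j * D (basisVec r) (basisVec i) (basisVec j) := by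
      rw [form_apply (D (basisVec r)) a a]
      simp only [Fin.sum_univ_two]
      ring
    have h3 : B (c t) b (basisVec r) = ∑ k, formMatrix (B (c t)) r k * b k := by
      rw [linear_plane_apply (B (c t)) b]
      simp only [add_apply, smul_apply, smul_eq_mul, Fin.sum_univ_two, formMatrix_apply]
      rw [hsymm (basisVec 0), hsymm (basisVec 1)]
      ring
    rw [h1, h2, h3, Matrix.mulVec, dotProduct]
    have l00 := hl 0 0
    have l01 := hl 0 1
    have l10 := hl 1 0
    have l11 := hl 1 1
    simp only [hw, Fin.sum_univ_two] at l00 l01 l10 l11 ⊢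
    linear_combination a 0 * a 0 * l00 + a 0 * a 1 * l01 + a 1 * a 0 * l10 + a 1 * a 1 * l11
  have hlin : ∀ X : Plane, D a a X + B (c t) b X - 1 / 2 * D X a a =
      X 0 * (formMatrix (B (c t))).mulVec w 0 + X 1 * (formMatrix (B (c t))).mulVec w 1 := by
    intro X
    rw [key, key]
    have e1 := linear_plane_apply (D a a) X
    have e2 := linear_plane_apply (B (c t) b) X
    have e3 := trilinear_apply D X a a
    simp only [smul_eq_mul] at e1 e2
    linear_combination e1 + e2 - 1 / 2 * e3
  constructor
  · intro hg
    have h0 : (formMatrix (B (c t))).mulVec w = 0 := by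
      funext r
      rw [key]
      exact sub_eq_zero.2 (hg (basisVec r))
    have := Matrix.eq_zero_of_mulVec_eq_zero hdet h0
    exact fun k => congrFun this k
  · intro hk X
    have h0 : w = 0 := funext hk
    have := hlin X
    rw [h0, Matrix.mulVec_zero] at this
    simpa [sub_eq_zero] using this

end

/-- The geodesic equation is invariant under pull-back of the metric. -/
lemma GeodesicEq.of_comp {T : E → E} (hT : ContDiffAt ℝ 2 T (c t))
    (hc : ContDiffAt ℝ 2 c t) (hB' : DifferentiableAt ℝ B' (T (c t)))
    (hsymm : ∀ X Y, B' (T (c t)) X Y = B' (T (c t)) Y X)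
    (hBB' : ∀ᶠ z in 𝓝 (c t), ∀ X Y, B z X Y = B' (T z) (fderiv ℝ T z X) (fderiv ℝ T z Y))
    (hB : DifferentiableAt ℝ B (c t))
    (hg : GeodesicEq B' (fun s => T (c s)) t) : GeodesicEq B c t := by
  have hTd : ∀ᶠ z in 𝓝 (c t), DifferentiableAt ℝ T z :=
    (hT.eventually (by simp)).mono fun z hz => hz.differentiableAt (by simp)
  have hcd : ∀ᶠ s in 𝓝 t, DifferentiableAt ℝ c s :=
    (hc.eventually (by simp)).mono fun z hz => hz.differentiableAt (by simp)
  have hT2 : DifferentiableAt ℝ (fderiv ℝ T) (c t) :=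
    (hT.fderiv_right (m := 1) (by norm_num)).differentiableAt (by simp)
  have hc2 : DifferentiableAt ℝ (deriv c) t := by
    have h1 := (hc.fderiv_right (m := 1) (by norm_num)).differentiableAt (by simp)
    exact h1.clm_apply (differentiableAt_const (1 : ℝ))
  set D2 := fderiv ℝ (fderiv ℝ T) (c t) with hD2
  have hD2s : ∀ X Y, D2 X Y = D2 Y X := fun X Y =>
    (hT.isSymmSndFDerivAt (by simp)).eq X Y
  have h1 : deriv (fun s => T (c s)) =ᶠ[𝓝 t] fun s => fderiv ℝ T (c s) (deriv c s) := by
    filter_upwards [hcd, hcd.self_of_nhds.continuousAt.eventually hTd] with s hs hs'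
    exact (hs'.hasFDerivAt.comp_hasDerivAt s hs.hasDerivAt).deriv
  have h2 : deriv (deriv fun s => T (c s)) t =
      D2 (deriv c t) (deriv c t) + fderiv ℝ T (c t) (deriv (deriv c) t) := by
    rw [h1.deriv_eq]
    exact ((hT2.hasFDerivAt.comp_hasDerivAt t hcd.self_of_nhds.hasDerivAt).clm_apply
      hc2.hasDerivAt).deriv
  -- This is the product rule applied to `B = T^*B'`. In the weak equation the terms with `D2`
  -- cancel by symmetry of the second derivative, apart from the one that belongs to the
  -- acceleration of `T ∘ c`.
  have h3 : ∀ Z X Y, fderiv ℝ B (c t) Z X Y =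
      fderiv ℝ B' (T (c t)) (fderiv ℝ T (c t) Z) (fderiv ℝ T (c t) X) (fderiv ℝ T (c t) Y) +
      B' (T (c t)) (D2 Z X) (fderiv ℝ T (c t) Y) +
      B' (T (c t)) (fderiv ℝ T (c t) X) (D2 Z Y) := by
    intro Z X Y
    have e1 := hasFDerivAt_form_apply hB X Y
    have f1 : HasFDerivAt (fun z => B' (T z)) (fderiv ℝ B' (T (c t)) ∘L fderiv ℝ T (c t)) (c t) :=
      HasFDerivAt.comp (G := E →L[ℝ] E →L[ℝ] ℝ) (c t) hB'.hasFDerivAt hTd.self_of_nhds.hasFDerivAt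
    have f2 : ∀ W, HasFDerivAt (fun z => fderiv ℝ T z W) (D2.flip W) (c t) := fun W =>
      (hT2.hasFDerivAt.clm_apply (hasFDerivAt_const W (c t))).congr_fderiv (by ext; simp [hD2])
    have e2 := (f1.clm_apply (f2 X)).clm_apply (f2 Y)
    have e3 := e2.congr_of_eventuallyEq (f₁ := fun z => B z X Y)
      (hBB'.mono fun z hz => hz X Y)
    have e4 := DFunLike.congr_fun (e1.unique e3) Z
    simp only [ContinuousLinearMap.flip_apply] at e4
    rw [e4]
    simp only [add_apply, ContinuousLinearMap.comp_apply, ContinuousLinearMap.flip_apply]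
    ring
  intro X
  -- Only test vectors in the range of `dT` are needed, so `dT` need not be invertible.
  have hX := hg (fderiv ℝ T (c t) X)
  rw [h1.eq_of_nhds, h2] at hX
  rw [h3, h3, hBB'.self_of_nhds]
  simp only [map_add, add_apply] at hX
  rw [hsymm (D2 X (deriv c t)) (fderiv ℝ T (c t) (deriv c t)), hD2s X (deriv c t)]
  linear_combination hX

/-- Solutions of the geodesic equation have constant speed. -/
lemma GeodesicEq.hasDerivAt_speed (hB : DifferentiableAt ℝ B (c t)) (hc : ContDiffAt ℝ 2 c t)
    (hsymm : ∀ X Y, B (c t) X Y = B (c t) Y X) (hg : GeodesicEq B c t) :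
    HasDerivAt (fun s => B (c s) (deriv c s) (deriv c s)) 0 t := by
  have hc1 : HasDerivAt c (deriv c t) t := (hc.differentiableAt (by simp)).hasDerivAt
  have hc2 : HasDerivAt (deriv c) (deriv (deriv c) t) t := by
    have h1 := (hc.fderiv_right (m := 1) (by norm_num)).differentiableAt (by simp)
    exact (h1.clm_apply (differentiableAt_const (1 : ℝ))).hasDerivAt
  have h0 : HasDerivAt (fun s => B (c s)) (fderiv ℝ B (c t) (deriv c t)) t :=
    HasFDerivAt.comp_hasDerivAt (E := E →L[ℝ] E →L[ℝ] ℝ) (F := E) t hB.hasFDerivAt hc1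
  have h := (h0.clm_apply hc2).clm_apply hc2
  refine h.congr_deriv ?_
  have h1 := hg (deriv c t)
  simp only [add_apply]
  rw [hsymm (deriv c t)]
  linear_combination 2 * h1

end GeodesicEquation

end LorentzSurface

namespace LorentzSurface

/-! ### Metrics pulled back by parametrisations -/

section PullBack

set_option synthInstance.maxHeartbeats 200000

variable {M : Type*} [TopologicalSpace M] [ChartedSpace Plane M] [IsManifold (𝓡 2) ∞ M]

/-- The metric at `q`, as a bilinear form on the model plane. -/
noncomputable def LorentzMetric.form (g : LorentzMetric M) (q : M) :
    Plane →L[ℝ] Plane →L[ℝ] ℝ := g.val q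

/-- The differential of a parametrisation, as an endomorphism of the model plane. -/
noncomputable def planeDeriv (x : Plane → M) (y : Plane) : Plane →L[ℝ] Plane :=
  mfderiv 𝓘(ℝ, Plane) (𝓡 2) x y

/-- The metric pulled back by a parametrisation. -/
noncomputable def pullForm (g : LorentzMetric M) (x : Plane → M) (y : Plane) :
    Plane →L[ℝ] Plane →L[ℝ] ℝ :=
  (g.form (x y)).bilinearComp (planeDeriv x y) (planeDeriv x y)

lemma pullForm_apply (g : LorentzMetric M) (x : Plane → M) (y X Y : Plane) :
    pullForm g x y X Y = g.val (x y) (mfderiv 𝓘(ℝ, Plane) (𝓡 2) x y X)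
      (mfderiv 𝓘(ℝ, Plane) (𝓡 2) x y Y) := rfl

lemma pullForm_symm (g : LorentzMetric M) (x : Plane → M) (y X Y : Plane) :
    pullForm g x y X Y = pullForm g x y Y X := g.symm _ _ _

lemma metricCoeff_eq (g : LorentzMetric M) (e : OpenPartialHomeomorph M Plane) :
    metricCoeff g e = fun y => formMatrix (pullForm g e.symm y) := rfl

lemma pullForm_congr (g : LorentzMetric M) {x x' : Plane → M} {y : Plane} (h : x =ᶠ[𝓝 y] x') :
    pullForm g x y = pullForm g x' y := by
  have h1 : planeDeriv x y = planeDeriv x' y := h.mfderiv_eq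
  rw [pullForm, pullForm, h1, h.eq_of_nhds]

lemma pullForm_comp (g : LorentzMetric M) {x : Plane → M} {T : Plane → Plane} {y : Plane}
    (hx : MDifferentiableAt 𝓘(ℝ, Plane) (𝓡 2) x (T y)) (hT : DifferentiableAt ℝ T y)
    (X Y : Plane) :
    pullForm g (fun z => x (T z)) y X Y =
      pullForm g x (T y) (fderiv ℝ T y X) (fderiv ℝ T y Y) := by
  have h : mfderiv 𝓘(ℝ, Plane) (𝓡 2) (x ∘ T) y =
      (mfderiv 𝓘(ℝ, Plane) (𝓡 2) x (T y)).comp (mfderiv 𝓘(ℝ, Plane) 𝓘(ℝ, Plane) T y) :=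
    mfderiv_comp y hx hT.mdifferentiableAt
  rw [mfderiv_eq_fderiv] at h
  rw [pullForm_apply, pullForm_apply]
  change g.val (x (T y)) (mfderiv 𝓘(ℝ, Plane) (𝓡 2) (x ∘ T) y X)
    (mfderiv 𝓘(ℝ, Plane) (𝓡 2) (x ∘ T) y Y) = _
  rw [h]
  rfl

/-- The tangent map carries constant fields to smooth vector fields along `x`. The metric, a smooth
section of the bundle of bilinear forms, is evaluated on these. -/
lemma contDiffOn_pullForm (g : LorentzMetric M) {x : Plane → M} {V : Set Plane} (hV : IsOpen V)
    (hx : ContMDiffOn 𝓘(ℝ, Plane) (𝓡 2) ∞ x V) : ContDiffOn ℝ ∞ (pullForm g x) V := by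
  rw [contDiffOn_clm_apply]
  intro X
  rw [contDiffOn_clm_apply]
  intro Y y hy
  have hvec : ∀ Z : Plane, ContMDiffAt 𝓘(ℝ, Plane) ((𝓡 2).prod 𝓘(ℝ, Plane)) ∞
      (fun m => (⟨x m, mfderiv 𝓘(ℝ, Plane) (𝓡 2) x m Z⟩ : TangentBundle (𝓡 2) M)) y := by
    intro Z
    have h1 : ContMDiffAt 𝓘(ℝ, Plane) (𝓘(ℝ, Plane).prod 𝓘(ℝ, Plane)) ∞
        (fun m => (⟨m, Z⟩ : TangentBundle 𝓘(ℝ, Plane) Plane)) y :=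
      contMDiffAt_vectorSpace_iff_contDiffAt.2 contDiffAt_const
    have h2 := (hx.contMDiffOn_tangentMapWithin (m := ∞) le_rfl hV.uniqueMDiffOn)
    have h3 : ContMDiffAt (𝓘(ℝ, Plane).prod 𝓘(ℝ, Plane)) ((𝓡 2).prod 𝓘(ℝ, Plane)) ∞
        (tangentMapWithin 𝓘(ℝ, Plane) (𝓡 2) x V) (⟨y, Z⟩ : TangentBundle 𝓘(ℝ, Plane) Plane) :=
      h2.contMDiffAt ((hV.preimage (FiberBundle.continuous_proj Plane
        (TangentSpace 𝓘(ℝ, Plane) (M := Plane)))).mem_nhds hy)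
    refine (h3.comp y h1).congr_of_eventuallyEq ?_
    filter_upwards [hV.mem_nhds hy] with m hm
    simp only [Function.comp_apply, tangentMapWithin]
    rw [mfderivWithin_of_isOpen hV hm]
  have hxy : ContMDiffAt 𝓘(ℝ, Plane) (𝓡 2) ∞ x y := hx.contMDiffAt (hV.mem_nhds hy)
  have h : ContMDiffAt 𝓘(ℝ, Plane) ((𝓡 2).prod 𝓘(ℝ, ℝ)) ∞
      (fun m => Bundle.TotalSpace.mk' ℝ (E := Bundle.Trivial M ℝ) (x m)
        (g.val (x m) (mfderiv 𝓘(ℝ, Plane) (𝓡 2) x m X) (mfderiv 𝓘(ℝ, Plane) (𝓡 2) x m Y))) y := by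
    apply ContMDiffAt.clm_bundle_apply₂ (F₁ := Plane) (F₂ := Plane)
      (E₁ := fun p : M => TangentSpace (𝓡 2) p) (E₂ := fun p : M => TangentSpace (𝓡 2) p)
    · exact g.contMDiff.contMDiffAt.comp y hxy
    · exact hvec X
    · exact hvec Y
  simp only [Bundle.contMDiffAt_totalSpace] at h
  exact (contMDiffAt_iff_contDiffAt.1 h.2).contDiffWithinAt

/-- A binary quadratic form that takes values of both signs has negative discriminant. -/
lemma det_neg_of_indefinite {a b d : ℝ} {x₁ y₁ x₂ y₂ : ℝ}
    (h₁ : a * x₁ ^ 2 + 2 * b * x₁ * y₁ + d * y₁ ^ 2 < 0)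
    (h₂ : 0 < a * x₂ ^ 2 + 2 * b * x₂ * y₂ + d * y₂ ^ 2) : a * d - b ^ 2 < 0 := by
  by_contra! hD
  -- Completing the square: the product equals `(a x + b y)² + (a d - b²) y²`.
  have key : ∀ x y : ℝ, 0 ≤ a * (a * x ^ 2 + 2 * b * x * y + d * y ^ 2) := fun x y => by
    nlinarith [sq_nonneg (a * x + b * y), mul_nonneg hD (sq_nonneg y)]
  have ha1 : a ≤ 0 := by
    by_contra! ha
    nlinarith [key x₁ y₁, mul_pos_of_neg_of_neg (neg_lt_zero.2 ha) h₁]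
  have ha2 : 0 ≤ a := by
    by_contra! ha
    nlinarith [key x₂ y₂, mul_neg_of_neg_of_pos ha h₂]
  obtain rfl : a = 0 := le_antisymm ha1 ha2
  obtain rfl : b = 0 := by nlinarith [sq_nonneg b]
  have hd1 : d < 0 := by nlinarith [sq_nonneg y₁]
  nlinarith [sq_nonneg y₂]

/-- On a plane an injective differential is onto, so a timelike and a spacelike vector both lift to
coordinates. The index of the metric thereby becomes a sign condition on the determinant. -/
lemma det_pullForm_neg (g : LorentzMetric M) {x : Plane → M} {y : Plane}
    (hx : Function.Injective (mfderiv 𝓘(ℝ, Plane) (𝓡 2) x y)) :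
    (formMatrix (pullForm g x y)).det < 0 := by
  have hsurj : Function.Surjective (planeDeriv x y) :=
    LinearMap.injective_iff_surjective.1 (show Function.Injective (planeDeriv x y).toLinearMap from hx)
  obtain ⟨X, hX⟩ := g.exists_timelike (x y)
  obtain ⟨Y, hY⟩ := g.exists_spacelike (x y)
  obtain ⟨X, rfl⟩ := hsurj X
  obtain ⟨Y, rfl⟩ := hsurj Y
  have hX' : pullForm g x y X X < 0 := hX
  have hY' : 0 < pullForm g x y Y Y := hY
  rw [form_apply, pullForm_symm g x y (basisVec 1) (basisVec 0)] at hX' hY'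
  simp only [Matrix.det_fin_two, formMatrix_apply]
  rw [pullForm_symm g x y (basisVec 1) (basisVec 0), ← sq]
  exact det_neg_of_indefinite (x₁ := X 0) (y₁ := X 1) (x₂ := Y 0) (y₂ := Y 1)
    (by linarith) (by linarith)

omit [IsManifold (𝓡 2) ∞ M] in
lemma injective_mfderiv_symm {e : OpenPartialHomeomorph M Plane}
    (he : e ∈ IsManifold.maximalAtlas (𝓡 2) ∞ M) {y : Plane} (hy : y ∈ e.target) :
    Function.Injective (mfderiv 𝓘(ℝ, Plane) (𝓡 2) e.symm y) := by
  have he' : e.MDifferentiable (𝓡 2) (𝓡 2) :=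
    ⟨(contMDiffOn_of_mem_maximalAtlas he).mdifferentiableOn (by simp),
      (contMDiffOn_symm_of_mem_maximalAtlas he).mdifferentiableOn (by simp)⟩
  exact he'.symm.mfderiv_injective hy

/-- A regular smooth parametrisation is locally the inverse of a chart. -/
theorem exists_chart_of_regular {x : Plane → M} {V : Set Plane} (hV : IsOpen V)
    (hx : ContMDiffOn 𝓘(ℝ, Plane) (𝓡 2) ∞ x V)
    (hreg : ∀ y ∈ V, Function.Injective (mfderiv 𝓘(ℝ, Plane) (𝓡 2) x y)) {y₀ : Plane}
    (hy₀ : y₀ ∈ V) :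
    ∃ e ∈ IsManifold.maximalAtlas (𝓡 2) ∞ M, y₀ ∈ e.target ∧ e.target ⊆ V ∧
      EqOn e.symm x e.target := by
  set c := chartAt Plane (x y₀) with hc
  have hcA : c ∈ IsManifold.maximalAtlas (𝓡 2) ∞ M := IsManifold.chart_mem_maximalAtlas _
  set V' := V ∩ x ⁻¹' c.source with hV'
  have hV'o : IsOpen V' := hx.continuousOn.isOpen_inter_preimage hV c.open_source
  have hy₀' : y₀ ∈ V' := ⟨hy₀, mem_chart_source _ _⟩
  set F : Plane → Plane := fun y => c (x y) with hF
  have hFs : ContDiffOn ℝ ∞ F V' := by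
    rw [← contMDiffOn_iff_contDiffOn]
    exact (contMDiffOn_of_mem_maximalAtlas hcA).comp (hx.mono inter_subset_left)
      inter_subset_right
  have hcD : c.MDifferentiable (𝓡 2) (𝓡 2) :=
    ⟨(contMDiffOn_of_mem_maximalAtlas hcA).mdifferentiableOn (by simp),
      (contMDiffOn_symm_of_mem_maximalAtlas hcA).mdifferentiableOn (by simp)⟩
  have hFd : ∀ y ∈ V', ∃ A : Plane ≃L[ℝ] Plane, HasFDerivAt F (A : Plane →L[ℝ] Plane) y := by
    intro y hy
    have hd : HasFDerivAt F (fderiv ℝ F y) y :=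
      ((hFs.contDiffAt (hV'o.mem_nhds hy)).differentiableAt (by simp)).hasFDerivAt
    have hinj : Function.Injective (fderiv ℝ F y) := by
      have hcomp : mfderiv 𝓘(ℝ, Plane) 𝓘(ℝ, Plane) (c ∘ x) y =
          (mfderiv (𝓡 2) (𝓡 2) c (x y)).comp (mfderiv 𝓘(ℝ, Plane) (𝓡 2) x y) :=
        mfderiv_comp y (hcD.mdifferentiableAt hy.2)
          ((hx.contMDiffAt (hV.mem_nhds hy.1)).mdifferentiableAt (by simp))
      have h2 : fderiv ℝ F y = mfderiv 𝓘(ℝ, Plane) 𝓘(ℝ, Plane) (c ∘ x) y :=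
        mfderiv_eq_fderiv.symm
      rw [h2, hcomp]
      exact (hcD.mfderiv_injective hy.2).comp (hreg y hy.1)
    refine ⟨(LinearEquiv.ofInjectiveEndo (fderiv ℝ F y).toLinearMap
      hinj).toContinuousLinearEquiv, ?_⟩
    convert hd
    ext z
    rfl
  obtain ⟨A, hA⟩ := hFd y₀ hy₀'
  have hF₀ := hFs.contDiffAt (hV'o.mem_nhds hy₀')
  -- The inverse function theorem applies to the coordinate expression `F = c ∘ x`. The required
  -- chart is `F⁻¹ ∘ c`, with inverse `c⁻¹ ∘ F = x`.
  set P := (hF₀.toOpenPartialHomeomorph F hA (by simp)).restrOpen V' hV'o with hP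
  have hPF : ∀ y, P y = F y := fun y => rfl
  have hPs : P.source ⊆ V' := inter_subset_right
  have hy₀P : y₀ ∈ P.source :=
    ⟨hF₀.mem_toOpenPartialHomeomorph_source hA (by simp), hy₀'⟩
  have hPsymm : ContDiffOn ℝ ∞ P.symm P.target := by
    intro z hz
    have hz' := hPs (P.map_target hz)
    obtain ⟨A', hA'⟩ := hFd _ hz'
    exact (P.contDiffAt_symm hz hA' (hFs.contDiffAt (hV'o.mem_nhds hz'))).contDiffWithinAt
  set e := c.trans P.symm with he
  have htarget : ∀ y, y ∈ e.target ↔ y ∈ P.source := by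
    intro y
    rw [he, OpenPartialHomeomorph.trans_target]
    simp only [OpenPartialHomeomorph.symm_target, OpenPartialHomeomorph.symm_symm, mem_inter_iff,
      mem_preimage, and_iff_left_iff_imp]
    exact fun hy => c.map_source (hPs hy).2
  have heq : EqOn e.symm x e.target := by
    intro y hy
    have hy' := hPs ((htarget y).1 hy)
    change c.symm (c (x y)) = x y
    exact c.left_inv hy'.2
  refine ⟨e, ?_, (htarget _).2 hy₀P, fun y hy => (hPs ((htarget y).1 hy)).1, heq⟩
  rw [IsManifold.mem_maximalAtlas_iff_contMDiffOn]
  constructor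
  · refine ContMDiffOn.comp (t := P.target) (contMDiffOn_iff_contDiffOn.2 hPsymm)
      ((contMDiffOn_of_mem_maximalAtlas hcA).mono ?_) ?_
    · exact fun q hq => hq.1
    · exact fun q hq => hq.2
  · exact (hx.mono fun y hy => (hPs ((htarget y).1 hy)).1).congr heq

end PullBack

end LorentzSurface

namespace LorentzSurface

/-! ### Geodesics on the surface and change of charts -/

section Geodesics

lemma two_le_infty : (2 : WithTop ℕ∞) ≤ ∞ := WithTop.coe_le_coe.2 le_top

set_option synthInstance.maxHeartbeats 200000

variable {M : Type*} [TopologicalSpace M] [ChartedSpace Plane M] [IsManifold (𝓡 2) ∞ M]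

lemma GeodesicEq.congr {B : Plane → Plane →L[ℝ] Plane →L[ℝ] ℝ} {c c' : ℝ → Plane} {t : ℝ}
    (h : GeodesicEq B c t) (hcc' : c' =ᶠ[𝓝 t] c) : GeodesicEq B c' t := by
  intro X
  rw [hcc'.deriv.deriv_eq, hcc'.deriv_eq, hcc'.eq_of_nhds]
  exact h X

lemma GeodesicEq.congr_form {B B' : Plane → Plane →L[ℝ] Plane →L[ℝ] ℝ} {c : ℝ → Plane} {t : ℝ}
    (h : GeodesicEq B c t) (hB : B' =ᶠ[𝓝 (c t)] B) : GeodesicEq B' c t := by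
  intro X
  rw [hB.fderiv_eq, hB.eq_of_nhds]
  exact h X

lemma deriv_plane_apply {c : ℝ → Plane} {t : ℝ} (hc : DifferentiableAt ℝ c t) (k : Fin 2) :
    deriv (fun r => c r k) t = deriv c t k :=
  ((EuclideanSpace.proj k : Plane →L[ℝ] ℝ).hasFDerivAt.comp_hasDerivAt t hc.hasDerivAt).deriv

lemma deriv_deriv_plane_apply {c : ℝ → Plane} {t : ℝ} (hc : ContDiffAt ℝ 2 c t) (k : Fin 2) :
    deriv (deriv fun r => c r k) t = deriv (deriv c) t k := by
  have h1 : (deriv fun r => c r k) =ᶠ[𝓝 t] fun r => deriv c r k :=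
    (hc.eventually (by simp)).mono fun z hz =>
      deriv_plane_apply (hz.differentiableAt (by simp)) k
  rw [h1.deriv_eq]
  refine deriv_plane_apply ?_ k
  have h2 := (hc.fderiv_right (m := 1) (by norm_num)).differentiableAt (by simp)
  exact h2.clm_apply (differentiableAt_const (1 : ℝ))

omit [IsManifold (𝓡 2) ∞ M] in
lemma contDiffAt_chart_comp {e : OpenPartialHomeomorph M Plane}
    (he : e ∈ IsManifold.maximalAtlas (𝓡 2) ∞ M) {γ : ℝ → M} {t : ℝ}
    (hγ : ContMDiffAt 𝓘(ℝ, ℝ) (𝓡 2) ∞ γ t) (ht : γ t ∈ e.source) :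
    ContDiffAt ℝ ∞ (fun r => e (γ r)) t :=
  ((contMDiffAt_of_mem_maximalAtlas he ht).comp t hγ).contDiffAt

lemma contDiffOn_chartForm (g : LorentzMetric M) {e : OpenPartialHomeomorph M Plane}
    (he : e ∈ IsManifold.maximalAtlas (𝓡 2) ∞ M) :
    ContDiffOn ℝ ∞ (pullForm g e.symm) e.target :=
  contDiffOn_pullForm g e.open_target (contMDiffOn_symm_of_mem_maximalAtlas he)

lemma differentiableAt_chartForm (g : LorentzMetric M) {e : OpenPartialHomeomorph M Plane}
    (he : e ∈ IsManifold.maximalAtlas (𝓡 2) ∞ M) {y : Plane} (hy : y ∈ e.target) :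
    DifferentiableAt ℝ (pullForm g e.symm) y :=
  ((contDiffOn_chartForm g he).contDiffAt (e.open_target.mem_nhds hy)).differentiableAt (by simp)

lemma det_chartForm_neg (g : LorentzMetric M) {e : OpenPartialHomeomorph M Plane}
    (he : e ∈ IsManifold.maximalAtlas (𝓡 2) ∞ M) {y : Plane} (hy : y ∈ e.target) :
    (formMatrix (pullForm g e.symm y)).det < 0 :=
  det_pullForm_neg g (injective_mfderiv_symm he hy)

/-- The weak form contains no Christoffel symbols, which makes its behaviour under a change of
coordinates easy to compute. -/
lemma geodesicEq_iff_chart (g : LorentzMetric M) {e : OpenPartialHomeomorph M Plane}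
    (he : e ∈ IsManifold.maximalAtlas (𝓡 2) ∞ M) {γ : ℝ → M} {t : ℝ}
    (hγ : ContMDiffAt 𝓘(ℝ, ℝ) (𝓡 2) ∞ γ t) (ht : γ t ∈ e.source) :
    GeodesicEq (pullForm g e.symm) (fun r => e (γ r)) t ↔
      ∀ k : Fin 2, deriv (deriv fun r => e (γ r) k) t
      + ∑ i : Fin 2, ∑ j : Fin 2, christoffel (metricCoeff g e) k i j (e (γ t))
          * deriv (fun r => e (γ r) i) t * deriv (fun r => e (γ r) j) t = 0 := by
  have hc := contDiffAt_chart_comp he hγ ht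
  have ht' := e.map_source ht
  have e1 := deriv_plane_apply (hc.differentiableAt (by simp))
  have e2 := deriv_deriv_plane_apply (hc.of_le two_le_infty)
  simp only [e1, e2]
  exact geodesicEq_iff_christoffel (c := fun r => e (γ r)) (differentiableAt_chartForm g he ht')
    (pullForm_symm g e.symm _) (det_chartForm_neg g he ht').ne

/-- The geodesic equation does not depend on the chart. -/
lemma geodesicEq_of_chart (g : LorentzMetric M) {e e' : OpenPartialHomeomorph M Plane}
    (he : e ∈ IsManifold.maximalAtlas (𝓡 2) ∞ M) (he' : e' ∈ IsManifold.maximalAtlas (𝓡 2) ∞ M)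
    {γ : ℝ → M} {t : ℝ} (hγ : ContMDiffAt 𝓘(ℝ, ℝ) (𝓡 2) ∞ γ t) (ht : γ t ∈ e.source)
    (ht' : γ t ∈ e'.source) (h : GeodesicEq (pullForm g e'.symm) (fun r => e' (γ r)) t) :
    GeodesicEq (pullForm g e.symm) (fun r => e (γ r)) t := by
  -- The transition map pulls back the metric coefficients of `e'` to those of `e`.
  set T : Plane → Plane := fun z => e' (e.symm z) with hT
  have hO : IsOpen (e.target ∩ e.symm ⁻¹' e'.source) :=
    e.symm.isOpen_inter_preimage e'.open_source
  have hTs : ContDiffOn ℝ ∞ T (e.target ∩ e.symm ⁻¹' e'.source) := by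
    rw [← contMDiffOn_iff_contDiffOn]
    exact (contMDiffOn_of_mem_maximalAtlas he').comp
      ((contMDiffOn_symm_of_mem_maximalAtlas he).mono inter_subset_left) inter_subset_right
  have hmem : e (γ t) ∈ e.target ∩ e.symm ⁻¹' e'.source :=
    ⟨e.map_source ht, by rwa [mem_preimage, e.left_inv ht]⟩
  have hTt : T (e (γ t)) = e' (γ t) := by simp only [hT, e.left_inv ht]
  have htar : T (e (γ t)) ∈ e'.target := hTt ▸ e'.map_source ht'
  refine GeodesicEq.of_comp (B' := pullForm g e'.symm) (T := T)
    ((hTs.contDiffAt (hO.mem_nhds hmem)).of_le two_le_infty)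
    ((contDiffAt_chart_comp he hγ ht).of_le two_le_infty)
    (differentiableAt_chartForm g he' htar) (pullForm_symm g e'.symm _) ?_
    (differentiableAt_chartForm g he (e.map_source ht)) ?_
  · filter_upwards [hO.mem_nhds hmem] with z hz X Y
    rw [← pullForm_comp g ((contMDiffAt_symm_of_mem_maximalAtlas he'
      (e'.map_source hz.2)).mdifferentiableAt (by simp))
      ((hTs.contDiffAt (hO.mem_nhds hz)).differentiableAt (by simp))]
    rw [pullForm_congr g (x' := fun z => e'.symm (T z))]
    filter_upwards [hO.mem_nhds hz] with w hw
    exact (e'.left_inv hw.2).symm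
  · refine h.congr ?_
    filter_upwards [hγ.continuousAt.preimage_mem_nhds (e.open_source.mem_nhds ht)] with s hs
    simp only [hT, e.left_inv hs]

lemma IsGeodesicOn.geodesicEq {g : LorentzMetric M} {γ : ℝ → M} {J : Set ℝ}
    (hγ : IsGeodesicOn g γ J) (hJ : IsOpen J) {t : ℝ} (ht : t ∈ J)
    {e : OpenPartialHomeomorph M Plane} (he : e ∈ IsManifold.maximalAtlas (𝓡 2) ∞ M)
    (hte : γ t ∈ e.source) : GeodesicEq (pullForm g e.symm) (fun r => e (γ r)) t :=
  (geodesicEq_iff_chart g he (hγ.1.contMDiffAt (hJ.mem_nhds ht)) hte).2 (hγ.2 e he t ht hte)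

/-- A geodesic must satisfy its equation in every chart of the maximal atlas; by chart independence
one chart at each time is enough. -/
lemma isGeodesicOn_of_geodesicEq {g : LorentzMetric M} {γ : ℝ → M} {J : Set ℝ}
    (hJ : IsOpen J) (hγ : ContMDiffOn 𝓘(ℝ, ℝ) (𝓡 2) ∞ γ J)
    (h : ∀ t ∈ J, ∃ e ∈ IsManifold.maximalAtlas (𝓡 2) ∞ M, γ t ∈ e.source ∧
      GeodesicEq (pullForm g e.symm) (fun r => e (γ r)) t) : IsGeodesicOn g γ J := by
  refine ⟨hγ, fun e he t ht hte => ?_⟩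
  have hγt := hγ.contMDiffAt (hJ.mem_nhds ht)
  rw [← geodesicEq_iff_chart g he hγt hte]
  obtain ⟨e', he', hte', hg⟩ := h t ht
  exact geodesicEq_of_chart g he he' hγt hte hte' hg

end Geodesics

/-! ### The Jacobi equation -/

section ODE

lemma eq_of_hasDerivAt_zero {J : Set ℝ} (hJ : IsOpen J) (hJc : J.OrdConnected) {f : ℝ → ℝ}
    (hf : ∀ u ∈ J, HasDerivAt f 0 u) {a b : ℝ} (ha : a ∈ J) (hb : b ∈ J) : f a = f b :=
  hJ.is_const_of_deriv_eq_zero hJc.isPreconnected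
    (fun u hu => (hf u hu).differentiableAt.differentiableWithinAt)
    (fun u hu => (hf u hu).deriv) ha hb

/-- Uniqueness for the initial value problem `φ'' = k φ`, `φ(0) = 1`, `φ'(0) = 0`. -/
lemma eq_of_jacobi {J : Set ℝ} (hJ : IsOpen J) (hJc : J.OrdConnected) (h0 : (0 : ℝ) ∈ J)
    {φ φ' S T : ℝ → ℝ} {k : ℝ} (hφ : ∀ u ∈ J, HasDerivAt φ (φ' u) u)
    (hφ' : ∀ u ∈ J, HasDerivAt φ' (k * φ u) u) (hφ0 : φ 0 = 1) (hφ'0 : φ' 0 = 0)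
    (hS : ∀ u, HasDerivAt S (k * T u) u) (hT : ∀ u, HasDerivAt T (S u) u)
    (hST : ∀ u, S u ^ 2 - k * T u ^ 2 = 1) (hS0 : S 0 = 1) (hT0 : T 0 = 0) {u : ℝ} (hu : u ∈ J) :
    φ u = S u := by
  -- These are the Wronskians of `φ` with the solutions `T` and `S`. Both are constant, and `S² - k
  -- T² = 1` allows one to solve for `φ`.
  have h1 := eq_of_hasDerivAt_zero hJ hJc (f := fun u => φ u * S u - φ' u * T u)
    (fun u hu => (((hφ u hu).mul (hS u)).sub ((hφ' u hu).mul (hT u))).congr_deriv (by ring))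
    hu h0
  have h2 := eq_of_hasDerivAt_zero hJ hJc (f := fun u => φ' u * S u - k * φ u * T u)
    (fun u hu => (((hφ' u hu).mul (hS u)).sub
      (((hφ u hu).const_mul k).mul (hT u))).congr_deriv (by ring)) hu h0
  simp only [hφ0, hφ'0, hS0, hT0] at h1 h2
  linear_combination S u * h1 + T u * h2 - φ u * hST u

/-- A metric coefficient whose curvature equation is `-ε G K = -G''/2 + G'²/(4G)` is `ε φ²` for the
solution `φ` of the Jacobi equation. -/
lemma eq_of_curvature_equation {J : Set ℝ} (hJ : IsOpen J) (hJc : J.OrdConnected)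
    (h0 : (0 : ℝ) ∈ J) {G G' G'' S T : ℝ → ℝ} {ε K : ℝ} (hε : ε ^ 2 = 1)
    (hG : ∀ u ∈ J, HasDerivAt G (G' u) u) (hG' : ∀ u ∈ J, HasDerivAt G' (G'' u) u)
    (hpos : ∀ u ∈ J, 0 < ε * G u)
    (hK : ∀ u ∈ J, -ε * G u * K = -(1 / 2) * G'' u + G' u ^ 2 / (4 * G u))
    (hG0 : G 0 = ε) (hG'0 : G' 0 = 0)
    (hS : ∀ u, HasDerivAt S (ε * K * T u) u) (hT : ∀ u, HasDerivAt T (S u) u)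
    (hST : ∀ u, S u ^ 2 - ε * K * T u ^ 2 = 1) (hS0 : S 0 = 1) (hT0 : T 0 = 0) {u : ℝ}
    (hu : u ∈ J) : G u = ε * S u ^ 2 := by
  -- The square root linearises the curvature equation to `φ'' = ε K φ`.
  set φ : ℝ → ℝ := fun u => √(ε * G u) with hφ
  have hφpos : ∀ u ∈ J, 0 < φ u := fun u hu => Real.sqrt_pos.2 (hpos u hu)
  have hφsq : ∀ u ∈ J, φ u ^ 2 = ε * G u := fun u hu => Real.sq_sqrt (hpos u hu).le
  have hGφ : ∀ u ∈ J, G u = ε * φ u ^ 2 := fun u hu => by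
    rw [hφsq u hu, ← mul_assoc, ← sq, hε, one_mul]
  have hd : ∀ u ∈ J, HasDerivAt φ (ε * G' u / (2 * φ u)) u := fun u hu =>
    ((hG u hu).const_mul ε).sqrt (hpos u hu).ne'
  have hd' : ∀ u ∈ J, HasDerivAt (fun u => ε * G' u / (2 * φ u)) (ε * K * φ u) u := by
    intro u hu
    have hne := (hφpos u hu).ne'
    refine (((hG' u hu).const_mul ε).div ((hd u hu).const_mul 2) (by positivity)).congr_deriv ?_
    have hKu := hK u hu
    have hε0 : ε ≠ 0 := by
      rintro rfl
      norm_num at hε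
    rw [hGφ u hu] at hKu
    have hG2 : G'' u = 2 * ε * (ε * φ u ^ 2) * K + G' u ^ 2 / (2 * (ε * φ u ^ 2)) := by
      have : G' u ^ 2 / (4 * (ε * φ u ^ 2)) = 1 / 2 * (G' u ^ 2 / (2 * (ε * φ u ^ 2))) := by
        field_simp
        norm_num
      linear_combination 2 * hKu + 2 * this
    rw [hG2]
    field_simp
    linear_combination (2 * K * ε * φ u ^ 4 * 2 - G' u ^ 2) * hε
  have hφ0 : φ 0 = 1 := by simp only [hφ, hG0, ← sq, hε, Real.sqrt_one]
  have := eq_of_jacobi hJ hJc h0 hd hd' hφ0 (by simp [hG'0]) hS hT hST hS0 hT0 hu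
  rw [hGφ u hu, this]

end ODE

end LorentzSurface

namespace LorentzSurface

/-! ### The metric in Fermi-type coordinates -/

section FermiUniqueness

set_option synthInstance.maxHeartbeats 200000

/-- The identification of the coordinate plane with `ℝ × ℝ`. -/
noncomputable def toPair : Plane ≃L[ℝ] ℝ × ℝ :=
  (EuclideanSpace.equiv (Fin 2) ℝ).trans (ContinuousLinearEquiv.finTwoArrow ℝ ℝ)

lemma toPair_apply (y : Plane) : toPair y = (y 0, y 1) := rfl

lemma toPair_symm_coords (y : Plane) : toPair.symm (y 0, y 1) = y := toPair.symm_apply_apply y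

lemma formMatrix_eq {B : Plane →L[ℝ] Plane →L[ℝ] ℝ} {a b c d : ℝ}
    (h00 : B (basisVec 0) (basisVec 0) = a) (h01 : B (basisVec 0) (basisVec 1) = b)
    (h10 : B (basisVec 1) (basisVec 0) = c) (h11 : B (basisVec 1) (basisVec 1) = d) :
    formMatrix B = !![a, b; c, d] := by
  ext i j
  fin_cases i <;> fin_cases j
  · exact h00
  · exact h01
  · exact h10
  · exact h11

lemma toPair_basisVec_zero : toPair (basisVec 0) = (1, 0) := by
  simp [toPair_apply]

lemma toPair_basisVec_one : toPair (basisVec 1) = (0, 1) := by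
  simp [toPair_apply]

lemma hasDerivAt_toPair_symm_left (u v : ℝ) :
    HasDerivAt (fun r : ℝ => toPair.symm (r, v)) (basisVec 0) u := by
  have h := (toPair.symm : ℝ × ℝ →L[ℝ] Plane).hasFDerivAt.comp_hasDerivAt u
    ((hasDerivAt_id u).prodMk (hasDerivAt_const u v))
  refine h.congr_deriv ?_
  rw [← toPair_basisVec_zero]
  exact toPair.symm_apply_apply _

lemma hasDerivAt_toPair_symm_right (u v : ℝ) :
    HasDerivAt (fun r : ℝ => toPair.symm (u, r)) (basisVec 1) v := by
  have h := (toPair.symm : ℝ × ℝ →L[ℝ] Plane).hasFDerivAt.comp_hasDerivAt v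
    ((hasDerivAt_const v u).prodMk (hasDerivAt_id v))
  refine h.congr_deriv ?_
  rw [← toPair_basisVec_one]
  exact toPair.symm_apply_apply _

variable {M : Type*} [TopologicalSpace M] [ChartedSpace Plane M] [IsManifold (𝓡 2) ∞ M]

section General

variable {g : LorentzMetric M} {U : Set (ℝ × ℝ)} {x : ℝ × ℝ → M}

omit [IsManifold (𝓡 2) ∞ M] in
lemma mfderiv_comp_toPair (hU : IsOpen U) (hx : ContMDiffOn 𝓘(ℝ, ℝ × ℝ) (𝓡 2) ∞ x U) {y : Plane}
    (hy : toPair y ∈ U) (X : Plane) :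
    (mfderiv 𝓘(ℝ, Plane) (𝓡 2) (fun z => x (toPair z)) y X : Plane) =
      mfderiv 𝓘(ℝ, ℝ × ℝ) (𝓡 2) x (toPair y) (toPair X) := by
  have h1 : MDifferentiableAt 𝓘(ℝ, ℝ × ℝ) (𝓡 2) x (toPair y) :=
    (hx.contMDiffAt (hU.mem_nhds hy)).mdifferentiableAt (by simp)
  have h2 : HasFDerivAt toPair (toPair : Plane →L[ℝ] ℝ × ℝ) y := toPair.hasFDerivAt
  have h3 : mfderiv 𝓘(ℝ, Plane) (𝓡 2) (x ∘ toPair) y =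
      (mfderiv 𝓘(ℝ, ℝ × ℝ) (𝓡 2) x (toPair y)).comp
        (mfderiv 𝓘(ℝ, Plane) 𝓘(ℝ, ℝ × ℝ) toPair y) :=
    mfderiv_comp y h1 h2.differentiableAt.mdifferentiableAt
  rw [mfderiv_eq_fderiv, h2.fderiv] at h3
  change mfderiv 𝓘(ℝ, Plane) (𝓡 2) (x ∘ toPair) y X = _
  rw [h3]
  rfl

lemma pullForm_comp_toPair (hU : IsOpen U) (hx : ContMDiffOn 𝓘(ℝ, ℝ × ℝ) (𝓡 2) ∞ x U) {y : Plane}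
    (hy : toPair y ∈ U) (X Y : Plane) :
    pullForm g (fun z => x (toPair z)) y X Y =
      g.val (x (toPair y)) (mfderiv 𝓘(ℝ, ℝ × ℝ) (𝓡 2) x (toPair y) (toPair X))
        (mfderiv 𝓘(ℝ, ℝ × ℝ) (𝓡 2) x (toPair y) (toPair Y)) := by
  rw [pullForm_apply]
  exact congrArg₂ (fun A B : Plane => g.form (x (toPair y)) A B)
    (mfderiv_comp_toPair hU hx hy X) (mfderiv_comp_toPair hU hx hy Y)

omit [IsManifold (𝓡 2) ∞ M] in
lemma contMDiffOn_comp_toPair (hx : ContMDiffOn 𝓘(ℝ, ℝ × ℝ) (𝓡 2) ∞ x U) :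
    ContMDiffOn 𝓘(ℝ, Plane) (𝓡 2) ∞ (fun z => x (toPair z)) (toPair ⁻¹' U) :=
  hx.comp (toPair.contDiff.contMDiff.contMDiffOn) (fun _ hz => hz)

omit [IsManifold (𝓡 2) ∞ M] in
lemma velocity_left (hU : IsOpen U) (hx : ContMDiffOn 𝓘(ℝ, ℝ × ℝ) (𝓡 2) ∞ x U) {u v : ℝ}
    (hq : (u, v) ∈ U) :
    velocity (fun r => x (r, v)) u = mfderiv 𝓘(ℝ, ℝ × ℝ) (𝓡 2) x (u, v) ((1, 0) : ℝ × ℝ) := by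
  have h1 : MDifferentiableAt 𝓘(ℝ, ℝ × ℝ) (𝓡 2) x (u, v) :=
    (hx.contMDiffAt (hU.mem_nhds hq)).mdifferentiableAt (by simp)
  have h2 : HasDerivAt (fun r : ℝ => (r, v)) ((1 : ℝ), (0 : ℝ)) u :=
    (hasDerivAt_id u).prodMk (hasDerivAt_const u v)
  have h3 : mfderiv 𝓘(ℝ, ℝ) (𝓡 2) (x ∘ fun r : ℝ => (r, v)) u =
      (mfderiv 𝓘(ℝ, ℝ × ℝ) (𝓡 2) x (u, v)).comp
        (mfderiv 𝓘(ℝ, ℝ) 𝓘(ℝ, ℝ × ℝ) (fun r : ℝ => (r, v)) u) :=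
    mfderiv_comp u h1 h2.differentiableAt.mdifferentiableAt
  rw [mfderiv_eq_fderiv, h2.hasFDerivAt.fderiv] at h3
  change mfderiv 𝓘(ℝ, ℝ) (𝓡 2) (x ∘ fun r : ℝ => (r, v)) u (1 : ℝ) = _
  rw [h3]
  change mfderiv 𝓘(ℝ, ℝ × ℝ) (𝓡 2) x (u, v) ((1 : ℝ) • ((1 : ℝ), (0 : ℝ)) : ℝ × ℝ) = _
  rw [one_smul]

omit [IsManifold (𝓡 2) ∞ M] in
lemma velocity_right (hU : IsOpen U) (hx : ContMDiffOn 𝓘(ℝ, ℝ × ℝ) (𝓡 2) ∞ x U) {u v : ℝ}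
    (hq : (u, v) ∈ U) :
    velocity (fun r => x (u, r)) v = mfderiv 𝓘(ℝ, ℝ × ℝ) (𝓡 2) x (u, v) ((0, 1) : ℝ × ℝ) := by
  have h1 : MDifferentiableAt 𝓘(ℝ, ℝ × ℝ) (𝓡 2) x (u, v) :=
    (hx.contMDiffAt (hU.mem_nhds hq)).mdifferentiableAt (by simp)
  have h2 : HasDerivAt (fun r : ℝ => (u, r)) ((0 : ℝ), (1 : ℝ)) v :=
    (hasDerivAt_const v u).prodMk (hasDerivAt_id v)
  have h3 : mfderiv 𝓘(ℝ, ℝ) (𝓡 2) (x ∘ fun r : ℝ => (u, r)) v =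
      (mfderiv 𝓘(ℝ, ℝ × ℝ) (𝓡 2) x (u, v)).comp
        (mfderiv 𝓘(ℝ, ℝ) 𝓘(ℝ, ℝ × ℝ) (fun r : ℝ => (u, r)) v) :=
    mfderiv_comp v h1 h2.differentiableAt.mdifferentiableAt
  rw [mfderiv_eq_fderiv, h2.hasFDerivAt.fderiv] at h3
  change mfderiv 𝓘(ℝ, ℝ) (𝓡 2) (x ∘ fun r : ℝ => (u, r)) v (1 : ℝ) = _
  rw [h3]
  change mfderiv 𝓘(ℝ, ℝ × ℝ) (𝓡 2) x (u, v) ((1 : ℝ) • ((0 : ℝ), (1 : ℝ)) : ℝ × ℝ) = _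
  rw [one_smul]

/-- A curve that is parametrised by an affine curve in the coordinate plane satisfies the geodesic
equation of the pulled back metric with vanishing acceleration. -/
lemma IsGeodesicOn.pullForm_eq {X : Plane → M} {V : Set Plane} (hV : IsOpen V)
    (hX : ContMDiffOn 𝓘(ℝ, Plane) (𝓡 2) ∞ X V)
    (hreg : ∀ y ∈ V, Function.Injective (mfderiv 𝓘(ℝ, Plane) (𝓡 2) X y))
    {γ : ℝ → M} {J : Set ℝ} (hγ : IsGeodesicOn g γ J) (hJ : IsOpen J) {t : ℝ} (ht : t ∈ J)
    {c : ℝ → Plane} {w : Plane} (hc : ∀ r, HasDerivAt c w r) (hct : c t ∈ V)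
    (hγc : ∀ᶠ r in 𝓝 t, γ r = X (c r)) (Z : Plane) :
    fderiv ℝ (pullForm g X) (c t) w w Z = 1 / 2 * fderiv ℝ (pullForm g X) (c t) Z w w := by
  -- The geodesic equation is known in charts only; locally the parametrisation is the inverse of
  -- one.
  obtain ⟨e, he, hye, heV, heq⟩ := exists_chart_of_regular hV hX hreg hct
  have hγt : γ t = e.symm (c t) := hγc.self_of_nhds.trans (heq hye).symm
  have hte : γ t ∈ e.source := hγt ▸ e.map_target hye
  have h1 := hγ.geodesicEq hJ ht he hte
  have hcurve : c =ᶠ[𝓝 t] fun r => e (γ r) := by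
    filter_upwards [hγc, (hc t).continuousAt.preimage_mem_nhds (e.open_target.mem_nhds hye)]
      with r hr hr'
    rw [hr, ← heq hr', e.right_inv hr']
  have hform : pullForm g X =ᶠ[𝓝 (c t)] pullForm g e.symm := by
    filter_upwards [e.open_target.mem_nhds hye] with z hz
    refine pullForm_congr g ?_
    filter_upwards [e.open_target.mem_nhds hz] with z' hz'
    exact (heq hz').symm
  have h2 := ((h1.congr hcurve).congr_form hform) Z
  have hd : deriv c = fun _ => w := funext fun r => (hc r).deriv
  rw [hd] at h2
  simpa using h2

/-- The curvature assumption concerns charts; it transfers because a regular parametrisation is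
locally the inverse of a chart and curvature is local. -/
lemma gaussCurvature_pullForm {K : ℝ} (hg : HasConstantCurvature g K) {X : Plane → M}
    {V : Set Plane} (hV : IsOpen V) (hX : ContMDiffOn 𝓘(ℝ, Plane) (𝓡 2) ∞ X V)
    (hreg : ∀ y ∈ V, Function.Injective (mfderiv 𝓘(ℝ, Plane) (𝓡 2) X y)) {y : Plane}
    (hy : y ∈ V) : gaussCurvature (fun z => formMatrix (pullForm g X z)) y = K := by
  obtain ⟨e, he, hye, heV, heq⟩ := exists_chart_of_regular hV hX hreg hy
  rw [← hg e he y hye, metricCoeff_eq]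
  refine gaussCurvature_congr ?_
  filter_upwards [e.open_target.mem_nhds hye] with z hz
  rw [pullForm_congr g (x' := e.symm)]
  filter_upwards [e.open_target.mem_nhds hz] with z' hz'
  exact (heq hz').symm

end General

lemma IsFermi.injective_mfderiv {g : LorentzMetric M} {ε : ℝ} {I : Set ℝ} {γ : ℝ → M}
    {U : Set (ℝ × ℝ)} {x : ℝ × ℝ → M} (hx : IsFermi g ε I γ U x) {y : Plane} (hy : toPair y ∈ U) :
    Function.Injective (mfderiv 𝓘(ℝ, Plane) (𝓡 2) (fun z => x (toPair z)) y) := by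
  intro A B hAB
  have hA := mfderiv_comp_toPair hx.isOpen_domain hx.contMDiffOn hy A
  have hB := mfderiv_comp_toPair hx.isOpen_domain hx.contMDiffOn hy B
  exact toPair.injective (hx.regular _ hy ((hA.symm.trans hAB).trans hB))

set_option maxHeartbeats 1000000 in
/-- The coefficients of the metric in Fermi-type coordinates. -/
theorem IsFermi.metric_eq {g : LorentzMetric M} {K : ℝ} (hg : HasConstantCurvature g K) {ε : ℝ}
    (hε : ε ^ 2 = 1) {S T : ℝ → ℝ}
    (hS : ∀ u, HasDerivAt S (ε * K * T u) u) (hT : ∀ u, HasDerivAt T (S u) u)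
    (hST : ∀ u, S u ^ 2 - ε * K * T u ^ 2 = 1) (hS0 : S 0 = 1) (hT0 : T 0 = 0)
    {I : Set ℝ} {γ : ℝ → M} {U : Set (ℝ × ℝ)} {x : ℝ × ℝ → M} (hx : IsFermi g ε I γ U x) :
    ∀ y : Plane, toPair y ∈ U →
      pullForm g (fun z => x (toPair z)) y (basisVec 0) (basisVec 0) = -ε ∧
      pullForm g (fun z => x (toPair z)) y (basisVec 0) (basisVec 1) = 0 ∧
      pullForm g (fun z => x (toPair z)) y (basisVec 1) (basisVec 1) = ε * S (y 0) ^ 2 := by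
  set X : Plane → M := fun z => x (toPair z) with hXdef
  set V : Set Plane := toPair ⁻¹' U with hVdef
  have hV : IsOpen V := hx.isOpen_domain.preimage toPair.continuous
  have hX : ContMDiffOn 𝓘(ℝ, Plane) (𝓡 2) ∞ X V := contMDiffOn_comp_toPair hx.contMDiffOn
  have hreg : ∀ y ∈ V, Function.Injective (mfderiv 𝓘(ℝ, Plane) (𝓡 2) X y) := fun y hy =>
    hx.injective_mfderiv hy
  set P := pullForm g X with hP
  have hPs : ContDiffOn ℝ ∞ P V := contDiffOn_pullForm g hV hX
  have hPd : ∀ y ∈ V, DifferentiableAt ℝ P y := fun y hy =>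
    (hPs.contDiffAt (hV.mem_nhds hy)).differentiableAt (by simp)
  have hsymm : ∀ y A B, P y A B = P y B A := fun y A B => pullForm_symm g X y A B
  have hdet : ∀ y ∈ V, P y (basisVec 0) (basisVec 0) * P y (basisVec 1) (basisVec 1) -
      P y (basisVec 0) (basisVec 1) ^ 2 < 0 := by
    intro y hy
    have h := det_pullForm_neg g (hreg y hy)
    rw [Matrix.det_fin_two] at h
    simp only [formMatrix_apply] at h
    rw [pullForm_symm g X y (basisVec 1) (basisVec 0), ← sq] at h
    exact h
  have hslice : ∀ v, IsOpen {u : ℝ | (u, v) ∈ U} := fun v =>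
    hx.isOpen_domain.preimage (by fun_prop : Continuous fun u : ℝ => (u, v))
  -- derivatives along the slices
  have hline : ∀ u v, (u, v) ∈ U → ∀ A B, HasDerivAt (fun r => P (toPair.symm (r, v)) A B)
      (fderiv ℝ P (toPair.symm (u, v)) (basisVec 0) A B) u := by
    intro u v huv A B
    have hy : toPair.symm (u, v) ∈ V := by simpa [hVdef] using huv
    exact (hasFDerivAt_form_apply (hPd _ hy) A B).comp_hasDerivAt u
      (hasDerivAt_toPair_symm_left u v)
  have hgeo : ∀ u v, (u, v) ∈ U → ∀ Z,
      fderiv ℝ P (toPair.symm (u, v)) (basisVec 0) (basisVec 0) Z =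
        1 / 2 * fderiv ℝ P (toPair.symm (u, v)) Z (basisVec 0) (basisVec 0) := by
    intro u v huv Z
    have hv : v ∈ I := hx.snd_mem _ huv
    exact (hx.slice_geodesic v hv).pullForm_eq hV hX hreg (hslice v) (t := u) huv
      (c := fun r => toPair.symm (r, v)) (fun r => hasDerivAt_toPair_symm_left r v)
      (by simpa [hVdef] using huv) (Eventually.of_forall fun r => by simp [hXdef]) Z
  -- the initial values
  have hinit : ∀ v ∈ I, P (toPair.symm (0, v)) (basisVec 0) (basisVec 0) = -ε ∧
      P (toPair.symm (0, v)) (basisVec 0) (basisVec 1) = 0 ∧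
      P (toPair.symm (0, v)) (basisVec 1) (basisVec 1) = ε := by
    intro v hv
    have h0 := hx.zero_mem v hv
    have hy : toPair (toPair.symm (0, v)) ∈ U := by simpa using h0
    have hpull := pullForm_comp_toPair (g := g) hx.isOpen_domain hx.contMDiffOn hy
    have h00 := hpull (basisVec 0) (basisVec 0)
    have h01 := hpull (basisVec 0) (basisVec 1)
    have h11 := hpull (basisVec 1) (basisVec 1)
    rw [toPair_basisVec_zero] at h00 h01
    rw [toPair_basisVec_one] at h01 h11
    rw [toPair.apply_symm_apply] at h00 h01 h11
    have s0 := hx.slice_unit_speed v hv 0 h0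
    have s1 := hx.slice_orthogonal v hv
    rw [velocity_left hx.isOpen_domain hx.contMDiffOn h0] at s0 s1
    rw [velocity_right hx.isOpen_domain hx.contMDiffOn h0] at s1
    have s2 : g.val (x (0, v)) (velocity (fun r => x (0, r)) v) (velocity (fun r => x (0, r)) v)
        = ε := by
      have heq : (fun r => x (0, r)) =ᶠ[𝓝 v] γ := by
        filter_upwards [hx.isOpen_interval.mem_nhds hv] with r hr
        exact hx.slice_start r hr
      have hvel : (velocity (fun r => x (0, r)) v : Plane) = velocity γ v :=
        DFunLike.congr_fun (heq.mfderiv_eq (I := 𝓘(ℝ, ℝ)) (I' := 𝓡 2)) (1 : ℝ)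
      rw [← hx.unit_speed v hv]
      change g.form (x (0, v)) _ _ = g.form (γ v) _ _
      rw [hvel, hx.slice_start v hv]
    rw [velocity_right hx.isOpen_domain hx.contMDiffOn h0] at s2
    rw [← h00] at s0
    rw [← h01] at s1
    rw [← h11] at s2
    refine ⟨?_, s1, s2⟩
    have hd := hdet _ hy
    change P _ (basisVec 0) (basisVec 1) = 0 at s1
    change P _ (basisVec 1) (basisVec 1) = ε at s2
    change |P (toPair.symm (0, v)) (basisVec 0) (basisVec 0)| = 1 at s0
    rw [s1, s2] at hd
    have hsq := sq_abs (P (toPair.symm (0, v)) (basisVec 0) (basisVec 0))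
    rw [s0] at hsq
    set a := P (toPair.symm (0, v)) (basisVec 0) (basisVec 0)
    -- Unit speed gives only `a = ±1`. The negative determinant `a ε < 0` selects `a = -ε`, that is,
    -- slices of the opposite causal type.
    have h1 : (a * ε - 1) * (a * ε + 1) = 0 := by linear_combination -hsq * ε ^ 2 + hε
    have h2 : a * ε + 1 = 0 := (mul_eq_zero.1 h1).resolve_left (by linarith)
    linear_combination ε * h2 - a * hε
  have hE : ∀ u v, (u, v) ∈ U → P (toPair.symm (u, v)) (basisVec 0) (basisVec 0) = -ε := by
    intro u v huv
    have hv : v ∈ I := hx.snd_mem _ huv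
    rw [← (hinit v hv).1]
    refine eq_of_hasDerivAt_zero (hslice v) (hx.ordConnected_slice v hv)
      (f := fun r => P (toPair.symm (r, v)) (basisVec 0) (basisVec 0)) ?_ huv (hx.zero_mem v hv)
    intro r hr
    -- The geodesic equation tested on `∂₀` reads `∂₀g₀₀ = ½ ∂₀g₀₀`.
    refine (hline r v hr (basisVec 0) (basisVec 0)).congr_deriv ?_
    linarith [hgeo r v hr (basisVec 0)]
  have hE' : ∀ y ∈ V, P y (basisVec 0) (basisVec 0) = -ε := fun y hy => by
    have := hE (y 0) (y 1) hy
    rwa [toPair_symm_coords] at this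
  have hEd : ∀ y ∈ V, ∀ Z, fderiv ℝ P y Z (basisVec 0) (basisVec 0) = 0 := by
    intro y hy Z
    have h1 := (hasFDerivAt_form_apply (hPd y hy) (basisVec 0) (basisVec 0)).fderiv
    have h2 : (fun z => P z (basisVec 0) (basisVec 0)) =ᶠ[𝓝 y] fun _ => -ε := by
      filter_upwards [hV.mem_nhds hy] with z hz
      exact hE' z hz
    rw [h2.fderiv_eq] at h1
    simpa using (DFunLike.congr_fun h1 Z).symm
  have hF : ∀ u v, (u, v) ∈ U → P (toPair.symm (u, v)) (basisVec 0) (basisVec 1) = 0 := by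
    intro u v huv
    have hv : v ∈ I := hx.snd_mem _ huv
    rw [← (hinit v hv).2.1]
    refine eq_of_hasDerivAt_zero (hslice v) (hx.ordConnected_slice v hv)
      (f := fun r => P (toPair.symm (r, v)) (basisVec 0) (basisVec 1)) ?_ huv (hx.zero_mem v hv)
    intro r hr
    -- The Gauss lemma: tested on `∂₁`, the equation reads `∂₀g₀₁ = ½ ∂₁g₀₀`, and `g₀₀` is constant.
    refine (hline r v hr (basisVec 0) (basisVec 1)).congr_deriv ?_
    rw [hgeo r v hr (basisVec 1), hEd _ (by simpa [hVdef] using hr), mul_zero]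
  have hF' : ∀ y ∈ V, P y (basisVec 0) (basisVec 1) = 0 := fun y hy => by
    have := hF (y 0) (y 1) hy
    rwa [toPair_symm_coords] at this
  have hFd : ∀ y ∈ V, ∀ Z, fderiv ℝ P y Z (basisVec 0) (basisVec 1) = 0 := by
    intro y hy Z
    have h1 := (hasFDerivAt_form_apply (hPd y hy) (basisVec 0) (basisVec 1)).fderiv
    have h2 : (fun z => P z (basisVec 0) (basisVec 1)) =ᶠ[𝓝 y] fun _ => 0 := by
      filter_upwards [hV.mem_nhds hy] with z hz
      exact hF' z hz
    rw [h2.fderiv_eq] at h1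
    simpa using (DFunLike.congr_fun h1 Z).symm
  set G : Plane → ℝ := fun z => P z (basisVec 1) (basisVec 1) with hG
  have hGs : ContDiffOn ℝ ∞ G V :=
    (hPs.clm_apply contDiffOn_const).clm_apply contDiffOn_const
  have hGd0 : ∀ u v, (u, v) ∈ U → ∀ f : Plane → ℝ, ContDiffOn ℝ ∞ f V →
      HasDerivAt (fun r => f (toPair.symm (r, v))) (partialDeriv 0 f (toPair.symm (u, v))) u := by
    intro u v huv f hf
    have hy : toPair.symm (u, v) ∈ V := by simpa [hVdef] using huv
    exact (((hf.contDiffAt (hV.mem_nhds hy)).differentiableAt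
      (by simp)).hasFDerivAt).comp_hasDerivAt u (hasDerivAt_toPair_symm_left u v)
  have hcurv : ∀ y ∈ V, -ε * G y * K =
      -(1 / 2) * partialDeriv 0 (partialDeriv 0 G) y + partialDeriv 0 G y ^ 2 / (4 * G y) := by
    intro y hy
    have hε0 : -ε ≠ 0 := by
      rintro h
      rw [neg_eq_zero] at h
      norm_num [h] at hε
    have hGy : G y ≠ 0 := by
      intro h
      have := hdet y hy
      rw [show P y (basisVec 1) (basisVec 1) = 0 from h, hF' y hy] at this
      norm_num at this
    rw [← gaussCurvature_pullForm hg hV hX hreg hy]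
    refine gaussCurvature_orthogonal hε0 (hGs.contDiffAt (hV.mem_nhds hy)) hGy ?_
    filter_upwards [hV.mem_nhds hy] with z hz
    exact formMatrix_eq (hE' z hz) (hF' z hz) ((hsymm _ _ _).trans (hF' z hz)) rfl
  intro y hy
  set u := y 0 with hu
  set v := y 1 with hvdef
  have huv : (u, v) ∈ U := hy
  have hv : v ∈ I := hx.snd_mem _ huv
  have hyuv : toPair.symm (u, v) = y := toPair_symm_coords y
  refine ⟨hE' y hy, hF' y hy, ?_⟩
  have hfin := eq_of_curvature_equation (hslice v) (hx.ordConnected_slice v hv)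
    (hx.zero_mem v hv) (G := fun r => G (toPair.symm (r, v)))
    (G' := fun r => partialDeriv 0 G (toPair.symm (r, v)))
    (G'' := fun r => partialDeriv 0 (partialDeriv 0 G) (toPair.symm (r, v)))
    (ε := ε) (K := K) hε (fun r hr => hGd0 r v hr G hGs)
    (fun r hr => hGd0 r v hr _ (contDiffOn_partialDeriv hV hGs 0)) ?_
    (fun r hr => hcurv _ (by simpa [hVdef] using hr)) (hinit v hv).2.2 ?_ hS hT hST hS0 hT0 huv
  · rw [← hyuv]
    exact hfin
  · intro r hr
    have h1 := hdet (toPair.symm (r, v)) (by simpa [hVdef] using hr)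
    rw [hE r v hr, hF r v hr] at h1
    simp only [hG]
    nlinarith
  · have h0 := hx.zero_mem v hv
    have hy0 : toPair.symm (0, v) ∈ V := by simpa [hVdef] using h0
    -- The base geodesic is the affine curve `u = 0`. Its equation tested on `∂₀` gives `½ ∂₀g₁₁ =
    -- ∂₁g₁₀ = 0`, the initial condition for the derivative of `G`.
    have h1 := hx.geodesic.pullForm_eq hV hX hreg hx.isOpen_interval hv
      (c := fun r => toPair.symm (0, r)) (fun r => hasDerivAt_toPair_symm_right 0 r) hy0 ?_
      (basisVec 0)
    · have h2 := hFd _ hy0 (basisVec 1)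
      have h3 := (hasFDerivAt_form_apply (hPd _ hy0) (basisVec 1) (basisVec 1)).fderiv
      have hsw : fderiv ℝ P (toPair.symm (0, v)) (basisVec 1) (basisVec 1) (basisVec 0) =
          fderiv ℝ P (toPair.symm (0, v)) (basisVec 1) (basisVec 0) (basisVec 1) := by
        have h5 := hasFDerivAt_form_apply (hPd _ hy0) (basisVec 1) (basisVec 0)
        have h6 := hasFDerivAt_form_apply (hPd _ hy0) (basisVec 0) (basisVec 1)
        have h7 : (fun z => P z (basisVec 1) (basisVec 0)) = fun z => P z (basisVec 0) (basisVec 1) :=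
          funext fun z => hsymm _ _ _
        rw [h7] at h5
        exact DFunLike.congr_fun (h5.unique h6) (basisVec 1)
      rw [← hP] at h1
      rw [hsw, h2] at h1
      simp only [partialDeriv, hG]
      rw [h3]
      simp only [ContinuousLinearMap.flip_apply]
      linarith
    · filter_upwards [hx.isOpen_interval.mem_nhds hv] with r hr
      simp only [hXdef, toPair.apply_symm_apply]
      exact (hx.slice_start r hr).symm

end FermiUniqueness

end LorentzSurface

namespace LorentzSurface

/-! ### Existence of Fermi-type coordinates -/

section FermiExistence

set_option synthInstance.maxHeartbeats 200000

variable {M : Type*} [TopologicalSpace M] [ChartedSpace Plane M] [IsManifold (𝓡 2) ∞ M]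

/-- The geodesic spray of a metric with coefficients `h`. -/
noncomputable def geodesicSpray (h : Plane → Matrix (Fin 2) (Fin 2) ℝ) (z : Plane × Plane) :
    Plane × Plane :=
  (z.2, toPair.symm (-∑ i : Fin 2, ∑ j : Fin 2, christoffel h 0 i j z.1 * z.2 i * z.2 j,
    -∑ i : Fin 2, ∑ j : Fin 2, christoffel h 1 i j z.1 * z.2 i * z.2 j))

lemma contDiffOn_geodesicSpray {h : Plane → Matrix (Fin 2) (Fin 2) ℝ} {V : Set Plane}
    (hV : IsOpen V) (hh : ∀ i j, ContDiffOn ℝ ∞ (fun z => h z i j) V)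
    (hdet : ∀ z ∈ V, (h z).det ≠ 0) :
    ContDiffOn ℝ ∞ (geodesicSpray h) (V ×ˢ (univ : Set Plane)) := by
  have hc : ∀ i : Fin 2, ContDiffOn ℝ ∞ (fun z : Plane × Plane => z.2 i) (V ×ˢ univ) := fun i =>
    ((EuclideanSpace.proj i : Plane →L[ℝ] ℝ).contDiff.comp contDiff_snd).contDiffOn
  have hΓ : ∀ k, ContDiffOn ℝ ∞ (fun z : Plane × Plane => -∑ i : Fin 2, ∑ j : Fin 2,
      christoffel h k i j z.1 * z.2 i * z.2 j) (V ×ˢ univ) := fun k =>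
    ContDiffOn.neg <| ContDiffOn.sum fun i _ => ContDiffOn.sum fun j _ =>
      (((contDiffOn_christoffel hV hh hdet k i j).comp contDiffOn_fst fun z hz => hz.1).mul
        (hc i)).mul (hc j)
  exact contDiffOn_snd.prodMk (toPair.symm.contDiff.comp_contDiffOn ((hΓ 0).prodMk (hΓ 1)))

/-- The geodesics in a chart, as a smooth function of the initial values and of the parameter. -/
theorem exists_geodesic_flow (g : LorentzMetric M) {e : OpenPartialHomeomorph M Plane}
    (he : e ∈ IsManifold.maximalAtlas (𝓡 2) ∞ M) {y₀ : Plane} (hy₀ : y₀ ∈ e.target) (v₀ : Plane) :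
    ∃ a > (0 : ℝ), ∃ W : Set (Plane × Plane), IsOpen W ∧ (y₀, v₀) ∈ W ∧
      ∃ ψ : (Plane × Plane) × ℝ → Plane, ContDiffOn ℝ ∞ ψ (W ×ˢ Ioo (-a) a) ∧
      ∀ z ∈ W, ψ (z, 0) = z.1 ∧ HasDerivAt (fun s => ψ (z, s)) z.2 0 ∧
        ∀ s ∈ Ioo (-a) a, ψ (z, s) ∈ e.target ∧
          GeodesicEq (pullForm g e.symm) (fun s => ψ (z, s)) s := by
  set h : Plane → Matrix (Fin 2) (Fin 2) ℝ := fun z => formMatrix (pullForm g e.symm z) with hh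
  have hs : ∀ i j, ContDiffOn ℝ ∞ (fun z => h z i j) e.target := fun i j =>
    ((contDiffOn_chartForm g he).clm_apply contDiffOn_const).clm_apply contDiffOn_const
  have hdet : ∀ z ∈ e.target, (h z).det ≠ 0 := fun z hz => (det_chartForm_neg g he hz).ne
  -- Geodesics are the base curves of the flow of the spray on position-velocity pairs.
  obtain ⟨a, ha, W, hW, hzW, φ, hφ, hφ0, hφd⟩ :=
    (contDiffOn_geodesicSpray e.open_target hs hdet).exists_local_flow
      (e.open_target.prod isOpen_univ) (z₀ := (y₀, v₀)) ⟨hy₀, mem_univ _⟩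
  refine ⟨a, ha, W, hW, hzW, fun q => (φ q).1, contDiff_fst.comp_contDiffOn hφ, fun z hz => ?_⟩
  have h1 : ∀ s ∈ Ioo (-a) a, HasDerivAt (fun s => (φ (z, s)).1) (φ (z, s)).2 s := fun s hs =>
    ((ContinuousLinearMap.fst ℝ Plane Plane).hasFDerivAt.comp_hasDerivAt s (hφd z hz s hs).2)
  have h2 : ∀ s ∈ Ioo (-a) a, HasDerivAt (fun s => (φ (z, s)).2)
      (geodesicSpray h (φ (z, s))).2 s := fun s hs =>
    ((ContinuousLinearMap.snd ℝ Plane Plane).hasFDerivAt.comp_hasDerivAt s (hφd z hz s hs).2)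
  have h0 : (0 : ℝ) ∈ Ioo (-a) a := ⟨by linarith, ha⟩
  refine ⟨by simp only [hφ0 z hz], ?_, fun s hs => ⟨(hφd z hz s hs).1.1, ?_⟩⟩
  · have := h1 0 h0
    rwa [hφ0 z hz] at this
  · have hd : deriv (fun s => (φ (z, s)).1) =ᶠ[𝓝 s] fun s => (φ (z, s)).2 := by
      filter_upwards [Ioo_mem_nhds hs.1 hs.2] with r hr
      exact (h1 r hr).deriv
    have hmem : (φ (z, s)).1 ∈ e.target := (hφd z hz s hs).1.1
    rw [geodesicEq_iff_christoffel (c := fun s => (φ (z, s)).1)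
      (differentiableAt_chartForm g he hmem) (pullForm_symm g e.symm _)
      (det_chartForm_neg g he hmem).ne, hd.deriv_eq, (h2 s hs).deriv, hd.eq_of_nhds]
    intro k
    fin_cases k
    · exact neg_add_cancel _
    · exact neg_add_cancel _

omit [IsManifold (𝓡 2) ∞ M] in
lemma velocity_chart_symm {e : OpenPartialHomeomorph M Plane}
    (he : e ∈ IsManifold.maximalAtlas (𝓡 2) ∞ M) {c : ℝ → Plane} {t : ℝ} {w : Plane}
    (hc : HasDerivAt c w t) (ht : c t ∈ e.target) :
    (velocity (fun r => e.symm (c r)) t : Plane) = planeDeriv e.symm (c t) w := by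
  have h1 : MDifferentiableAt 𝓘(ℝ, Plane) (𝓡 2) e.symm (c t) :=
    (contMDiffAt_symm_of_mem_maximalAtlas he ht).mdifferentiableAt (by simp)
  have h3 : mfderiv 𝓘(ℝ, ℝ) (𝓡 2) (e.symm ∘ c) t =
      (mfderiv 𝓘(ℝ, Plane) (𝓡 2) e.symm (c t)).comp (mfderiv 𝓘(ℝ, ℝ) 𝓘(ℝ, Plane) c t) :=
    mfderiv_comp t h1 hc.differentiableAt.mdifferentiableAt
  rw [mfderiv_eq_fderiv, hc.hasFDerivAt.fderiv] at h3
  change mfderiv 𝓘(ℝ, ℝ) (𝓡 2) (e.symm ∘ c) t (1 : ℝ) = _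
  rw [h3]
  change mfderiv 𝓘(ℝ, Plane) (𝓡 2) e.symm (c t) ((1 : ℝ) • w : Plane) = _
  rw [one_smul]
  rfl

lemma isGeodesicOn_chart_symm {g : LorentzMetric M} {e : OpenPartialHomeomorph M Plane}
    (he : e ∈ IsManifold.maximalAtlas (𝓡 2) ∞ M) {c : ℝ → Plane} {J : Set ℝ} (hJ : IsOpen J)
    (hc : ContDiffOn ℝ ∞ c J) (hmem : ∀ t ∈ J, c t ∈ e.target)
    (hg : ∀ t ∈ J, GeodesicEq (pullForm g e.symm) c t) :
    IsGeodesicOn g (fun r => e.symm (c r)) J := by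
  refine isGeodesicOn_of_geodesicEq hJ
    ((contMDiffOn_symm_of_mem_maximalAtlas he).comp (contMDiffOn_iff_contDiffOn.2 hc) hmem)
    fun t ht => ⟨e, he, e.map_target (hmem t ht), (hg t ht).congr ?_⟩
  filter_upwards [hJ.mem_nhds ht] with r hr
  exact e.right_inv (hmem r hr)

/-- The speed of a solution of the geodesic equation on an interval is constant. -/
lemma speed_eq_of_geodesicEq {g : LorentzMetric M} {e : OpenPartialHomeomorph M Plane}
    (he : e ∈ IsManifold.maximalAtlas (𝓡 2) ∞ M) {c : ℝ → Plane} {a : ℝ}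
    (hc : ContDiffOn ℝ ∞ c (Ioo (-a) a)) (hmem : ∀ t ∈ Ioo (-a) a, c t ∈ e.target)
    (hg : ∀ t ∈ Ioo (-a) a, GeodesicEq (pullForm g e.symm) c t) {t : ℝ} (ht : t ∈ Ioo (-a) a) :
    pullForm g e.symm (c t) (deriv c t) (deriv c t) =
      pullForm g e.symm (c 0) (deriv c 0) (deriv c 0) := by
  have h0 : (0 : ℝ) ∈ Ioo (-a) a := ⟨by linarith [ht.1.trans ht.2], by linarith [ht.1.trans ht.2]⟩
  exact eq_of_hasDerivAt_zero isOpen_Ioo ordConnected_Ioo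
    (f := fun t => pullForm g e.symm (c t) (deriv c t) (deriv c t))
    (fun s hs => (hg s hs).hasDerivAt_speed (differentiableAt_chartForm g he (hmem s hs))
      ((hc.contDiffAt (isOpen_Ioo.mem_nhds hs)).of_le two_le_infty) (pullForm_symm g e.symm _))
    ht h0

/-- The vector orthogonal to `w` with `⟨N, N⟩ = -⟨w, w⟩`. -/
noncomputable def normalVec (B : Plane →L[ℝ] Plane →L[ℝ] ℝ) (w : Plane) : Plane :=
  (√(-(formMatrix B).det))⁻¹ • toPair.symm (-B (basisVec 1) w, B (basisVec 0) w)

/-- The vector `n = (-B(e₁, w), B(e₀, w))` annihilates `w`, and `B(n, n) = det B · B(w, w)`.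
Division by `√(-det B)` normalises it. Being explicit, the normal depends smoothly on `B` and `w`.
-/
lemma form_normalVec {B : Plane →L[ℝ] Plane →L[ℝ] ℝ} (hsymm : ∀ X Y, B X Y = B Y X)
    (hdet : (formMatrix B).det < 0) (w : Plane) :
    B (normalVec B w) w = 0 ∧ B (normalVec B w) (normalVec B w) = -B w w := by
  have hw0 : B (basisVec 0) w = w 0 * B (basisVec 0) (basisVec 0) +
      w 1 * B (basisVec 0) (basisVec 1) := linear_plane_apply (B (basisVec 0)) w
  have hw1 : B (basisVec 1) w = w 0 * B (basisVec 0) (basisVec 1) +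
      w 1 * B (basisVec 1) (basisVec 1) := by
    rw [hsymm (basisVec 0) (basisVec 1)]
    exact linear_plane_apply (B (basisVec 1)) w
  have hpos : 0 < -(formMatrix B).det := by linarith
  have hsq : (√(-(formMatrix B).det)) ^ 2 = -(formMatrix B).det := Real.sq_sqrt hpos.le
  have hne : √(-(formMatrix B).det) ≠ 0 := (Real.sqrt_pos.2 hpos).ne'
  set s := √(-(formMatrix B).det) with hs
  simp only [Matrix.det_fin_two, formMatrix_apply] at hsq
  rw [hsymm (basisVec 1) (basisVec 0)] at hsq
  set n : Plane := toPair.symm (-B (basisVec 1) w, B (basisVec 0) w) with hn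
  have hn0 : n 0 = -B (basisVec 1) w := rfl
  have hn1 : n 1 = B (basisVec 0) w := rfl
  have hN : normalVec B w = s⁻¹ • n := rfl
  have h1 : B n w = 0 := by
    rw [linear_plane_apply B n]
    simp only [add_apply, smul_apply, smul_eq_mul, hn0, hn1]
    ring
  have h2 : B n n = -s ^ 2 * B w w := by
    rw [form_apply B n n, form_apply B w w, hn0, hn1, hw0, hw1, hsq,
      hsymm (basisVec 1) (basisVec 0)]
    ring
  rw [hN]
  simp only [map_smul, smul_apply, smul_eq_mul, h1, h2, mul_zero, true_and]
  field_simp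

lemma contDiffOn_normalVec {B : Plane → Plane →L[ℝ] Plane →L[ℝ] ℝ} {V : Set Plane}
    (hB : ContDiffOn ℝ ∞ B V) (hdet : ∀ y ∈ V, (formMatrix (B y)).det < 0) {c w : ℝ → Plane}
    {J : Set ℝ} (hc : ContDiffOn ℝ ∞ c J) (hw : ContDiffOn ℝ ∞ w J) (hcV : ∀ t ∈ J, c t ∈ V) :
    ContDiffOn ℝ ∞ (fun t => normalVec (B (c t)) (w t)) J := by
  have hBc : ContDiffOn ℝ ∞ (fun t => B (c t)) J := hB.comp hc hcV
  have hij : ∀ i j, ContDiffOn ℝ ∞ (fun t => formMatrix (B (c t)) i j) J := fun i j =>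
    (hBc.clm_apply contDiffOn_const).clm_apply contDiffOn_const
  have hd : ContDiffOn ℝ ∞ (fun t => -(formMatrix (B (c t))).det) J := by
    simp only [Matrix.det_fin_two]
    exact (((hij 0 0).mul (hij 1 1)).sub ((hij 0 1).mul (hij 1 0))).neg
  have hpos : ∀ t ∈ J, 0 < -(formMatrix (B (c t))).det := fun t ht => by
    linarith [hdet _ (hcV t ht)]
  refine ContDiffOn.smul ((hd.sqrt fun t ht => (hpos t ht).ne').inv
    fun t ht => (Real.sqrt_pos.2 (hpos t ht)).ne') ?_
  exact toPair.symm.contDiff.comp_contDiffOn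
    ((((hBc.clm_apply contDiffOn_const).clm_apply hw).neg).prodMk
      ((hBc.clm_apply contDiffOn_const).clm_apply hw))

/-- A map with an invertible derivative is injective and regular on a small square. -/
lemma exists_square {F : Plane → Plane} {D : Set Plane} (hD : IsOpen D)
    (hF : ContDiffOn ℝ ∞ F D) (h0 : (0 : Plane) ∈ D)
    (hinj : Function.Injective (fderiv ℝ F 0)) :
    ∃ r > (0 : ℝ), ∀ q ∈ Ioo (-r) r ×ˢ Ioo (-r) r, toPair.symm q ∈ D ∧
      Function.Injective (fderiv ℝ F (toPair.symm q)) ∧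
      ∀ q' ∈ Ioo (-r) r ×ˢ Ioo (-r) r, F (toPair.symm q) = F (toPair.symm q') → q = q' := by
  have hF0 := hF.contDiffAt (hD.mem_nhds h0)
  set A : Plane ≃L[ℝ] Plane := (LinearEquiv.ofInjectiveEndo (fderiv ℝ F 0).toLinearMap
    hinj).toContinuousLinearEquiv with hA
  have hA' : (A : Plane →L[ℝ] Plane) = fderiv ℝ F 0 := by
    ext z
    rfl
  have hd : HasFDerivAt F (A : Plane →L[ℝ] Plane) 0 := by
    rw [hA']
    exact (hF0.differentiableAt (by simp)).hasFDerivAt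
  set P := hF0.toOpenPartialHomeomorph F hd (by simp) with hP
  have hPs : P.source ∈ 𝓝 (0 : Plane) :=
    P.open_source.mem_nhds (hF0.mem_toOpenPartialHomeomorph_source hd (by simp))
  -- Invertible operators form an open set, so regularity at `0` persists nearby.
  have hreg : ∀ᶠ y in 𝓝 (0 : Plane), Function.Injective (fderiv ℝ F y) := by
    have hcont : ContinuousAt (fderiv ℝ F) 0 :=
      (hF0.fderiv_right (m := ∞) le_rfl).continuousAt
    have hA₀ : range ((↑) : (Plane ≃L[ℝ] Plane) → Plane →L[ℝ] Plane) ∈ 𝓝 (fderiv ℝ F 0) := by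
      rw [← hA']
      exact ContinuousLinearEquiv.nhds A
    filter_upwards [hcont.preimage_mem_nhds hA₀] with y hy
    obtain ⟨A', hA'⟩ := hy
    rw [← hA']
    exact A'.injective
  have hev : ∀ᶠ q in 𝓝 ((0 : ℝ), (0 : ℝ)), toPair.symm q ∈ D ∧
      Function.Injective (fderiv ℝ F (toPair.symm q)) ∧ toPair.symm q ∈ P.source := by
    have hcont : Tendsto (toPair.symm : ℝ × ℝ → Plane) (𝓝 ((0 : ℝ), (0 : ℝ))) (𝓝 0) := by
      have := toPair.symm.continuous.tendsto ((0 : ℝ), (0 : ℝ))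
      rwa [show ((0 : ℝ), (0 : ℝ)) = 0 from rfl, map_zero] at this
    exact hcont.eventually ((hD.eventually_mem h0).and (hreg.and hPs))
  obtain ⟨r, hr, hsub⟩ := Metric.eventually_nhds_iff_ball.1 hev
  have hbox : ∀ q ∈ Ioo (-r) r ×ˢ Ioo (-r) r, q ∈ Metric.ball ((0 : ℝ), (0 : ℝ)) r := by
    intro q hq
    rw [← ball_prod_same, Real.ball_eq_Ioo, zero_sub, zero_add]
    exact hq
  refine ⟨r, hr, fun q hq => ?_⟩
  obtain ⟨h1, h2, h3⟩ := hsub q (hbox q hq)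
  refine ⟨h1, h2, fun q' hq' hqq' => ?_⟩
  exact toPair.symm.injective (P.injOn h3 (hsub q' (hbox q' hq')).2.2 hqq')

set_option maxHeartbeats 1000000 in
/-- Through every point, with every unit velocity, there is a geodesic along which there are
injective Fermi-type coordinates. -/
theorem exists_isFermi (g : LorentzMetric M) {ε : ℝ} (hε : ε ^ 2 = 1) (p : M)
    (w : TangentSpace (𝓡 2) p) (hw : g.val p w w = ε) :
    ∃ (I : Set ℝ) (γ : ℝ → M) (U : Set (ℝ × ℝ)) (x : ℝ × ℝ → M),
      IsFermi g ε I γ U x ∧ InjOn x U ∧ 0 ∈ I ∧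
      (⟨γ 0, velocity γ 0⟩ : TangentBundle (𝓡 2) M) = ⟨p, w⟩ := by
  set e := chartAt Plane p with he'
  have he : e ∈ IsManifold.maximalAtlas (𝓡 2) ∞ M := IsManifold.chart_mem_maximalAtlas _
  have hps : p ∈ e.source := mem_chart_source _ _
  have hy₀ : e p ∈ e.target := e.map_source hps
  set B := pullForm g e.symm with hB
  have hBs : ContDiffOn ℝ ∞ B e.target := contDiffOn_chartForm g he
  set w₀ : Plane := mfderiv (𝓡 2) (𝓡 2) e p w with hw₀
  have heD : e.MDifferentiable (𝓡 2) (𝓡 2) :=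
    ⟨(contMDiffOn_of_mem_maximalAtlas he).mdifferentiableOn (by simp),
      (contMDiffOn_symm_of_mem_maximalAtlas he).mdifferentiableOn (by simp)⟩
  have hback : planeDeriv e.symm (e p) w₀ = w := DFunLike.congr_fun (heD.symm_comp_deriv hps) w
  have hBw : B (e p) w₀ w₀ = ε := by
    rw [← hw]
    change g.form (e.symm (e p)) (planeDeriv e.symm (e p) w₀) (planeDeriv e.symm (e p) w₀) = _
    rw [hback, e.left_inv hps]
    rfl
  -- the base geodesic
  obtain ⟨a₁, ha₁, W₁, hW₁, hzW₁, ψ₁, hψ₁, hψ₁z⟩ := exists_geodesic_flow g he hy₀ w₀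
  obtain ⟨hc0, hc0', hcg⟩ := hψ₁z _ hzW₁
  set c : ℝ → Plane := fun s => ψ₁ ((e p, w₀), s) with hc
  have hcs : ContDiffOn ℝ ∞ c (Ioo (-a₁) a₁) :=
    hψ₁.comp (contDiff_const.prodMk contDiff_id).contDiffOn fun s hs => ⟨hzW₁, hs⟩
  have hc0 : c 0 = e p := hc0
  have hcd : ∀ s ∈ Ioo (-a₁) a₁, HasDerivAt c (deriv c s) s := fun s hs =>
    ((hcs.contDiffAt (isOpen_Ioo.mem_nhds hs)).differentiableAt (by simp)).hasDerivAt
  have hc's : ContDiffOn ℝ ∞ (deriv c) (Ioo (-a₁) a₁) :=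
    hcs.deriv_of_isOpen isOpen_Ioo le_rfl
  have hspeed : ∀ s ∈ Ioo (-a₁) a₁, B (c s) (deriv c s) (deriv c s) = ε := by
    intro s hs
    rw [speed_eq_of_geodesicEq he hcs (fun t ht => (hcg t ht).1) (fun t ht => (hcg t ht).2) hs,
      hc0'.deriv, hc0]
    exact hBw
  -- the unit normal
  set N : ℝ → Plane := fun s => normalVec (B (c s)) (deriv c s) with hN
  have hNs : ContDiffOn ℝ ∞ N (Ioo (-a₁) a₁) :=
    contDiffOn_normalVec hBs (fun y hy => det_chartForm_neg g he hy) hcs hc's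
      fun s hs => (hcg s hs).1
  have hNB : ∀ s ∈ Ioo (-a₁) a₁, B (c s) (N s) (deriv c s) = 0 ∧ B (c s) (N s) (N s) = -ε := by
    intro s hs
    have := form_normalVec (pullForm_symm g e.symm (c s)) (det_chartForm_neg g he (hcg s hs).1)
      (deriv c s)
    rwa [hspeed s hs] at this
  -- the orthogonal geodesics
  obtain ⟨a₂, ha₂, W₂, hW₂, hzW₂, ψ₂, hψ₂, hψ₂z⟩ := exists_geodesic_flow g he hy₀ (N 0)
  -- In chart coordinates, `F(u, v)` is the point at time `u` on the geodesic leaving `c v` with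
  -- velocity `N v`; `J` collects the `v` whose initial data lie in the domain of the flow.
  set F : Plane → Plane := fun y => ψ₂ ((c (y 1), N (y 1)), y 0) with hF
  set J : Set ℝ := Ioo (-a₁) a₁ ∩ (fun s => (c s, N s)) ⁻¹' W₂ with hJ
  have hJo : IsOpen J :=
    (hcs.continuousOn.prodMk hNs.continuousOn).isOpen_inter_preimage isOpen_Ioo hW₂
  have h0a₁ : (0 : ℝ) ∈ Ioo (-a₁) a₁ := ⟨by linarith, ha₁⟩
  have h0a₂ : (0 : ℝ) ∈ Ioo (-a₂) a₂ := ⟨by linarith, ha₂⟩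
  have h0J : (0 : ℝ) ∈ J := ⟨h0a₁, by simpa only [mem_preimage, hc0] using hzW₂⟩
  set D : Set Plane := {y | y 0 ∈ Ioo (-a₂) a₂ ∧ y 1 ∈ J} with hD
  have hproj : ∀ i : Fin 2, ContDiff ℝ ∞ fun y : Plane => y i := fun i =>
    (EuclideanSpace.proj i : Plane →L[ℝ] ℝ).contDiff
  have hDo : IsOpen D :=
    (isOpen_Ioo.preimage (hproj 0).continuous).inter (hJo.preimage (hproj 1).continuous)
  have hFs : ContDiffOn ℝ ∞ F D := by
    have h1 : ContDiffOn ℝ ∞ (fun y : Plane => c (y 1)) D :=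
      hcs.comp (hproj 1).contDiffOn fun y hy => hy.2.1
    have h2 : ContDiffOn ℝ ∞ (fun y : Plane => N (y 1)) D :=
      hNs.comp (hproj 1).contDiffOn fun y hy => hy.2.1
    exact hψ₂.comp ((h1.prodMk h2).prodMk (hproj 0).contDiffOn) fun y hy => ⟨hy.2.2, hy.1⟩
  have h0D : (0 : Plane) ∈ D := ⟨h0a₂, h0J⟩
  have hFd : ∀ y ∈ D, DifferentiableAt ℝ F y := fun y hy =>
    (hFs.contDiffAt (hDo.mem_nhds hy)).differentiableAt (by simp)
  have hFmem : ∀ y ∈ D, F y ∈ e.target := fun y hy => ((hψ₂z _ hy.2.2).2.2 _ hy.1).1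
  have hFc : ∀ v ∈ J, F (toPair.symm (0, v)) = c v := fun v hv => (hψ₂z _ hv.2).1
  have hF0 : ∀ v ∈ J, HasDerivAt (fun r => F (toPair.symm (r, v))) (N v) 0 := fun v hv =>
    (hψ₂z _ hv.2).2.1
  have hF1 : ∀ v ∈ J, HasDerivAt (fun r => F (toPair.symm (0, r))) (deriv c v) v := by
    intro v hv
    refine (hcd v hv.1).congr_of_eventuallyEq ?_
    filter_upwards [hJo.mem_nhds hv] with r hr
    exact hFc r hr
  have hzero : toPair.symm ((0 : ℝ), (0 : ℝ)) = 0 := map_zero toPair.symm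
  have hinj : Function.Injective (fderiv ℝ F 0) := by
    have hF' : HasFDerivAt F (fderiv ℝ F 0) (toPair.symm ((0 : ℝ), (0 : ℝ))) := by
      rw [hzero]
      exact (hFd 0 h0D).hasFDerivAt
    have d0 : HasDerivAt (fun r => F (toPair.symm (r, (0 : ℝ)))) (fderiv ℝ F 0 (basisVec 0)) 0 :=
      HasFDerivAt.comp_hasDerivAt (f := fun r : ℝ => toPair.symm (r, (0 : ℝ))) (l := F) (0 : ℝ)
        hF' (hasDerivAt_toPair_symm_left 0 0)
    have d1 : HasDerivAt (fun r => F (toPair.symm ((0 : ℝ), r))) (fderiv ℝ F 0 (basisVec 1)) 0 :=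
      HasFDerivAt.comp_hasDerivAt (f := fun r : ℝ => toPair.symm ((0 : ℝ), r)) (l := F) (0 : ℝ)
        hF' (hasDerivAt_toPair_symm_right 0 0)
    -- The differential at `0` sends the basis to `N 0` and `c' 0`. These are orthogonal with
    -- squares `-ε` and `ε`, hence independent.
    have e0 := d0.unique (hF0 0 h0J)
    have e1 := d1.unique (hF1 0 h0J)
    rw [injective_iff_map_eq_zero]
    intro X hX
    rw [linear_plane_apply (fderiv ℝ F 0) X, e0, e1] at hX
    obtain ⟨n1, n2⟩ := hNB 0 h0a₁
    have n3 := hspeed 0 h0a₁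
    have n1' : B (c 0) (deriv c 0) (N 0) = 0 := (pullForm_symm g e.symm _ _ _).trans n1
    have k1 := congrArg (fun Y => B (c 0) Y (N 0)) hX
    have k2 := congrArg (fun Y => B (c 0) Y (deriv c 0)) hX
    simp only [map_add, map_smul, add_apply, smul_apply, smul_eq_mul, n1, n2, n3, n1', map_zero,
      zero_apply, mul_zero, add_zero, zero_add] at k1 k2
    rw [plane_eq_sum X, show X 0 = 0 by linear_combination -ε * k1 - X 0 * hε,
      show X 1 = 0 by linear_combination ε * k2 - X 1 * hε, zero_smul, zero_smul, add_zero]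
  obtain ⟨r, hr, hsq⟩ := exists_square hDo hFs h0D hinj
  have h0r : (0 : ℝ) ∈ Ioo (-r) r := ⟨by linarith, hr⟩
  have hIJ : ∀ v ∈ Ioo (-r) r, v ∈ J := fun v hv => (hsq (0, v) ⟨h0r, hv⟩).1.2
  have hUD : ∀ q ∈ Ioo (-r) r ×ˢ Ioo (-r) r, toPair.symm q ∈ D := fun q hq => (hsq q hq).1
  have hsliceeq : ∀ v ∈ Ioo (-r) r, {u : ℝ | (u, v) ∈ Ioo (-r) r ×ˢ Ioo (-r) r} = Ioo (-r) r := by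
    intro v hv
    ext u
    exact ⟨fun h => h.1, fun h => ⟨h, hv⟩⟩
  set x : ℝ × ℝ → M := fun q => e.symm (F (toPair.symm q)) with hx
  set γ : ℝ → M := fun v => e.symm (c v) with hγ
  have hxγ : ∀ v ∈ Ioo (-r) r, x (0, v) = γ v := fun v hv => by
    simp only [hx, hγ, hFc v (hIJ v hv)]
  have hcurve : ∀ v ∈ Ioo (-r) r, ContDiffOn ℝ ∞ (fun u => F (toPair.symm (u, v))) (Ioo (-a₂) a₂) ∧
      ∀ u ∈ Ioo (-a₂) a₂, F (toPair.symm (u, v)) ∈ e.target ∧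
        GeodesicEq B (fun u => F (toPair.symm (u, v))) u := by
    intro v hv
    have h1 : ContDiffOn ℝ ∞ (fun u : ℝ => ψ₂ ((c v, N v), u)) (Ioo (-a₂) a₂) :=
      hψ₂.comp (contDiff_const.prodMk contDiff_id).contDiffOn fun s hs => ⟨(hIJ v hv).2, hs⟩
    exact ⟨h1, fun u hu => (hψ₂z _ (hIJ v hv).2).2.2 u hu⟩
  have hrsub : Ioo (-r) r ⊆ Ioo (-a₂) a₂ := fun u hu => (hUD (u, 0) ⟨hu, h0r⟩).1
  have hxs : ContMDiffOn 𝓘(ℝ, ℝ × ℝ) (𝓡 2) ∞ x (Ioo (-r) r ×ˢ Ioo (-r) r) :=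
    (contMDiffOn_symm_of_mem_maximalAtlas he).comp (contMDiffOn_iff_contDiffOn.2
      (hFs.comp toPair.symm.contDiff.contDiffOn hUD)) fun q hq => hFmem _ (hUD q hq)
  have hform : ∀ (c₁ c₂ : ℝ → Plane) (t₁ t₂ : ℝ) (w₁ w₂ : Plane), HasDerivAt c₁ w₁ t₁ →
      HasDerivAt c₂ w₂ t₂ → c₁ t₁ ∈ e.target → c₂ t₂ = c₁ t₁ →
      g.form (e.symm (c₁ t₁)) (velocity (fun r => e.symm (c₁ r)) t₁)
        (velocity (fun r => e.symm (c₂ r)) t₂) = B (c₁ t₁) w₁ w₂ := by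
    intro c₁ c₂ t₁ t₂ w₁ w₂ h₁ h₂ hm h12
    have e1 := velocity_chart_symm he h₁ hm
    have e2 := velocity_chart_symm he h₂ (h12 ▸ hm)
    rw [h12] at e2
    exact congrArg₂ (fun X Y : Plane => g.form (e.symm (c₁ t₁)) X Y) e1 e2
  refine ⟨Ioo (-r) r, γ, Ioo (-r) r ×ˢ Ioo (-r) r, x, ?_, ?_, h0r, ?_⟩
  · refine ⟨isOpen_Ioo, ordConnected_Ioo, ?_, ?_, isOpen_Ioo.prod isOpen_Ioo,
      fun v hv => ⟨h0r, hv⟩, fun q hq => hq.2, fun v hv => ?_, hxs, fun v hv => ?_,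
      fun v hv u huv => ?_, hxγ, fun v hv => ?_, fun q hq => ?_⟩
    · exact isGeodesicOn_chart_symm he isOpen_Ioo (hcs.mono fun v hv => (hIJ v hv).1)
        (fun v hv => (hcg v (hIJ v hv).1).1) (fun v hv => (hcg v (hIJ v hv).1).2)
    · intro v hv
      have hv' := (hIJ v hv).1
      exact (hform c c v v _ _ (hcd v hv') (hcd v hv') (hcg v hv').1 rfl).trans (hspeed v hv')
    · rw [hsliceeq v hv]
      exact ordConnected_Ioo
    · rw [hsliceeq v hv]
      exact isGeodesicOn_chart_symm he isOpen_Ioo ((hcurve v hv).1.mono hrsub)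
        (fun u hu => ((hcurve v hv).2 u (hrsub hu)).1)
        (fun u hu => ((hcurve v hv).2 u (hrsub hu)).2)
    · have hu := hrsub huv.1
      obtain ⟨k1, k2⟩ := hcurve v hv
      have k3 : HasDerivAt (fun u => F (toPair.symm (u, v)))
          (deriv (fun u => F (toPair.symm (u, v))) u) u :=
        ((k1.contDiffAt (isOpen_Ioo.mem_nhds hu)).differentiableAt (by simp)).hasDerivAt
      have k4 := hform _ _ u u _ _ k3 k3 (k2 u hu).1 rfl
      -- Constancy of speed carries the value `-ε` at `u = 0` along the whole slice.
      have k5 := speed_eq_of_geodesicEq he k1 (fun t ht => (k2 t ht).1) (fun t ht => (k2 t ht).2) hu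
      have k6 := (hNB v (hIJ v hv).1).2
      rw [(hF0 v (hIJ v hv)).deriv, hFc v (hIJ v hv)] at k5
      change |g.form (e.symm (F (toPair.symm (u, v)))) _ _| = 1
      rw [k4, hB, k5, ← hB, k6, abs_neg, ← sq_eq_sq₀ (abs_nonneg _) zero_le_one, sq_abs, hε,
        one_pow]
    · have hv' := hIJ v hv
      have k1 := hform _ _ 0 v _ _ (hF0 v hv') (hF1 v hv')
        (by rw [hFc v hv']; exact (hcg v hv'.1).1) rfl
      rw [hFc v hv'] at k1
      have k2 := k1.trans (hNB v hv'.1).1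
      change g.form (x (0, v)) _ _ = 0
      rw [hxγ v hv]
      exact k2
    · have hy := hUD q hq
      have hm := hFmem _ hy
      have hd : HasFDerivAt (fun q => F (toPair.symm q))
          (fderiv ℝ F (toPair.symm q) ∘L (toPair.symm : ℝ × ℝ →L[ℝ] Plane)) q :=
        (hFd _ hy).hasFDerivAt.comp q toPair.symm.hasFDerivAt
      have h1 : MDifferentiableAt 𝓘(ℝ, Plane) (𝓡 2) e.symm (F (toPair.symm q)) :=
        (contMDiffAt_symm_of_mem_maximalAtlas he hm).mdifferentiableAt (by simp)
      have h3 : mfderiv 𝓘(ℝ, ℝ × ℝ) (𝓡 2) (e.symm ∘ fun q => F (toPair.symm q)) q =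
          (mfderiv 𝓘(ℝ, Plane) (𝓡 2) e.symm (F (toPair.symm q))).comp
            (mfderiv 𝓘(ℝ, ℝ × ℝ) 𝓘(ℝ, Plane) (fun q => F (toPair.symm q)) q) :=
        mfderiv_comp q h1 hd.differentiableAt.mdifferentiableAt
      rw [mfderiv_eq_fderiv, hd.fderiv] at h3
      change Function.Injective
        (mfderiv 𝓘(ℝ, ℝ × ℝ) (𝓡 2) (e.symm ∘ fun q => F (toPair.symm q)) q)
      rw [h3]
      exact (injective_mfderiv_symm he hm).comp ((hsq q hq).2.1.comp toPair.symm.injective)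
  · intro q hq q' hq' hqq'
    exact (hsq q hq).2.2 q' hq'
      (e.symm.injOn (hFmem _ (hUD q hq)) (hFmem _ (hUD q' hq')) hqq')
  · have hp : γ 0 = p := by
      simp only [hγ, hc0]
      exact e.left_inv hps
    have hv : (velocity γ 0 : Plane) = w := by
      have h1 := velocity_chart_symm he hc0' (by rw [hc0]; exact hy₀)
      rw [hc0] at h1
      exact h1.trans hback
    exact Bundle.TotalSpace.ext hp (heq_of_eq hv)

end FermiExistence

end LorentzSurface

namespace LorentzSurface

/-! ### Fermi-type coordinates in constant curvature -/

section FermiCharts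

set_option synthInstance.maxHeartbeats 200000

variable {M : Type*} [TopologicalSpace M] [ChartedSpace Plane M] [IsManifold (𝓡 2) ∞ M]
  {g : LorentzMetric M} {K ε : ℝ} {S T : ℝ → ℝ}

/-- `S` and `T` are the cosine and sine type solutions of `φ'' = εKφ`; keeping them abstract treats
all signs of `εK` at once. -/
theorem fermiExpression_of_constantCurvature (hg : HasConstantCurvature g K)
    (hε : ε ^ 2 = 1) (hS : ∀ u, HasDerivAt S (ε * K * T u) u) (hT : ∀ u, HasDerivAt T (S u) u)
    (hST : ∀ u, S u ^ 2 - ε * K * T u ^ 2 = 1) (hS0 : S 0 = 1) (hT0 : T 0 = 0) :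
    FermiExpression g ε (fun _ => -ε) (fun u => ε * S u ^ 2) := by
  refine ⟨fun p w hw => exists_isFermi g hε p w hw, fun I γ U x hx q hq => ?_⟩
  have hy : toPair (toPair.symm q) ∈ U := by rwa [toPair.apply_symm_apply]
  have hpull := pullForm_comp_toPair (g := g) hx.isOpen_domain hx.contMDiffOn hy
  have h00 := hpull (basisVec 0) (basisVec 0)
  have h01 := hpull (basisVec 0) (basisVec 1)
  have h11 := hpull (basisVec 1) (basisVec 1)
  rw [toPair_basisVec_zero] at h00 h01
  rw [toPair_basisVec_one] at h01 h11
  rw [toPair.apply_symm_apply] at h00 h01 h11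
  obtain ⟨e00, e01, e11⟩ := hx.metric_eq hg hε hS hT hST hS0 hT0 _ hy
  exact ⟨h00.symm.trans e00, h01.symm.trans e01, h11.symm.trans e11⟩

lemma LorentzMetric.exists_unit (g : LorentzMetric M) (hε : ε ^ 2 = 1) (p : M) :
    ∃ w : TangentSpace (𝓡 2) p, g.val p w w = ε := by
  have h : ∃ X : Plane, 0 < ε * g.form p X X := by
    rcases sq_eq_one_iff.1 hε with rfl | rfl
    · obtain ⟨X, hX⟩ := g.exists_spacelike p
      exact ⟨X, by rw [one_mul]; exact hX⟩
    · obtain ⟨X, hX⟩ := g.exists_timelike p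
      exact ⟨X, by rw [neg_one_mul]; exact neg_pos.2 hX⟩
  obtain ⟨X, hX⟩ := h
  have hw : g.form p ((Real.sqrt (ε * g.form p X X))⁻¹ • X)
      ((Real.sqrt (ε * g.form p X X))⁻¹ • X) = ε := by
    have hs := Real.sq_sqrt hX.le
    have hs0 := (Real.sqrt_pos.2 hX).ne'
    simp only [map_smul, smul_apply, smul_eq_mul]
    set r := Real.sqrt (ε * g.form p X X)
    field_simp
    rw [hs]
    linear_combination -g.form p X X * hε
  exact ⟨_, hw⟩

/-- Around every point there is a chart whose inverse is a Fermi-type coordinate system. -/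
theorem exists_fermi_chart (hg : HasConstantCurvature g K)
    (hε : ε ^ 2 = 1) (hS : ∀ u, HasDerivAt S (ε * K * T u) u) (hT : ∀ u, HasDerivAt T (S u) u)
    (hST : ∀ u, S u ^ 2 - ε * K * T u ^ 2 = 1) (hS0 : S 0 = 1) (hT0 : T 0 = 0) (p : M) :
    ∃ e ∈ IsManifold.maximalAtlas (𝓡 2) ∞ M, p ∈ e.source ∧ e p = 0 ∧ ∀ y ∈ e.target,
      pullForm g e.symm y (basisVec 0) (basisVec 0) = -ε ∧
      pullForm g e.symm y (basisVec 0) (basisVec 1) = 0 ∧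
      pullForm g e.symm y (basisVec 1) (basisVec 1) = ε * S (y 0) ^ 2 := by
  obtain ⟨w, hw⟩ := g.exists_unit hε p
  obtain ⟨I, γ, U, x, hx, -, h0I, hpw⟩ := exists_isFermi g hε p w hw
  have hp : γ 0 = p := congrArg Bundle.TotalSpace.proj hpw
  have hV : IsOpen (toPair ⁻¹' U) := hx.isOpen_domain.preimage toPair.continuous
  have h0 : (0 : Plane) ∈ toPair ⁻¹' U := by
    rw [mem_preimage, map_zero]
    exact hx.zero_mem 0 h0I
  obtain ⟨e, he, h0e, heV, heq⟩ := exists_chart_of_regular hV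
    (contMDiffOn_comp_toPair hx.contMDiffOn) (fun y hy => hx.injective_mfderiv hy) h0
  have hep : e.symm 0 = p := by
    rw [heq h0e, ← hp]
    change x (toPair 0) = γ 0
    rw [map_zero]
    exact hx.slice_start 0 h0I
  refine ⟨e, he, hep ▸ e.map_target h0e, by rw [← hep, e.right_inv h0e], fun y hy => ?_⟩
  have h1 : pullForm g e.symm y = pullForm g (fun z => x (toPair z)) y := by
    refine pullForm_congr g ?_
    filter_upwards [e.open_target.mem_nhds hy] with z hz
    exact heq hz
  rw [h1]
  exact hx.metric_eq hg hε hS hT hST hS0 hT0 y (heV hy)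

end FermiCharts

end LorentzSurface

namespace LorentzSurface

/-! ### Surfaces with a warped parametrisation -/

section Models

set_option synthInstance.maxHeartbeats 200000

variable {n : ℕ} {s : ℕ}

lemma pair_add_left (x y z : Fin n → ℝ) : pair s (x + y) z = pair s x z + pair s y z := by
  simp only [pair, Pi.add_apply, ← Finset.sum_add_distrib]
  exact Finset.sum_congr rfl fun i _ => by ring

lemma pair_smul_left (a : ℝ) (x y : Fin n → ℝ) : pair s (a • x) y = a * pair s x y := by
  simp only [pair, Pi.smul_apply, smul_eq_mul, Finset.mul_sum]
  exact Finset.sum_congr rfl fun i _ => by ring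

lemma pair_comm (x y : Fin n → ℝ) : pair s x y = pair s y x := by
  simp only [pair, mul_comm]

lemma pair_linear_plane (L : Plane →L[ℝ] Fin n → ℝ) (X Y : Plane) :
    pair s (L X) (L Y) = X 0 * Y 0 * pair s (L (basisVec 0)) (L (basisVec 0)) +
      (X 0 * Y 1 + X 1 * Y 0) * pair s (L (basisVec 0)) (L (basisVec 1)) +
      X 1 * Y 1 * pair s (L (basisVec 1)) (L (basisVec 1)) := by
  have h : ∀ x : Fin n → ℝ, pair s x (L Y) =
      Y 0 * pair s x (L (basisVec 0)) + Y 1 * pair s x (L (basisVec 1)) := by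
    intro x
    rw [linear_plane_apply L Y, pair_comm, pair_add_left, pair_smul_left, pair_smul_left,
      pair_comm _ x, pair_comm _ x]
  rw [linear_plane_apply L X, pair_add_left, pair_smul_left, pair_smul_left, h, h,
    pair_comm (L (basisVec 1)) (L (basisVec 0))]
  ring

/-- `Y` is a smooth parametrisation of all of `Q ⊆ ℝⁿₛ`, in which the induced metric is
`-ε du² + ε S(u)² dv²`, and which has a smooth inverse near the origin. -/
structure IsWarpedParam (s : ℕ) (Q : Set (Fin n → ℝ)) (ε : ℝ) (S : ℝ → ℝ)
    (Y : Plane → Fin n → ℝ) : Prop where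
  contDiff : ContDiff ℝ ∞ Y
  mem : ∀ y, Y y ∈ Q
  surj : ∀ z ∈ Q, ∃ y, Y y = z
  pair_zero_zero : ∀ y, pair s (fderiv ℝ Y y (basisVec 0)) (fderiv ℝ Y y (basisVec 0)) = -ε
  pair_zero_one : ∀ y, pair s (fderiv ℝ Y y (basisVec 0)) (fderiv ℝ Y y (basisVec 1)) = 0
  pair_one_one : ∀ y, pair s (fderiv ℝ Y y (basisVec 1)) (fderiv ℝ Y y (basisVec 1)) =
    ε * S (y 0) ^ 2
  exists_inverse : ∃ (V : Set Plane) (W : Set (Fin n → ℝ)) (ψ : (Fin n → ℝ) → Plane),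
    IsOpen V ∧ IsOpen W ∧ 0 ∈ V ∧ ContDiffOn ℝ ∞ ψ W ∧
    (∀ y ∈ V, Y y ∈ W ∧ ψ (Y y) = y) ∧ ∀ z ∈ Q, z ∈ W → ψ z ∈ V ∧ Y (ψ z) = z

variable {M : Type*} [TopologicalSpace M] [ChartedSpace Plane M] [IsManifold (𝓡 2) ∞ M]
  {g : LorentzMetric M} {K κ ε : ℝ} {S T : ℝ → ℝ} {Q : Set (Fin n → ℝ)} {Y : Plane → Fin n → ℝ}

lemma partialDeriv_zero_of_hasDerivAt {f f' : ℝ → ℝ} (hf : ∀ u, HasDerivAt f (f' u) u) :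
    partialDeriv 0 (fun y => f (y 0)) = fun y => f' (y 0) := by
  funext y
  have h1 : HasFDerivAt (fun y : Plane => y 0) (EuclideanSpace.proj 0 : Plane →L[ℝ] ℝ) y :=
    (EuclideanSpace.proj 0 : Plane →L[ℝ] ℝ).hasFDerivAt
  have h2 := (hf (y 0)).comp_hasFDerivAt y h1
  change fderiv ℝ (f ∘ fun y : Plane => y 0) y _ = _
  rw [h2.fderiv]
  simp

/-- The curvature of a surface that is locally isometric to a surface of revolution. -/
theorem curvature_eq_of_isLocallyIsometricTo [Nonempty M] (hg : HasConstantCurvature g K)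
    (hl : IsLocallyIsometricTo g s Q) (hY : IsWarpedParam s Q ε S Y) (hε : ε ^ 2 = 1)
    (hS : ∀ u, HasDerivAt S (ε * κ * T u) u) (hT : ∀ u, HasDerivAt T (S u) u)
    (hSs : ContDiff ℝ ∞ S) (hS0 : ∀ u, S u ≠ 0) : K = κ := by
  have hε0 : ε ≠ 0 := by
    rintro rfl
    norm_num at hε
  obtain ⟨p⟩ := ‹Nonempty M›
  obtain ⟨φ, hp, hφ, hψ, hmet⟩ := hl p
  -- The isometry may take `p` to any point of the model, so the parametrisation has to reach all of
  -- `Q`.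
  obtain ⟨y₀, hy₀⟩ := hY.surj _ (φ p).2
  obtain ⟨W, ψ, hW, hzW, hψs, hψφ⟩ := hψ _ (φ.map_source hp)
  obtain ⟨N, hN, hNφ⟩ := isOpen_induced_iff.1 φ.open_target
  have htgt : ∀ z : Q, (z : Fin n → ℝ) ∈ N ↔ z ∈ φ.target := fun z => by
    rw [← hNφ]
    rfl
  set V : Set Plane := Y ⁻¹' (W ∩ N) with hVdef
  have hV : IsOpen V := (hW.inter hN).preimage hY.contDiff.continuous
  have hy₀V : y₀ ∈ V := by
    rw [hVdef, mem_preimage, hy₀]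
    exact ⟨hzW, (htgt _).2 (φ.map_source hp)⟩
  -- Following the model parametrisation by the inverse isometry gives coordinates on `M` in which
  -- the metric is the warped one.
  set x : Plane → M := fun y => ψ (Y y) with hx
  have hxφ : ∀ y ∈ V, x y ∈ φ.source ∧ (φ (x y) : Fin n → ℝ) = Y y := by
    intro y hy
    have h1 : (⟨Y y, hY.mem y⟩ : Q) ∈ φ.target := (htgt _).1 hy.2
    have h2 : x y = φ.symm ⟨Y y, hY.mem y⟩ := hψφ _ h1 hy.1
    rw [h2, φ.right_inv h1]
    exact ⟨φ.map_target h1, rfl⟩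
  have hxs : ContMDiffOn 𝓘(ℝ, Plane) (𝓡 2) ∞ x V :=
    hψs.comp hY.contDiff.contMDiff.contMDiffOn fun y hy => hy.1
  have hpull : ∀ y ∈ V, ∀ A B : Plane,
      pullForm g x y A B = pair s (fderiv ℝ Y y A) (fderiv ℝ Y y B) := by
    intro y hy A B
    have h1 : MDifferentiableAt 𝓘(ℝ, Plane) (𝓡 2) x y :=
      (hxs.contMDiffAt (hV.mem_nhds hy)).mdifferentiableAt (by simp)
    have h2 : MDifferentiableAt (𝓡 2) 𝓘(ℝ, Fin n → ℝ) (fun q => (φ q : Fin n → ℝ)) (x y) :=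
      (hφ.contMDiffAt (φ.open_source.mem_nhds (hxφ y hy).1)).mdifferentiableAt (by simp)
    have h3 : mfderiv 𝓘(ℝ, Plane) 𝓘(ℝ, Fin n → ℝ) ((fun q => (φ q : Fin n → ℝ)) ∘ x) y =
        (mfderiv (𝓡 2) 𝓘(ℝ, Fin n → ℝ) (fun q => (φ q : Fin n → ℝ)) (x y)).comp
          (mfderiv 𝓘(ℝ, Plane) (𝓡 2) x y) := mfderiv_comp y h2 h1
    have h4 : (fun q => (φ q : Fin n → ℝ)) ∘ x =ᶠ[𝓝 y] Y := by
      filter_upwards [hV.mem_nhds hy] with z hz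
      exact (hxφ z hz).2
    rw [mfderiv_eq_fderiv, h4.fderiv_eq] at h3
    rw [pullForm_apply, ← hmet _ (hxφ y hy).1, h3]
    rfl
  have h00 : ∀ y ∈ V, pullForm g x y (basisVec 0) (basisVec 0) = -ε := fun y hy =>
    (hpull y hy _ _).trans (hY.pair_zero_zero y)
  have h01 : ∀ y ∈ V, pullForm g x y (basisVec 0) (basisVec 1) = 0 := fun y hy =>
    (hpull y hy _ _).trans (hY.pair_zero_one y)
  have h11 : ∀ y ∈ V, pullForm g x y (basisVec 1) (basisVec 1) = ε * S (y 0) ^ 2 := fun y hy =>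
    (hpull y hy _ _).trans (hY.pair_one_one y)
  have h10 : ∀ y ∈ V, pullForm g x y (basisVec 1) (basisVec 0) = 0 := fun y hy =>
    (pullForm_symm g x y _ _).trans (h01 y hy)
  -- A vector killed by the differential is orthogonal to everything for the pulled back form, which
  -- is nondegenerate because `S` has no zeros.
  have hreg : ∀ y ∈ V, Function.Injective (mfderiv 𝓘(ℝ, Plane) (𝓡 2) x y) := by
    intro y hy
    change Function.Injective (planeDeriv x y)
    rw [injective_iff_map_eq_zero]
    intro A hA
    have h1 : ∀ B, pullForm g x y A B = 0 := fun B => by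
      change g.form (x y) (planeDeriv x y A) _ = 0
      rw [hA, map_zero]
      rfl
    have h2 := h1 (basisVec 0)
    have h3 := h1 (basisVec 1)
    rw [linear_plane_apply (pullForm g x y) A] at h2 h3
    simp only [add_apply, smul_apply, smul_eq_mul, h00 y hy, h01 y hy, h10 y hy, h11 y hy,
      mul_zero, add_zero, zero_add] at h2 h3
    have h4 : A 0 = 0 := (mul_eq_zero.1 h2).resolve_right (neg_ne_zero.2 hε0)
    have h5 : A 1 = 0 :=
      (mul_eq_zero.1 h3).resolve_right (mul_ne_zero hε0 (pow_ne_zero 2 (hS0 _)))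
    rw [plane_eq_sum A, h4, h5, zero_smul, zero_smul, add_zero]
  have hG1 : partialDeriv 0 (fun y : Plane => ε * S (y 0) ^ 2) =
      fun y => 2 * ε * S (y 0) * (ε * κ * T (y 0)) :=
    partialDeriv_zero_of_hasDerivAt (f := fun u => ε * S u ^ 2)
      (f' := fun u => 2 * ε * S u * (ε * κ * T u)) fun u => by
        refine (((hS u).pow 2).const_mul ε).congr_deriv ?_
        push_cast
        ring
  have hG2 : partialDeriv 0 (fun y : Plane => 2 * ε * S (y 0) * (ε * κ * T (y 0))) =
      fun y => 2 * ε * (ε * κ * T (y 0)) * (ε * κ * T (y 0)) +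
        2 * ε * S (y 0) * (ε * κ * S (y 0)) :=
    partialDeriv_zero_of_hasDerivAt (f := fun u => 2 * ε * S u * (ε * κ * T u))
      (f' := fun u => 2 * ε * (ε * κ * T u) * (ε * κ * T u) + 2 * ε * S u * (ε * κ * S u))
      fun u => ((hS u).const_mul (2 * ε)).mul ((hT u).const_mul (ε * κ))
  have hsm : ContDiff ℝ ∞ fun y : Plane => ε * S (y 0) ^ 2 :=
    contDiff_const.mul ((hSs.comp (EuclideanSpace.proj 0 : Plane →L[ℝ] ℝ).contDiff).pow 2)
  have hcurv := gaussCurvature_orthogonal (h := fun z => formMatrix (pullForm g x z))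
    (neg_ne_zero.2 hε0) (hsm.contDiffAt (x := y₀))
    (mul_ne_zero hε0 (pow_ne_zero 2 (hS0 _))) (by
      filter_upwards [hV.mem_nhds hy₀V] with z hz
      exact formMatrix_eq (h00 z hz) (h01 z hz) (h10 z hz) (h11 z hz))
  rw [gaussCurvature_pullForm hg hV hxs hreg hy₀V, hG1, hG2] at hcurv
  have hs := hS0 (y₀ 0)
  have hdiv : (2 * ε * S (y₀ 0) * (ε * κ * T (y₀ 0))) ^ 2 / (4 * (ε * S (y₀ 0) ^ 2)) =
      ε * (ε * κ * T (y₀ 0)) ^ 2 := by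
    field_simp
    ring
  simp only [hdiv] at hcurv
  have hfin : S (y₀ 0) ^ 2 * (K - κ) = 0 := by
    linear_combination -hcurv - S (y₀ 0) ^ 2 * (K - κ) * hε
  exact sub_eq_zero.1 ((mul_eq_zero.1 hfin).resolve_left (pow_ne_zero 2 hs))

/-- A chart of `M` and the model parametrisation have the same metric coefficients, so `Y ∘ e` is an
isometry. Every point of `M` is the origin of such a chart, so an inverse of `Y` near the origin
suffices. -/
theorem isLocallyIsometricTo_of_charts (hY : IsWarpedParam s Q ε S Y)
    (hc : ∀ p : M, ∃ e ∈ IsManifold.maximalAtlas (𝓡 2) ∞ M, p ∈ e.source ∧ e p = 0 ∧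
      ∀ y ∈ e.target,
        pullForm g e.symm y (basisVec 0) (basisVec 0) = -ε ∧
        pullForm g e.symm y (basisVec 0) (basisVec 1) = 0 ∧
        pullForm g e.symm y (basisVec 1) (basisVec 1) = ε * S (y 0) ^ 2) :
    IsLocallyIsometricTo g s Q := by
  obtain ⟨V, W, ψ, hV, hW, h0V, hψ, hVW, hQ⟩ := hY.exists_inverse
  let Φ : OpenPartialHomeomorph Plane Q :=
    { toFun := fun y => ⟨Y y, hY.mem y⟩
      invFun := fun z => ψ z
      source := V
      target := Subtype.val ⁻¹' W
      map_source' := fun y hy => (hVW y hy).1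
      map_target' := fun z hz => (hQ z z.2 hz).1
      left_inv' := fun y hy => (hVW y hy).2
      right_inv' := fun z hz => Subtype.ext (hQ z z.2 hz).2
      open_source := hV
      open_target := hW.preimage continuous_subtype_val
      continuousOn_toFun := (hY.contDiff.continuous.subtype_mk hY.mem).continuousOn
      continuousOn_invFun :=
        hψ.continuousOn.comp continuous_subtype_val.continuousOn fun z hz => hz }
  intro p
  obtain ⟨e, he, hp, hp0, hmet⟩ := hc p
  have heS := contMDiffOn_of_mem_maximalAtlas he
  have heD : e.MDifferentiable (𝓡 2) (𝓡 2) :=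
    ⟨heS.mdifferentiableOn (by simp),
      (contMDiffOn_symm_of_mem_maximalAtlas he).mdifferentiableOn (by simp)⟩
  refine ⟨e.trans Φ, ⟨hp, ?_⟩, ?_, ?_, ?_⟩
  · change e p ∈ V
    rwa [hp0]
  · exact hY.contDiff.contMDiff.comp_contMDiffOn (heS.mono fun q hq => hq.1)
  · intro z hz
    refine ⟨W ∩ ψ ⁻¹' e.target, fun z => e.symm (ψ z),
      hψ.continuousOn.isOpen_inter_preimage hW e.open_target, ⟨hz.1, hz.2⟩, ?_, fun z' _ _ => rfl⟩
    exact (contMDiffOn_symm_of_mem_maximalAtlas he).comp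
      (contMDiffOn_iff_contDiffOn.2 (hψ.mono inter_subset_left)) fun z hz => hz.2
  · intro q hq A B
    have h3 : mfderiv (𝓡 2) 𝓘(ℝ, Fin n → ℝ) (Y ∘ e) q =
        (mfderiv 𝓘(ℝ, Plane) 𝓘(ℝ, Fin n → ℝ) Y (e q)).comp (mfderiv (𝓡 2) (𝓡 2) e q) :=
      mfderiv_comp q (hY.contDiff.contMDiff.mdifferentiableAt (by simp))
        (heD.mdifferentiableAt hq.1)
    rw [mfderiv_eq_fderiv] at h3
    set A' : Plane := mfderiv (𝓡 2) (𝓡 2) e q A with hA'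
    set B' : Plane := mfderiv (𝓡 2) (𝓡 2) e q B with hB'
    have hinv := heD.symm_comp_deriv hq.1
    have hA : planeDeriv e.symm (e q) A' = A := DFunLike.congr_fun hinv A
    have hB : planeDeriv e.symm (e q) B' = B := DFunLike.congr_fun hinv B
    have h4 : pullForm g e.symm (e q) A' B' = g.val q A B := by
      change g.form (e.symm (e q)) (planeDeriv e.symm (e q) A')
        (planeDeriv e.symm (e q) B') = g.form q A B
      rw [hA, hB, e.left_inv hq.1]
    obtain ⟨m00, m01, m11⟩ := hmet _ (e.map_source hq.1)
    rw [← h4, form_apply, pullForm_symm g _ _ (basisVec 1) (basisVec 0), m00, m01, m11]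
    change pair s (mfderiv (𝓡 2) 𝓘(ℝ, Fin n → ℝ) (Y ∘ e) q A)
      (mfderiv (𝓡 2) 𝓘(ℝ, Fin n → ℝ) (Y ∘ e) q B) = _
    rw [h3]
    change pair s (fderiv ℝ Y (e q) A') (fderiv ℝ Y (e q) B') = _
    rw [pair_linear_plane, hY.pair_zero_zero, hY.pair_zero_one, hY.pair_one_one]
    ring

end Models

end LorentzSurface

namespace LorentzSurface

/-! ### Parametrisations of the three model surfaces -/

section StandardModels

lemma contDiff_coord (i : Fin 2) : ContDiff ℝ ∞ fun y : Plane => y i :=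
  (EuclideanSpace.proj i : Plane →L[ℝ] ℝ).contDiff

section

variable {E : Type*} [NormedAddCommGroup E] [NormedSpace ℝ E] {F : Plane → E} {y : Plane} {w : E}

lemma fderiv_basisVec_zero (hF : DifferentiableAt ℝ F y)
    (h : HasDerivAt (fun r => F (toPair.symm (r, y 1))) w (y 0)) :
    fderiv ℝ F y (basisVec 0) = w := by
  have h1 : HasFDerivAt F (fderiv ℝ F y) (toPair.symm (y 0, y 1)) := by
    rw [toPair_symm_coords]
    exact hF.hasFDerivAt
  have h2 : HasDerivAt (fun r => F (toPair.symm (r, y 1))) (fderiv ℝ F y (basisVec 0)) (y 0) :=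
    HasFDerivAt.comp_hasDerivAt (f := fun r : ℝ => toPair.symm (r, y 1)) (l := F) (y 0) h1
      (hasDerivAt_toPair_symm_left (y 0) (y 1))
  exact h2.unique h

lemma fderiv_basisVec_one (hF : DifferentiableAt ℝ F y)
    (h : HasDerivAt (fun r => F (toPair.symm (y 0, r))) w (y 1)) :
    fderiv ℝ F y (basisVec 1) = w := by
  have h1 : HasFDerivAt F (fderiv ℝ F y) (toPair.symm (y 0, y 1)) := by
    rw [toPair_symm_coords]
    exact hF.hasFDerivAt
  have h2 : HasDerivAt (fun r => F (toPair.symm (y 0, r))) (fderiv ℝ F y (basisVec 1)) (y 1) :=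
    HasFDerivAt.comp_hasDerivAt (f := fun r : ℝ => toPair.symm (y 0, r)) (l := F) (y 1) h1
      (hasDerivAt_toPair_symm_right (y 0) (y 1))
  exact h2.unique h

end

lemma pair_one_fin_two (x y : Fin 2 → ℝ) : pair 1 x y = x 0 * y 0 - x 1 * y 1 := by
  simp [pair, Fin.sum_univ_two]
  ring

lemma pair_one_fin_three (x y : Fin 3 → ℝ) :
    pair 1 x y = x 0 * y 0 + x 1 * y 1 - x 2 * y 2 := by
  simp [pair, Fin.sum_univ_three]
  ring

lemma pair_two_fin_three (x y : Fin 3 → ℝ) :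
    pair 2 x y = x 0 * y 0 - x 1 * y 1 - x 2 * y 2 := by
  simp [pair, Fin.sum_univ_three]
  ring

/-- The coordinates are swapped because `u` is timelike for `ε = 1`, while the minus sign of `pair
1` sits on the last coordinate. -/
theorem isWarpedParam_plane :
    IsWarpedParam 1 (univ : Set (Fin 2 → ℝ)) 1 (fun _ => 1) fun y => ![y 1, y 0] := by
  have hs : ContDiff ℝ ∞ fun y : Plane => ![y 1, y 0] := by
    rw [contDiff_pi]
    intro i
    fin_cases i
    · exact contDiff_coord 1
    · exact contDiff_coord 0
  have hd : ∀ y, DifferentiableAt ℝ (fun y : Plane => ![y 1, y 0]) y := fun y =>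
    hs.differentiable (by simp) y
  have h0 : ∀ y : Plane, fderiv ℝ (fun y : Plane => ![y 1, y 0]) y (basisVec 0) = ![0, 1] := by
    intro y
    refine fderiv_basisVec_zero (hd y) (hasDerivAt_pi.2 fun i => ?_)
    fin_cases i
    · exact hasDerivAt_const _ _
    · exact hasDerivAt_id _
  have h1 : ∀ y : Plane, fderiv ℝ (fun y : Plane => ![y 1, y 0]) y (basisVec 1) = ![1, 0] := by
    intro y
    refine fderiv_basisVec_one (hd y) (hasDerivAt_pi.2 fun i => ?_)
    fin_cases i
    · exact hasDerivAt_id _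
    · exact hasDerivAt_const _ _
  refine ⟨hs, fun y => mem_univ _, fun z _ => ⟨toPair.symm (z 1, z 0), ?_⟩, fun y => ?_,
    fun y => ?_, fun y => ?_, univ, univ, fun z => toPair.symm (z 1, z 0), isOpen_univ,
    isOpen_univ, mem_univ _, ?_, fun y _ => ⟨mem_univ _, toPair_symm_coords y⟩,
    fun z _ _ => ⟨mem_univ _, ?_⟩⟩
  · ext i
    fin_cases i <;> rfl
  · simp [h0, pair_one_fin_two]
  · simp [h0, h1, pair_one_fin_two]
  · simp [h1, pair_one_fin_two]
  · exact (toPair.symm.contDiff.comp ((contDiff_apply ℝ ℝ 1).prodMk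
      (contDiff_apply ℝ ℝ 0))).contDiffOn
  · ext i
    fin_cases i <;> rfl

/-- Polar coordinates: every vector of the plane is `(r cos θ, r sin θ)`. -/
lemma exists_polar (a b : ℝ) {r : ℝ} (hr : 0 < r) (h : a ^ 2 + b ^ 2 = r ^ 2) :
    ∃ θ, r * Real.cos θ = a ∧ r * Real.sin θ = b := by
  have hn : ‖(⟨a, b⟩ : ℂ)‖ = r := by
    rw [Complex.norm_def, Complex.normSq_mk, ← sq, ← sq, h, Real.sqrt_sq hr.le]
  refine ⟨Complex.arg ⟨a, b⟩, ?_, ?_⟩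
  · rw [← hn]
    exact Complex.norm_mul_cos_arg _
  · rw [← hn]
    exact Complex.norm_mul_sin_arg _

/-- In the right half-plane `arctan (b / a)` is a smooth polar angle, which supplies the local
inverses of the model parametrisations. -/
lemma polar_arctan {a b r : ℝ} (ha : 0 < a) (hr : 0 < r) (h : a ^ 2 + b ^ 2 = r ^ 2) :
    r * Real.cos (Real.arctan (b / a)) = a ∧ r * Real.sin (Real.arctan (b / a)) = b := by
  have h1 : Real.sqrt (1 + (b / a) ^ 2) = r / a := by
    rw [show 1 + (b / a) ^ 2 = (r / a) ^ 2 by field_simp; linarith,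
      Real.sqrt_sq (by positivity)]
  rw [Real.cos_arctan, Real.sin_arctan, h1]
  constructor <;> field_simp

lemma arctan_polar {r θ : ℝ} (hr : 0 < r) (h1 : -(Real.pi / 2) < θ) (h2 : θ < Real.pi / 2) :
    Real.arctan (r * Real.sin θ / (r * Real.cos θ)) = θ := by
  rw [mul_div_mul_left _ _ hr.ne', ← Real.tan_eq_sin_div_cos, Real.arctan_tan h1 h2]

lemma cosh_sq_arsinh (a : ℝ) : Real.cosh (Real.arsinh a) ^ 2 = 1 + a ^ 2 := by
  rw [Real.cosh_sq, Real.sinh_arsinh, add_comm]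

/-- The strip on which the angular coordinate lies in `(-π/2, π/2)`. -/
lemma isOpen_strip : IsOpen {y : Plane | -(Real.pi / 2) < y 1 ∧ y 1 < Real.pi / 2} :=
  (isOpen_lt continuous_const (contDiff_coord 1).continuous).inter
    (isOpen_lt (contDiff_coord 1).continuous continuous_const)

/-- De Sitter space is the hyperboloid obtained by rotating the curve `(cosh u, 0, sinh u)` about
the timelike axis. With `ε = 1` the warping function `cosh` never vanishes and the parametrisation
covers everything. -/
theorem isWarpedParam_pseudoSphere :
    IsWarpedParam 1 (pseudoSphere 2 1) 1 Real.cosh fun y =>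
      ![Real.cosh (y 0) * Real.cos (y 1), Real.cosh (y 0) * Real.sin (y 1), Real.sinh (y 0)] := by
  set Y : Plane → Fin 3 → ℝ := fun y =>
    ![Real.cosh (y 0) * Real.cos (y 1), Real.cosh (y 0) * Real.sin (y 1), Real.sinh (y 0)]
  have c0 := contDiff_coord 0
  have c1 := contDiff_coord 1
  have hs : ContDiff ℝ ∞ Y := by
    rw [contDiff_pi]
    intro i
    fin_cases i
    · exact c0.cosh.mul c1.cos
    · exact c0.cosh.mul c1.sin
    · exact c0.sinh
  have hd : ∀ y, DifferentiableAt ℝ Y y := fun y => hs.differentiable (by simp) y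
  have h0 : ∀ y : Plane, fderiv ℝ Y y (basisVec 0) = ![Real.sinh (y 0) * Real.cos (y 1),
      Real.sinh (y 0) * Real.sin (y 1), Real.cosh (y 0)] := by
    intro y
    refine fderiv_basisVec_zero (hd y) (hasDerivAt_pi.2 fun i => ?_)
    fin_cases i
    · exact (Real.hasDerivAt_cosh (y 0)).mul_const (Real.cos (y 1))
    · exact (Real.hasDerivAt_cosh (y 0)).mul_const (Real.sin (y 1))
    · exact Real.hasDerivAt_sinh _
  have h1 : ∀ y : Plane, fderiv ℝ Y y (basisVec 1) = ![Real.cosh (y 0) * -Real.sin (y 1),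
      Real.cosh (y 0) * Real.cos (y 1), 0] := by
    intro y
    refine fderiv_basisVec_one (hd y) (hasDerivAt_pi.2 fun i => ?_)
    fin_cases i
    · exact (Real.hasDerivAt_cos (y 1)).const_mul (Real.cosh (y 0))
    · exact (Real.hasDerivAt_sin (y 1)).const_mul (Real.cosh (y 0))
    · exact hasDerivAt_const (y 1) (Real.sinh (y 0))
  have hQ : ∀ z : Fin 3 → ℝ, z ∈ pseudoSphere 2 1 ↔ z 0 ^ 2 + z 1 ^ 2 - z 2 ^ 2 = 1 := fun z => by
    simp only [pseudoSphere, mem_ofPred_eq, pair_one_fin_three, sq]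
  have hcosh : ∀ z ∈ pseudoSphere 2 1, z 0 ^ 2 + z 1 ^ 2 = Real.cosh (Real.arsinh (z 2)) ^ 2 :=
    fun z hz => by
      rw [cosh_sq_arsinh]
      linarith [(hQ z).1 hz]
  refine ⟨hs, fun y => (hQ _).2 ?_, fun z hz => ?_, fun y => ?_, fun y => ?_, fun y => ?_,
    {y | -(Real.pi / 2) < y 1 ∧ y 1 < Real.pi / 2}, {z | 0 < z 0},
    fun z => toPair.symm (Real.arsinh (z 2), Real.arctan (z 1 / z 0)), isOpen_strip,
    isOpen_lt continuous_const (continuous_apply 0), ?_, ?_, fun y hy => ⟨?_, ?_⟩,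
    fun z hz hz0 => ⟨⟨Real.neg_pi_div_two_lt_arctan _, Real.arctan_lt_pi_div_two _⟩, ?_⟩⟩
  · change (Real.cosh (y 0) * Real.cos (y 1)) ^ 2 + (Real.cosh (y 0) * Real.sin (y 1)) ^ 2 -
      Real.sinh (y 0) ^ 2 = 1
    linear_combination Real.cosh (y 0) ^ 2 * Real.sin_sq_add_cos_sq (y 1) +
      Real.cosh_sq (y 0)
  · obtain ⟨θ, hc, hsn⟩ := exists_polar _ _ (Real.cosh_pos (Real.arsinh (z 2))) (hcosh z hz)
    refine ⟨toPair.symm (Real.arsinh (z 2), θ), ?_⟩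
    ext i
    fin_cases i
    · exact hc
    · exact hsn
    · exact Real.sinh_arsinh _
  · rw [h0, pair_one_fin_three]
    change Real.sinh (y 0) * Real.cos (y 1) * (Real.sinh (y 0) * Real.cos (y 1)) +
      Real.sinh (y 0) * Real.sin (y 1) * (Real.sinh (y 0) * Real.sin (y 1)) -
      Real.cosh (y 0) * Real.cosh (y 0) = -1
    linear_combination Real.sinh (y 0) ^ 2 * Real.sin_sq_add_cos_sq (y 1) -
      Real.cosh_sq (y 0)
  · rw [h0, h1, pair_one_fin_three]
    change Real.sinh (y 0) * Real.cos (y 1) * (Real.cosh (y 0) * -Real.sin (y 1)) +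
      Real.sinh (y 0) * Real.sin (y 1) * (Real.cosh (y 0) * Real.cos (y 1)) -
      Real.cosh (y 0) * 0 = 0
    ring
  · rw [h1, pair_one_fin_three]
    change Real.cosh (y 0) * -Real.sin (y 1) * (Real.cosh (y 0) * -Real.sin (y 1)) +
      Real.cosh (y 0) * Real.cos (y 1) * (Real.cosh (y 0) * Real.cos (y 1)) - 0 * 0 =
      1 * Real.cosh (y 0) ^ 2
    linear_combination Real.cosh (y 0) ^ 2 * Real.sin_sq_add_cos_sq (y 1)
  · change -(Real.pi / 2) < (0 : ℝ) ∧ (0 : ℝ) < Real.pi / 2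
    constructor <;> linarith [Real.pi_pos]
  · refine toPair.symm.contDiff.comp_contDiffOn
      ((contDiff_apply ℝ ℝ 2).arsinh.contDiffOn.prodMk (ContDiffOn.arctan ?_))
    exact (contDiff_apply ℝ ℝ 1).contDiffOn.div (contDiff_apply ℝ ℝ 0).contDiffOn
      fun z hz => ne_of_gt hz
  · exact mul_pos (Real.cosh_pos _) (Real.cos_pos_of_mem_Ioo hy)
  · exact (congrArg toPair.symm (Prod.ext (Real.arsinh_sinh (y 0))
      (arctan_polar (Real.cosh_pos (y 0)) hy.1 hy.2))).trans (toPair_symm_coords y)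
  · obtain ⟨hc, hsn⟩ := polar_arctan hz0 (Real.cosh_pos (Real.arsinh (z 2))) (hcosh z hz)
    ext i
    fin_cases i
    · exact hc
    · exact hsn
    · exact Real.sinh_arsinh _

/-- Here the rotation takes place in the negative definite plane of the last two coordinates, so the
circles are timelike and `ε = -1`. This type again has warping function `cosh`; the spacelike one
would have `cos`, which has zeros. -/
theorem isWarpedParam_pseudoHyperbolic :
    IsWarpedParam 2 (pseudoHyperbolic 2 1) (-1) Real.cosh fun y =>
      ![Real.sinh (y 0), Real.cosh (y 0) * Real.cos (y 1), Real.cosh (y 0) * Real.sin (y 1)] := by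
  set Y : Plane → Fin 3 → ℝ := fun y =>
    ![Real.sinh (y 0), Real.cosh (y 0) * Real.cos (y 1), Real.cosh (y 0) * Real.sin (y 1)]
  have c0 := contDiff_coord 0
  have c1 := contDiff_coord 1
  have hs : ContDiff ℝ ∞ Y := by
    rw [contDiff_pi]
    intro i
    fin_cases i
    · exact c0.sinh
    · exact c0.cosh.mul c1.cos
    · exact c0.cosh.mul c1.sin
  have hd : ∀ y, DifferentiableAt ℝ Y y := fun y => hs.differentiable (by simp) y
  have h0 : ∀ y : Plane, fderiv ℝ Y y (basisVec 0) = ![Real.cosh (y 0),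
      Real.sinh (y 0) * Real.cos (y 1), Real.sinh (y 0) * Real.sin (y 1)] := by
    intro y
    refine fderiv_basisVec_zero (hd y) (hasDerivAt_pi.2 fun i => ?_)
    fin_cases i
    · exact Real.hasDerivAt_sinh _
    · exact (Real.hasDerivAt_cosh (y 0)).mul_const (Real.cos (y 1))
    · exact (Real.hasDerivAt_cosh (y 0)).mul_const (Real.sin (y 1))
  have h1 : ∀ y : Plane, fderiv ℝ Y y (basisVec 1) = ![0, Real.cosh (y 0) * -Real.sin (y 1),
      Real.cosh (y 0) * Real.cos (y 1)] := by
    intro y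
    refine fderiv_basisVec_one (hd y) (hasDerivAt_pi.2 fun i => ?_)
    fin_cases i
    · exact hasDerivAt_const (y 1) (Real.sinh (y 0))
    · exact (Real.hasDerivAt_cos (y 1)).const_mul (Real.cosh (y 0))
    · exact (Real.hasDerivAt_sin (y 1)).const_mul (Real.cosh (y 0))
  have hQ : ∀ z : Fin 3 → ℝ, z ∈ pseudoHyperbolic 2 1 ↔ z 0 ^ 2 - z 1 ^ 2 - z 2 ^ 2 = -1 :=
    fun z => by
      simp only [pseudoHyperbolic, mem_ofPred_eq, Nat.reduceAdd, pair_two_fin_three, sq]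
  have hcosh : ∀ z ∈ pseudoHyperbolic 2 1,
      z 1 ^ 2 + z 2 ^ 2 = Real.cosh (Real.arsinh (z 0)) ^ 2 := fun z hz => by
    rw [cosh_sq_arsinh]
    linarith [(hQ z).1 hz]
  refine ⟨hs, fun y => (hQ _).2 ?_, fun z hz => ?_, fun y => ?_, fun y => ?_, fun y => ?_,
    {y | -(Real.pi / 2) < y 1 ∧ y 1 < Real.pi / 2}, {z | 0 < z 1},
    fun z => toPair.symm (Real.arsinh (z 0), Real.arctan (z 2 / z 1)), isOpen_strip,
    isOpen_lt continuous_const (continuous_apply 1), ?_, ?_, fun y hy => ⟨?_, ?_⟩,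
    fun z hz hz0 => ⟨⟨Real.neg_pi_div_two_lt_arctan _, Real.arctan_lt_pi_div_two _⟩, ?_⟩⟩
  · change Real.sinh (y 0) ^ 2 - (Real.cosh (y 0) * Real.cos (y 1)) ^ 2 -
      (Real.cosh (y 0) * Real.sin (y 1)) ^ 2 = -1
    linear_combination -Real.cosh (y 0) ^ 2 * Real.sin_sq_add_cos_sq (y 1) -
      Real.cosh_sq (y 0)
  · obtain ⟨θ, hc, hsn⟩ := exists_polar _ _ (Real.cosh_pos (Real.arsinh (z 0))) (hcosh z hz)
    refine ⟨toPair.symm (Real.arsinh (z 0), θ), ?_⟩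
    ext i
    fin_cases i
    · exact Real.sinh_arsinh _
    · exact hc
    · exact hsn
  · rw [h0, pair_two_fin_three]
    change Real.cosh (y 0) * Real.cosh (y 0) -
      Real.sinh (y 0) * Real.cos (y 1) * (Real.sinh (y 0) * Real.cos (y 1)) -
      Real.sinh (y 0) * Real.sin (y 1) * (Real.sinh (y 0) * Real.sin (y 1)) = - -1
    linear_combination -Real.sinh (y 0) ^ 2 * Real.sin_sq_add_cos_sq (y 1) +
      Real.cosh_sq (y 0)
  · rw [h0, h1, pair_two_fin_three]
    change Real.cosh (y 0) * 0 -
      Real.sinh (y 0) * Real.cos (y 1) * (Real.cosh (y 0) * -Real.sin (y 1)) -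
      Real.sinh (y 0) * Real.sin (y 1) * (Real.cosh (y 0) * Real.cos (y 1)) = 0
    ring
  · rw [h1, pair_two_fin_three]
    change 0 * 0 - Real.cosh (y 0) * -Real.sin (y 1) * (Real.cosh (y 0) * -Real.sin (y 1)) -
      Real.cosh (y 0) * Real.cos (y 1) * (Real.cosh (y 0) * Real.cos (y 1)) =
      -1 * Real.cosh (y 0) ^ 2
    linear_combination -Real.cosh (y 0) ^ 2 * Real.sin_sq_add_cos_sq (y 1)
  · change -(Real.pi / 2) < (0 : ℝ) ∧ (0 : ℝ) < Real.pi / 2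
    constructor <;> linarith [Real.pi_pos]
  · refine toPair.symm.contDiff.comp_contDiffOn
      ((contDiff_apply ℝ ℝ 0).arsinh.contDiffOn.prodMk (ContDiffOn.arctan ?_))
    exact (contDiff_apply ℝ ℝ 2).contDiffOn.div (contDiff_apply ℝ ℝ 1).contDiffOn
      fun z hz => ne_of_gt hz
  · exact mul_pos (Real.cosh_pos _) (Real.cos_pos_of_mem_Ioo hy)
  · exact (congrArg toPair.symm (Prod.ext (Real.arsinh_sinh (y 0))
      (arctan_polar (Real.cosh_pos (y 0)) hy.1 hy.2))).trans (toPair_symm_coords y)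
  · obtain ⟨hc, hsn⟩ := polar_arctan hz0 (Real.cosh_pos (Real.arsinh (z 0))) (hcosh z hz)
    ext i
    fin_cases i
    · exact Real.sinh_arsinh _
    · exact hc
    · exact hsn

end StandardModels

end LorentzSurface

namespace LorentzSurface

/-! ### The three curvatures -/

section Classification

variable {M : Type*} [TopologicalSpace M] [ChartedSpace Plane M] [IsManifold (𝓡 2) ∞ M]
  {g : LorentzMetric M} {K ε : ℝ}

/-- The Fermi-type expression where the Jacobi equation has constant coefficient `0`. -/
lemma fermiExpression_flat (hg : HasConstantCurvature g K) (hε : ε ^ 2 = 1) (hK : ε * K = 0) :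
    FermiExpression g ε (fun _ => -ε) (fun _ => ε) := by
  have h := fermiExpression_of_constantCurvature (S := fun _ => 1) (T := id) hg hε
    (fun u => by rw [hK, zero_mul]; exact hasDerivAt_const u 1) hasDerivAt_id
    (fun u => by rw [hK]; ring) rfl rfl
  simpa using h

lemma fermiExpression_cosh (hg : HasConstantCurvature g K) (hε : ε ^ 2 = 1) (hK : ε * K = 1) :
    FermiExpression g ε (fun _ => -ε) (fun u => ε * Real.cosh u ^ 2) :=
  fermiExpression_of_constantCurvature (S := Real.cosh) (T := Real.sinh) hg hε
    (fun u => by rw [hK, one_mul]; exact Real.hasDerivAt_cosh u) Real.hasDerivAt_sinh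
    (fun u => by rw [hK, Real.cosh_sq]; ring) Real.cosh_zero Real.sinh_zero

lemma fermiExpression_cos (hg : HasConstantCurvature g K) (hε : ε ^ 2 = 1) (hK : ε * K = -1) :
    FermiExpression g ε (fun _ => -ε) (fun u => ε * Real.cos u ^ 2) :=
  fermiExpression_of_constantCurvature (S := Real.cos) (T := Real.sin) hg hε
    (fun u => by rw [hK, neg_one_mul]; exact Real.hasDerivAt_cos u) Real.hasDerivAt_sin
    (fun u => by rw [hK]; linarith [Real.sin_sq_add_cos_sq u]) Real.cos_zero Real.sin_zero

lemma isLocallyIsometricTo_plane (hg : HasConstantCurvature g 0) :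
    IsLocallyIsometricTo g 1 (univ : Set (Fin 2 → ℝ)) :=
  isLocallyIsometricTo_of_charts isWarpedParam_plane <|
    exists_fermi_chart (T := id) hg (one_pow 2)
      (fun u => by rw [mul_zero, zero_mul]; exact hasDerivAt_const u 1) hasDerivAt_id
      (fun u => by ring) rfl rfl

lemma isLocallyIsometricTo_pseudoSphere (hg : HasConstantCurvature g 1) :
    IsLocallyIsometricTo g 1 (pseudoSphere 2 1) :=
  isLocallyIsometricTo_of_charts isWarpedParam_pseudoSphere <|
    exists_fermi_chart (T := Real.sinh) hg (one_pow 2)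
      (fun u => by rw [one_mul, one_mul]; exact Real.hasDerivAt_cosh u) Real.hasDerivAt_sinh
      (fun u => by rw [Real.cosh_sq]; ring) Real.cosh_zero Real.sinh_zero

lemma isLocallyIsometricTo_pseudoHyperbolic (hg : HasConstantCurvature g (-1)) :
    IsLocallyIsometricTo g 2 (pseudoHyperbolic 2 1) :=
  isLocallyIsometricTo_of_charts isWarpedParam_pseudoHyperbolic <|
    exists_fermi_chart (T := Real.sinh) hg neg_one_sq
      (fun u => by rw [neg_one_mul, neg_neg, one_mul]; exact Real.hasDerivAt_cosh u)
      Real.hasDerivAt_sinh (fun u => by rw [Real.cosh_sq]; ring) Real.cosh_zero Real.sinh_zero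

variable [Nonempty M]

lemma curvature_of_plane (hg : HasConstantCurvature g K)
    (h : IsLocallyIsometricTo g 1 (univ : Set (Fin 2 → ℝ))) : K = 0 :=
  curvature_eq_of_isLocallyIsometricTo (T := id) hg h isWarpedParam_plane (one_pow 2)
    (fun u => by rw [mul_zero, zero_mul]; exact hasDerivAt_const u 1) hasDerivAt_id
    contDiff_const fun _ => one_ne_zero

lemma curvature_of_pseudoSphere (hg : HasConstantCurvature g K)
    (h : IsLocallyIsometricTo g 1 (pseudoSphere 2 1)) : K = 1 :=
  curvature_eq_of_isLocallyIsometricTo (T := Real.sinh) hg h isWarpedParam_pseudoSphere (one_pow 2)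
    (fun u => by rw [one_mul, one_mul]; exact Real.hasDerivAt_cosh u) Real.hasDerivAt_sinh
    Real.contDiff_cosh fun u => (Real.cosh_pos u).ne'

lemma curvature_of_pseudoHyperbolic (hg : HasConstantCurvature g K)
    (h : IsLocallyIsometricTo g 2 (pseudoHyperbolic 2 1)) : K = -1 :=
  curvature_eq_of_isLocallyIsometricTo (T := Real.sinh) hg h isWarpedParam_pseudoHyperbolic
    neg_one_sq (fun u => by rw [neg_one_mul, neg_neg, one_mul]; exact Real.hasDerivAt_cosh u)
    Real.hasDerivAt_sinh Real.contDiff_cosh fun u => (Real.cosh_pos u).ne'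

end Classification

end LorentzSurface

open LorentzSurface in
theorem mainTheorem1 {M : Type*} [TopologicalSpace M] [T2Space M] [Nonempty M]
    [ChartedSpace Plane M] [IsManifold (𝓡 2) ∞ M]
    (g : LorentzMetric M) (K : ℝ) (hK : K = -1 ∨ K = 0 ∨ K = 1)
    (hg : HasConstantCurvature g K) :
    (K = 0 →
      IsLocallyIsometricTo g 1 (Set.univ : Set (Fin 2 → ℝ)) ∧
      FermiExpression g 1 (fun _ => -1) (fun _ => 1) ∧
      FermiExpression g (-1) (fun _ => 1) (fun _ => -1)) ∧
    (K = 1 →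
      IsLocallyIsometricTo g 1 (pseudoSphere 2 1) ∧
      FermiExpression g 1 (fun _ => -1) (fun u => Real.cosh u ^ 2) ∧
      FermiExpression g (-1) (fun _ => 1) (fun τ => -Real.cos τ ^ 2)) ∧
    (K = -1 →
      IsLocallyIsometricTo g 2 (pseudoHyperbolic 2 1) ∧
      FermiExpression g 1 (fun _ => -1) (fun u => Real.cos u ^ 2) ∧
      FermiExpression g (-1) (fun _ => 1) (fun τ => -Real.cosh τ ^ 2)) ∧
    ¬ (IsLocallyIsometricTo g 1 (Set.univ : Set (Fin 2 → ℝ)) ∧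
      IsLocallyIsometricTo g 1 (pseudoSphere 2 1)) ∧
    ¬ (IsLocallyIsometricTo g 1 (Set.univ : Set (Fin 2 → ℝ)) ∧
      IsLocallyIsometricTo g 2 (pseudoHyperbolic 2 1)) ∧
    ¬ (IsLocallyIsometricTo g 1 (pseudoSphere 2 1) ∧
      IsLocallyIsometricTo g 2 (pseudoHyperbolic 2 1)) := by
  refine ⟨?_, ?_, ?_, ?_, ?_, ?_⟩
  · rintro rfl
    refine ⟨isLocallyIsometricTo_plane hg, fermiExpression_flat hg (one_pow 2) (mul_zero 1), ?_⟩
    simpa using fermiExpression_flat hg neg_one_sq (mul_zero (-1))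
  · rintro rfl
    refine ⟨isLocallyIsometricTo_pseudoSphere hg, ?_, ?_⟩
    · simpa using fermiExpression_cosh hg (one_pow 2) (mul_one 1)
    · simpa using fermiExpression_cos hg neg_one_sq (mul_one (-1))
  · rintro rfl
    refine ⟨isLocallyIsometricTo_pseudoHyperbolic hg, ?_, ?_⟩
    · simpa using fermiExpression_cos hg (one_pow 2) (one_mul (-1))
    · simpa using fermiExpression_cosh hg neg_one_sq (by norm_num : (-1 : ℝ) * -1 = 1)
  -- Each model forces its own value of `K`, so two models contradict each other.
  · rintro ⟨h₁, h₂⟩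
    linarith [curvature_of_plane hg h₁, curvature_of_pseudoSphere hg h₂]
  · rintro ⟨h₁, h₂⟩
    linarith [curvature_of_plane hg h₁, curvature_of_pseudoHyperbolic hg h₂]
  · rintro ⟨h₁, h₂⟩
    linarith [curvature_of_pseudoSphere hg h₁, curvature_of_pseudoHyperbolic hg h₂]
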